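/- Fix $0<q<1$. Let $\mathcal U_q=\mathcal U_q(\mathfrak{su}(1,1))$ be the unital complex algebra generated by $K,K^{-1},E,F$ with relations $KK^{-1}=K^{-1}K=1$, $KE=qEK$, $KF=q^{-1}FK$, $EF-FE=\frac{K^2-K^{-2}}{q-q^{-1}}$, with $*$-structure $K^*=K$, $E^*=-F$ and comultiplication $\Delta(K^{\pm1})=K^{\pm1}\otimes K^{\pm1}$, $\Delta(E)=K\otimes E+E\otimes K^{-1}$, $\Delta(F)=K\otimes F+F\otimes K^{-1}$. Consider the following $*$-representations by unbounded operators, whose domain consists of the finite linear combinations of the standard orthonormal basis vectors $e_n$ of $\ell^2(\mathbb N)$ (for $\pi^\pm_k$, $k>0$) or of $\ell^2(\mathbb Z)$ (for $\pi^{\mathrm S}_{\sigma,\varepsilon}$, $\sigma,\varepsilon\in\mathbb R$): * positive discrete series: $\pi^+_k(K)e_n=q^{k+n}e_n$, $(q^{-1}-q)\pi^+_k(E)e_n=q^{-\frac12-k-n}\sqrt{(1-q^{2n+2})(1-q^{4k+2n})}\,e_{n+1}$, $(q^{-1}-q)\pi^+_k(F)e_n=-q^{\frac12-k-n}\sqrt{(1-q^{2n})(1-q^{4k+2n-2})}\,e_{n-1}$;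 * negative discrete series: $\pi^-_k(K)e_n=q^{-(k+n)}e_n$, $\pi^-_k(E)=\pi^+_k(F)$ and $\pi^-_k(F)=\pi^+_k(E)$; * strange series: $\pi^{\mathrm S}_{\sigma,\varepsilon}(K)e_n=q^{n+\varepsilon}e_n$, $(q^{-1}-q)\pi^{\mathrm S}_{\sigma,\varepsilon}(E)e_n=q^{-\frac12-n-\varepsilon}\sqrt{(1+q^{2n+2\varepsilon+2\sigma+1})(1+q^{2n+2\varepsilon-2\sigma+1})}\,e_{n+1}$, $(q^{-1}-q)\pi^{\mathrm S}_{\sigma,\varepsilon}(F)e_n=-q^{\frac12-n-\varepsilon}\sqrt{(1+q^{2n+2\varepsilon+2\sigma-1})(1+q^{2n+2\varepsilon-2\sigma-1})}\,e_{n-1}$. For $k_1,k_2>0$ and $\varepsilon\in\frac12\mathbb Z$ let $$\mathcal T'_{k_1,k_2,\varepsilon}=\Big(\big(\pi^-_{k_1}\otimes\pi^{\mathrm S}_{k_2-\frac12,\varepsilon+k_2}\big)\oplus\big(\pi^{\mathrm S}_{k_1-\frac12,-\varepsilon-k_1}\otimes\pi^+_{k_2}\big)\Big)\Delta$$ on $\big(\ell^2(\mathbb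 N)\otimes\ell^2(\mathbb Z)\big)\oplus\big(\ell^2(\mathbb Z)\otimes\ell^2(\mathbb N)\big)$, with domain the finite linear combinations of the vectors $e_i\otimes e_j$ of the two summands. For $p\in\mathbb Z$, $n\in\mathbb N$ put $$f^-_{p,n}=e_n\otimes e_{n+p}\in\ell^2(\mathbb N)\otimes\ell^2(\mathbb Z),\qquad f^+_{p,n}=e_{2\varepsilon-n+p}\otimes e_n\in\ell^2(\mathbb Z)\otimes\ell^2(\mathbb N).$$ Let $(x;q)_m=\prod_{i=0}^{m-1}(1-xq^i)$ for $m\in\mathbb N\cup\{\infty\}$, $(x_1,\dots,x_s;q)_m=\prod_j(x_j;q)_m$, $\theta(x;q)=(x,q/x;q)_\infty$, and let $$P_m(x;a,b,c;q)={}_3\varphi_2\!\left[\begin{matrix}q^{-m},\,abq^{m+1},\,x\\ aq,\,cq\end{matrix};q,q\right]=\sum_{k=0}^{m}\frac{(q^{-m},abq^{m+1},x;q)_k}{(q,aq,cq;q)_k}\,q^k$$ be the big $q$-Jacobi polynomials. Put $$u(x;a,b,c;q)=\frac{(x/a,x/c;q)_\infty}{(x,bx/c;q)_\infty},$$ $$v(m;a,b,c;q)=\frac{1-abq^{2m+1}}{aq(1-abq)}\,\frac{(aq,bq,cq,abq/c;q)_\infty}{(q,abq^2;q)_\infty\,\theta(c/a;q)}\,\frac{(aq,abq,cq;q)_m}{(q,bq,abq/c;q)_m}\,(-acq^2)^{-m}q^{-\frac12m(m-1)}$$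 (with the factor $1-abq$ cancelled, i.e. understood as a limit, when $abq=1$), and $$r_x(m;a,b,c;q)=\sqrt{|x|\,u(x;a,b,c;q)\,v(m;a,b,c;q)}\;P_m(x;a,b,c;q).$$ For $m\in\mathbb N$ define $$(\Theta f^-_{p,n})(m)=r_{q^{2n+4k_1}}\big(m;q^{4k_1-2},q^{4k_2-2},-q^{4k_1-2p-2\varepsilon-2};q^2\big),$$ $$(\Theta f^+_{p,n})(m)=(-1)^n\,r_{-q^{2n+4k_1-2p-2\varepsilon}}\big(m;q^{4k_1-2},q^{4k_2-2},-q^{4k_1-2p-2\varepsilon-2};q^2\big).$$ **Theorem.** The representation $\mathcal T'_{k_1,k_2,\varepsilon}$ is unitarily equivalent to $$\bigoplus_{m=0}^\infty\pi^{\mathrm S}_{k_1+k_2-\frac12+m,\ \varepsilon-k_1+k_2},$$ and the unitary intertwiner is given by normalized big $q$-Jacobi polynomials. Precisely: there is a unitary operator $$U:\big(\ell^2(\mathbb N)\otimes\ell^2(\mathbb Z)\big)\oplus\big(\ell^2(\mathbb Z)\otimes\ell^2(\mathbb N)\big)\to\bigoplus_{m=0}^\infty\ell^2(\mathbb Z)$$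 such that $$Uf^\sigma_{p,n}=\sum_{m=0}^\infty(\Theta f^\sigma_{p,n})(m)\,e^{(m)}_p,\qquad p\in\mathbb Z,\ n\in\mathbb N,\ \sigma\in\{-,+\},$$ where $e_p^{(m)}$ is the basis vector $e_p$ of the $m$-th copy of $\ell^2(\mathbb Z)$, and such that for every $v$ in the domain of $\mathcal T'$ the vector $Uv$ is in the domain of the direct sum and $$\Big(\bigoplus_{m}\pi^{\mathrm S}_{k_1+k_2-\frac12+m,\ \varepsilon-k_1+k_2}\Big)(X)\,Uv=U\,\mathcal T'(X)v\qquad\text{for all }X\in\mathcal U_q.$$ Here the domain of the direct sum consists of all $(\varphi_m)_m$ in the Hilbert space sum such that every $\varphi_m$ is in the domain of the $m$-th representation $\pi_m$ and $\sum_m\|\pi_m(X)\varphi_m\|^2<\infty$ for all $X\in\mathcal U_q$; the action is componentwise. -/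

import Mathlib

open scoped TensorProduct lp

noncomputable section

namespace SU11

/-! ### The quantized universal enveloping algebra -/

inductive Gen
  | K | Kinv | E | F

/-- The defining relations of `U_q(su(1,1))`. -/
inductive Rel (q : ℝ) : FreeAlgebra ℂ Gen → FreeAlgebra ℂ Gen → Prop
  | K_Kinv : Rel q (FreeAlgebra.ι ℂ Gen.K * FreeAlgebra.ι ℂ Gen.Kinv) 1
  | Kinv_K : Rel q (FreeAlgebra.ι ℂ Gen.Kinv * FreeAlgebra.ι ℂ Gen.K) 1
  | K_E : Rel q (FreeAlgebra.ι ℂ Gen.K * FreeAlgebra.ι ℂ Gen.E)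
      ((q : ℂ) • (FreeAlgebra.ι ℂ Gen.E * FreeAlgebra.ι ℂ Gen.K))
  | K_F : Rel q (FreeAlgebra.ι ℂ Gen.K * FreeAlgebra.ι ℂ Gen.F)
      ((q : ℂ)⁻¹ • (FreeAlgebra.ι ℂ Gen.F * FreeAlgebra.ι ℂ Gen.K))
  | E_F : Rel q (FreeAlgebra.ι ℂ Gen.E * FreeAlgebra.ι ℂ Gen.F
        - FreeAlgebra.ι ℂ Gen.F * FreeAlgebra.ι ℂ Gen.E)
      (((q : ℂ) - (q : ℂ)⁻¹)⁻¹ •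
        (FreeAlgebra.ι ℂ Gen.K ^ 2 - FreeAlgebra.ι ℂ Gen.Kinv ^ 2))

/-- The algebra `U_q = U_q(su(1,1))`. -/
abbrev Uq (q : ℝ) : Type := RingQuot (Rel q)

/-- The generators, as elements of `U_q`. -/
def gen (q : ℝ) (g : Gen) : Uq q := RingQuot.mkAlgHom ℂ (Rel q) (FreeAlgebra.ι ℂ g)

section
variable {q : ℝ}

theorem K_mul_Kinv : gen q .K * gen q .Kinv = 1 := by
  simpa [gen, -Complex.coe_smul] using RingQuot.mkAlgHom_rel ℂ (Rel.K_Kinv (q := q))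

theorem Kinv_mul_K : gen q .Kinv * gen q .K = 1 := by
  simpa [gen, -Complex.coe_smul] using RingQuot.mkAlgHom_rel ℂ (Rel.Kinv_K (q := q))

theorem K_mul_E : gen q .K * gen q .E = (q : ℂ) • (gen q .E * gen q .K) := by
  simpa [gen, -Complex.coe_smul] using RingQuot.mkAlgHom_rel ℂ (Rel.K_E (q := q))

theorem K_mul_F : gen q .K * gen q .F = (q : ℂ)⁻¹ • (gen q .F * gen q .K) := by
  simpa [gen, -Complex.coe_smul] using RingQuot.mkAlgHom_rel ℂ (Rel.K_F (q := q))

theorem E_mul_F_sub : gen q .E * gen q .F - gen q .F * gen q .E =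
    ((q : ℂ) - (q : ℂ)⁻¹)⁻¹ • (gen q .K ^ 2 - gen q .Kinv ^ 2) := by
  simpa [gen, -Complex.coe_smul] using RingQuot.mkAlgHom_rel ℂ (Rel.E_F (q := q))

/-- `E K⁻¹ = q K⁻¹ E`. -/
theorem E_mul_Kinv : gen q .E * gen q .Kinv = (q : ℂ) • (gen q .Kinv * gen q .E) := by
  calc gen q .E * gen q .Kinv
      = gen q .Kinv * (gen q .K * gen q .E) * gen q .Kinv := by
        rw [← mul_assoc, Kinv_mul_K, one_mul]
    _ = (q : ℂ) • (gen q .Kinv * gen q .E * (gen q .K * gen q .Kinv)) := by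
        rw [K_mul_E]; simp only [mul_smul_comm, smul_mul_assoc, mul_assoc]
    _ = _ := by rw [K_mul_Kinv, mul_one]

/-- `F K⁻¹ = q⁻¹ K⁻¹ F`. -/
theorem F_mul_Kinv : gen q .F * gen q .Kinv = (q : ℂ)⁻¹ • (gen q .Kinv * gen q .F) := by
  calc gen q .F * gen q .Kinv
      = gen q .Kinv * (gen q .K * gen q .F) * gen q .Kinv := by
        rw [← mul_assoc, Kinv_mul_K, one_mul]
    _ = (q : ℂ)⁻¹ • (gen q .Kinv * gen q .F * (gen q .K * gen q .Kinv)) := by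
        rw [K_mul_F]; simp only [mul_smul_comm, smul_mul_assoc, mul_assoc]
    _ = _ := by rw [K_mul_Kinv, mul_one]

/-- The universal property of `U_q`: four elements satisfying the relations give a
homomorphism. -/
def lift {A : Type*} [Ring A] [Algebra ℂ A] (q : ℝ) (k k' e f : A)
    (h1 : k * k' = 1) (h2 : k' * k = 1) (h3 : k * e = (q : ℂ) • (e * k))
    (h4 : k * f = (q : ℂ)⁻¹ • (f * k))
    (h5 : e * f - f * e = ((q : ℂ) - (q : ℂ)⁻¹)⁻¹ • (k ^ 2 - k' ^ 2)) : Uq q →ₐ[ℂ] A :=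
  RingQuot.liftAlgHom ℂ ⟨FreeAlgebra.lift ℂ (fun g => match g with
      | .K => k
      | .Kinv => k'
      | .E => e
      | .F => f), by
    intro x y h
    cases h <;> simp [h1, h2, h3, h4, h5, -Complex.coe_smul]⟩

end

/-- The comultiplication: `Δ(K) = K ⊗ K`, `Δ(K⁻¹) = K⁻¹ ⊗ K⁻¹`, `Δ(E) = K ⊗ E + E ⊗ K⁻¹`,
`Δ(F) = K ⊗ F + F ⊗ K⁻¹`. -/
def comul (q : ℝ) (hq : q ≠ 0) : Uq q →ₐ[ℂ] Uq q ⊗[ℂ] Uq q :=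
  lift q (gen q .K ⊗ₜ[ℂ] gen q .K) (gen q .Kinv ⊗ₜ[ℂ] gen q .Kinv)
    (gen q .K ⊗ₜ[ℂ] gen q .E + gen q .E ⊗ₜ[ℂ] gen q .Kinv)
    (gen q .K ⊗ₜ[ℂ] gen q .F + gen q .F ⊗ₜ[ℂ] gen q .Kinv)
    (by simp [K_mul_Kinv, Algebra.TensorProduct.one_def])
    (by simp [Kinv_mul_K, Algebra.TensorProduct.one_def])
    (by
      simp only [mul_add, add_mul, Algebra.TensorProduct.tmul_mul_tmul, K_mul_E, K_mul_Kinv,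
        Kinv_mul_K, smul_add, TensorProduct.tmul_smul, TensorProduct.smul_tmul'])
    (by
      simp only [mul_add, add_mul, Algebra.TensorProduct.tmul_mul_tmul, K_mul_F, K_mul_Kinv,
        Kinv_mul_K, smul_add, TensorProduct.tmul_smul, TensorProduct.smul_tmul'])
    (by
      have hq' : (q : ℂ) ≠ 0 := by exact_mod_cast hq
      have e1 : gen q .E * gen q .F = gen q .F * gen q .E +
          ((q : ℂ) - (q : ℂ)⁻¹)⁻¹ • (gen q .K ^ 2 - gen q .Kinv ^ 2) := by
        rw [← E_mul_F_sub]; abel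
      simp only [mul_add, add_mul, Algebra.TensorProduct.tmul_mul_tmul, K_mul_F, K_mul_E,
        E_mul_Kinv, F_mul_Kinv, e1, TensorProduct.tmul_add, TensorProduct.add_tmul,
        TensorProduct.tmul_smul, ← TensorProduct.smul_tmul', TensorProduct.tmul_sub,
        TensorProduct.sub_tmul, pow_two, smul_smul, smul_sub, mul_inv_cancel₀ hq',
        inv_mul_cancel₀ hq', one_smul]
      abel)

/-! ### Unbounded `*`-representations -/

/-- A (densely defined, unbounded) `*`-representation of `U_q(su(1,1))` on `H`: an action of the
algebra on a common dense invariant domain, compatible with the `*`-structure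
`K* = K`, `E* = -F` (which is determined by these values, as is `(K⁻¹)* = K⁻¹`, `F* = -E`). -/
structure StarRep (q : ℝ) (H : Type*) [NormedAddCommGroup H] [InnerProductSpace ℂ H] where
  domain : Submodule ℂ H
  dense : Dense (domain : Set H)
  action : Uq q →ₐ[ℂ] Module.End ℂ domain
  star_K : ∀ v w : domain,
    inner ℂ (action (gen q .K) v : H) (w : H) = inner ℂ (v : H) (action (gen q .K) w : H)
  star_E : ∀ v w : domain,
    inner ℂ (action (gen q .E) v : H) (w : H) = -inner ℂ (v : H) (action (gen q .F) w : H)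

/-- The unitary operator `U` intertwines `π` with `π'`: it maps the domain of `π` into that of
`π'`, and `π'(X) U v = U π(X) v` for all `X ∈ U_q` and all `v` in the domain of `π`. -/
def StarRep.Intertwines {q : ℝ} {H H' : Type*} [NormedAddCommGroup H] [InnerProductSpace ℂ H]
    [NormedAddCommGroup H'] [InnerProductSpace ℂ H'] (π : StarRep q H) (π' : StarRep q H')
    (U : H ≃ₗᵢ[ℂ] H') : Prop :=
  ∀ v : π.domain, ∃ h : U v ∈ π'.domain,
    ∀ X : Uq q, (π'.action X ⟨U v, h⟩ : H') = U (π.action X v : H)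

/-- A `U_q`-module `V` embedded in `H` as a dense subspace, seen as a representation on `H`. -/
def StarRep.ofCore {q : ℝ} {V H : Type*} [AddCommMonoid V] [Module ℂ V]
    [NormedAddCommGroup H] [InnerProductSpace ℂ H] (π : Uq q →ₐ[ℂ] Module.End ℂ V)
    (j : V →ₗ[ℂ] H) (hj : Function.Injective j) (hd : DenseRange j)
    (hK : ∀ v w, inner ℂ (j (π (gen q .K) v)) (j w) = inner ℂ (j v) (j (π (gen q .K) w)))
    (hE : ∀ v w, inner ℂ (j (π (gen q .E) v)) (j w) = -inner ℂ (j v) (j (π (gen q .F) w))) :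
    StarRep q H where
  domain := LinearMap.range j
  dense := by simpa [DenseRange, LinearMap.coe_range] using hd
  action := ((LinearEquiv.ofInjective j hj).conjAlgEquiv ℂ).toAlgHom.comp π
  star_K := by
    intro v w
    obtain ⟨v, rfl⟩ := (LinearEquiv.ofInjective j hj).surjective v
    obtain ⟨w, rfl⟩ := (LinearEquiv.ofInjective j hj).surjective w
    simpa [LinearEquiv.conjAlgEquiv] using hK v w
  star_E := by
    intro v w
    obtain ⟨v, rfl⟩ := (LinearEquiv.ofInjective j hj).surjective v
    obtain ⟨w, rfl⟩ := (LinearEquiv.ofInjective j hj).surjective w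
    simpa [LinearEquiv.conjAlgEquiv] using hE v w

/-! ### Sequence spaces and finite linear combinations of basis vectors -/

/-- The inclusion of the finite linear combinations of the standard orthonormal basis vectors
`e_i` (represented by `Finsupp.single i 1`) into `ℓ²(ι)`. -/
def embed (ι : Type*) : (ι →₀ ℂ) →ₗ[ℂ] ℓ²(ι, ℂ) where
  toFun f := ⟨⇑f, (memℓp_zero (f.hasFiniteSupport)).of_exponent_ge zero_le⟩
  map_add' _ _ := rfl
  map_smul' _ _ := rfl

theorem embed_apply {ι : Type*} (f : ι →₀ ℂ) (i : ι) : embed ι f i = f i := rfl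

theorem embed_injective (ι : Type*) : Function.Injective (embed ι) := by
  intro f g h
  ext i
  rw [← embed_apply, h, embed_apply]

theorem embed_denseRange (ι : Type*) : DenseRange (embed ι) := by
  classical
  intro f
  refine mem_closure_of_tendsto (lp.hasSum_single (by norm_num) f)
    (Filter.Eventually.of_forall fun s => ⟨∑ i ∈ s, Finsupp.single i (f i), ?_⟩)
  rw [map_sum]
  refine Finset.sum_congr rfl fun i _ => ?_
  ext j
  simp [embed_apply, Finsupp.single_apply, Pi.single_apply, eq_comm]

theorem inner_embed_single {ι : Type*} [DecidableEq ι] (i j : ι) (a b : ℂ) :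
    inner ℂ (embed ι (Finsupp.single i a)) (embed ι (Finsupp.single j b)) =
      if i = j then inner ℂ a b else 0 := by
  have h : embed ι (Finsupp.single i a) = lp.single 2 i a := by
    ext j
    simp [embed_apply, Finsupp.single_apply, Pi.single_apply, eq_comm]
  rw [h, lp.inner_single_left, embed_apply, Finsupp.single_apply]
  by_cases h : j = i
  · simp [h]
  · simp [h, Ne.symm h]

/-- `A* = s B` formally, for the inner product that `V` inherits from `H`. -/
def IsAdj {V H : Type*} [AddCommMonoid V] [Module ℂ V] [NormedAddCommGroup H]
    [InnerProductSpace ℂ H] (j : V →ₗ[ℂ] H) (s : ℂ) (A B : Module.End ℂ V) : Prop :=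
  ∀ v w, inner ℂ (j (A v)) (j w) = s * inner ℂ (j v) (j (B w))

theorem IsAdj.of_single {ι : Type*} {s : ℂ} {A B : Module.End ℂ (ι →₀ ℂ)}
    (h : ∀ i j, inner ℂ (embed ι (A (Finsupp.single i 1))) (embed ι (Finsupp.single j 1)) =
      s * inner ℂ (embed ι (Finsupp.single i 1)) (embed ι (B (Finsupp.single j 1)))) :
    IsAdj (embed ι) s A B := by
  intro v w
  induction v using Finsupp.induction_linear with
  | zero => simp
  | add f g hf hg => simp only [map_add, inner_add_left, hf, hg, mul_add]
  | single i a =>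
    induction w using Finsupp.induction_linear with
    | zero => simp
    | add f g hf hg => simp only [map_add, inner_add_right, hf, hg, mul_add]
    | single j b =>
      have e1 : (Finsupp.single i a : ι →₀ ℂ) = a • Finsupp.single i 1 := by simp
      have e2 : (Finsupp.single j b : ι →₀ ℂ) = b • Finsupp.single j 1 := by simp
      rw [e1, e2]
      simp only [map_smul, inner_smul_left, inner_smul_right, h]
      ring

/-! ### Weight modules -/

/-- The operator `e_i ↦ c_i e_{s(i)}`. -/
def shift {ι : Type*} (s : ι → ι) (c : ι → ℝ) : Module.End ℂ (ι →₀ ℂ) :=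
  Finsupp.linearCombination ℂ fun i => Finsupp.single (s i) (c i : ℂ)

theorem shift_single {ι : Type*} (s : ι → ι) (c : ι → ℝ) (i : ι) (a : ℂ) :
    shift s c (Finsupp.single i a) = Finsupp.single (s i) (a * c i) := by
  simp [shift, -Complex.coe_smul]

/-- Data for an action of `U_q` of the form `K e_i = κ_i e_i`, `E e_i = c_i e_{up(i)}`,
`F e_i = d_i e_{dn(i)}`, and the conditions under which this is a `*`-representation. -/
structure WeightData (q : ℝ) (ι : Type*) where
  up : ι → ι
  dn : ι → ι
  κ : ι → ℝ
  c : ι → ℝ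
  d : ι → ℝ
  κ_ne : ∀ i, κ i ≠ 0
  c_up : ∀ i, c i = 0 ∨ (dn (up i) = i ∧ κ (up i) = q * κ i ∧ d (up i) = -c i)
  d_dn : ∀ i, d i = 0 ∨ (up (dn i) = i ∧ κ (dn i) = q⁻¹ * κ i ∧ c (dn i) = -d i)
  sq_sub : ∀ i, c i ^ 2 - d i ^ 2 = (q - q⁻¹)⁻¹ * (κ i ^ 2 - ((κ i)⁻¹) ^ 2)

/-- The `U_q`-module on the finite linear combinations of the `e_i` given by weight data. -/
def WeightData.rep {q : ℝ} {ι : Type*} (D : WeightData q ι) :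
    Uq q →ₐ[ℂ] Module.End ℂ (ι →₀ ℂ) :=
  lift q (shift id D.κ) (shift id fun i => (D.κ i)⁻¹) (shift D.up D.c) (shift D.dn D.d)
    (by
      refine Finsupp.lhom_ext fun i a => ?_
      have := D.κ_ne i
      simp [shift_single, mul_assoc, this, -Finsupp.single_mul])
    (by
      refine Finsupp.lhom_ext fun i a => ?_
      have := D.κ_ne i
      simp [shift_single, mul_assoc, this, -Finsupp.single_mul])
    (by
      refine Finsupp.lhom_ext fun i a => ?_
      rcases D.c_up i with h | ⟨-, h, -⟩
      · simp [shift_single, h, -Complex.coe_smul, -Finsupp.single_mul]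
      · simp only [Module.End.mul_apply, shift_single, LinearMap.smul_apply, Finsupp.smul_single,
          id, h, smul_eq_mul]
        congr 1; push_cast; ring)
    (by
      refine Finsupp.lhom_ext fun i a => ?_
      rcases D.d_dn i with h | ⟨-, h, -⟩
      · simp [shift_single, h, -Complex.coe_smul, -Finsupp.single_mul]
      · simp only [Module.End.mul_apply, shift_single, LinearMap.smul_apply, Finsupp.smul_single,
          id, h, smul_eq_mul]
        congr 1; push_cast; ring)
    (by
      refine Finsupp.lhom_ext fun i a => ?_
      have e1 : shift D.up D.c (shift D.dn D.d (Finsupp.single i a)) =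
          Finsupp.single i (-(a * (D.d i) ^ 2)) := by
        rcases D.d_dn i with h | ⟨h1, -, h2⟩
        · simp [shift_single, h]
        · rw [shift_single, shift_single, h1, h2]; congr 1; push_cast; ring
      have e2 : shift D.dn D.d (shift D.up D.c (Finsupp.single i a)) =
          Finsupp.single i (-(a * (D.c i) ^ 2)) := by
        rcases D.c_up i with h | ⟨h1, -, h2⟩
        · simp [shift_single, h]
        · rw [shift_single, shift_single, h1, h2]; congr 1; push_cast; ring
      have e3 := congrArg (fun x : ℝ => (x : ℂ)) (D.sq_sub i)
      push_cast at e3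
      simp only [LinearMap.sub_apply, Module.End.mul_apply, LinearMap.smul_apply, pow_two,
        id]
      rw [e1, e2]
      simp only [shift_single, id]
      rw [← Finsupp.single_sub, ← Finsupp.single_sub, Finsupp.smul_single, smul_eq_mul]
      refine congrArg (Finsupp.single i) ?_
      push_cast
      linear_combination a * e3)

theorem lift_gen {A : Type*} [Ring A] [Algebra ℂ A] (q : ℝ) (k k' e f : A)
    (h1 : k * k' = 1) (h2 : k' * k = 1) (h3 : k * e = (q : ℂ) • (e * k))
    (h4 : k * f = (q : ℂ)⁻¹ • (f * k))
    (h5 : e * f - f * e = ((q : ℂ) - (q : ℂ)⁻¹)⁻¹ • (k ^ 2 - k' ^ 2)) :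
    lift q k k' e f h1 h2 h3 h4 h5 (gen q .K) = k ∧
    lift q k k' e f h1 h2 h3 h4 h5 (gen q .Kinv) = k' ∧
    lift q k k' e f h1 h2 h3 h4 h5 (gen q .E) = e ∧
    lift q k k' e f h1 h2 h3 h4 h5 (gen q .F) = f := by
  simp [lift, gen]

section
variable {q : ℝ} {ι : Type*} (D : WeightData q ι)

theorem WeightData.rep_K : D.rep (gen q .K) = shift id D.κ := (lift_gen ..).1
theorem WeightData.rep_Kinv : D.rep (gen q .Kinv) = shift id fun i => (D.κ i)⁻¹ :=
  (lift_gen ..).2.1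
theorem WeightData.rep_E : D.rep (gen q .E) = shift D.up D.c := (lift_gen ..).2.2.1
theorem WeightData.rep_F : D.rep (gen q .F) = shift D.dn D.d := (lift_gen ..).2.2.2

theorem isAdj_shift_id (c : ι → ℝ) : IsAdj (embed ι) 1 (shift id c) (shift id c) := by
  classical
  refine IsAdj.of_single fun i j => ?_
  simp only [shift_single, inner_embed_single, id]
  by_cases h : i = j
  · subst h; simp
  · simp [h]

theorem WeightData.adj_K : IsAdj (embed ι) 1 (D.rep (gen q .K)) (D.rep (gen q .K)) := by
  rw [rep_K]; exact isAdj_shift_id _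

theorem WeightData.adj_Kinv : IsAdj (embed ι) 1 (D.rep (gen q .Kinv))
    (D.rep (gen q .Kinv)) := by
  rw [rep_Kinv]; exact isAdj_shift_id _

theorem WeightData.adj_E : IsAdj (embed ι) (-1) (D.rep (gen q .E)) (D.rep (gen q .F)) := by
  classical
  rw [rep_E, rep_F]
  refine IsAdj.of_single fun i j => ?_
  simp only [shift_single, inner_embed_single]
  by_cases h1 : D.up i = j
  · subst h1
    rcases D.c_up i with h | ⟨h1, -, h2⟩
    · rcases D.d_dn (D.up i) with h' | ⟨h3, -, h4⟩
      · simp [h, h']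
      · by_cases h5 : i = D.dn (D.up i)
        · rw [← h5] at h4
          have : D.d (D.up i) = 0 := by linarith
          simp [h, this]
        · simp [h, h5]
    · simp [h1, h2]
  · rcases D.d_dn j with h' | ⟨h3, -, h4⟩
    · simp [h', h1]
    · by_cases h5 : i = D.dn j
      · subst h5; exact absurd h3 h1
      · simp [h1, h5]

/-- The `*`-representation on `ℓ²(ι)` given by weight data. -/
def WeightData.starRep : StarRep q ℓ²(ι, ℂ) :=
  StarRep.ofCore D.rep (embed ι) (embed_injective ι) (embed_denseRange ι)
    (fun v w => by simpa using D.adj_K v w) (fun v w => by simpa using D.adj_E v w)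

end

/-! ### Discrete series and strange series -/

theorem discrete_c_sq {q k : ℝ} (hq : q ∈ Set.Ioo (0 : ℝ) 1) (hk : 0 < k) (n : ℕ) :
    ((q⁻¹ - q)⁻¹ * (q ^ (-1 / 2 - k - n) *
      √((1 - q ^ (2 * (n : ℝ) + 2)) * (1 - q ^ (4 * k + 2 * n))))) ^ 2 -
    (-((q⁻¹ - q)⁻¹ * (q ^ (1 / 2 - k - n) *
      √((1 - q ^ (2 * (n : ℝ))) * (1 - q ^ (4 * k + 2 * n - 2)))))) ^ 2 =
    (q - q⁻¹)⁻¹ * ((q ^ (k + n)) ^ 2 - ((q ^ (k + n))⁻¹) ^ 2) := by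
  obtain ⟨h0, h1⟩ := hq
  have le1 : ∀ x : ℝ, 0 ≤ x → 0 ≤ 1 - q ^ x := fun x hx =>
    sub_nonneg.2 (Real.rpow_le_one h0.le h1.le hx)
  have hn : (0 : ℝ) ≤ n := n.cast_nonneg
  have p1 : 0 ≤ (1 - q ^ (2 * (n : ℝ) + 2)) * (1 - q ^ (4 * k + 2 * n)) :=
    mul_nonneg (le1 _ (by positivity)) (le1 _ (by positivity))
  have p2 : 0 ≤ (1 - q ^ (2 * (n : ℝ))) * (1 - q ^ (4 * k + 2 * n - 2)) := by
    rcases Nat.eq_zero_or_pos n with rfl | h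
    · simp
    · have : (1 : ℝ) ≤ n := by exact_mod_cast h
      exact mul_nonneg (le1 _ (by positivity)) (le1 _ (by linarith))
  have hY : (0 : ℝ) < q ^ (k + n) := Real.rpow_pos_of_pos h0 _
  have hX : (0 : ℝ) < q ^ (n : ℝ) := Real.rpow_pos_of_pos h0 _
  have hZ : (0 : ℝ) < q ^ k := Real.rpow_pos_of_pos h0 _
  have hYX : q ^ (k + n) = q ^ k * q ^ (n : ℝ) := Real.rpow_add h0 _ _
  have sq : ∀ x : ℝ, (q ^ x) ^ 2 = q ^ (2 * x) := fun x => by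
    rw [mul_comm, Real.rpow_mul h0.le, Real.rpow_two]
  have a1 : (q ^ (-1 / 2 - k - n)) ^ 2 = q⁻¹ * ((q ^ k * q ^ (n : ℝ)) ^ 2)⁻¹ := by
    rw [← hYX, sq, sq, ← Real.rpow_neg h0.le, ← Real.rpow_neg_one, ← Real.rpow_add h0]
    congr 1; ring
  have a2 : (q ^ (1 / 2 - k - n)) ^ 2 = q * ((q ^ k * q ^ (n : ℝ)) ^ 2)⁻¹ := by
    rw [← hYX, sq, sq, ← Real.rpow_neg h0.le]
    nth_rewrite 2 [← Real.rpow_one q]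
    rw [← Real.rpow_add h0]
    congr 1; ring
  have a3 : q ^ (2 * (n : ℝ)) = (q ^ (n : ℝ)) ^ 2 := (sq _).symm
  have a4 : q ^ (2 * (n : ℝ) + 2) = (q ^ (n : ℝ)) ^ 2 * q ^ 2 := by
    rw [Real.rpow_add h0, a3, Real.rpow_two]
  have a5 : q ^ (4 * k + 2 * n) = (q ^ k) ^ 4 * (q ^ (n : ℝ)) ^ 2 := by
    rw [Real.rpow_add h0, a3, mul_comm 4 k, Real.rpow_mul h0.le]; norm_cast
  have a6 : q ^ (4 * k + 2 * n - 2) = (q ^ k) ^ 4 * (q ^ (n : ℝ)) ^ 2 / q ^ 2 := by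
    rw [Real.rpow_sub h0, a5, Real.rpow_two]
  rw [neg_sq]
  simp only [mul_pow, Real.sq_sqrt p1, Real.sq_sqrt p2]
  rw [a1, a2, a3, a4, a5, a6, hYX]
  have hq1 : q⁻¹ - q ≠ 0 := by
    have : 1 < q⁻¹ := (one_lt_inv₀ h0).2 h1
    linarith
  have e : (q - q⁻¹)⁻¹ = -(q⁻¹ - q)⁻¹ := by rw [← inv_neg, neg_sub]
  rw [e]
  generalize hw : (q⁻¹ - q)⁻¹ = w
  have hw' : w * (q⁻¹ - q) = 1 := by rw [← hw]; exact inv_mul_cancel₀ hq1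
  generalize q ^ k = z at *
  generalize q ^ (n : ℝ) = x at *
  have key : q⁻¹ * ((z * x) ^ 2)⁻¹ * ((1 - x ^ 2 * q ^ 2) * (1 - z ^ 4 * x ^ 2)) -
      q * ((z * x) ^ 2)⁻¹ * ((1 - x ^ 2) * (1 - z ^ 4 * x ^ 2 / q ^ 2)) =
      -(q⁻¹ - q) * ((z * x) ^ 2 - ((z * x)⁻¹) ^ 2) := by
    field_simp
    ring
  linear_combination w ^ 2 * key - w * ((z * x) ^ 2 - ((z * x)⁻¹) ^ 2) * hw'

theorem strange_c_sq {q : ℝ} (hq : q ∈ Set.Ioo (0 : ℝ) 1) (σ ε : ℝ) (n : ℤ) :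
    ((q⁻¹ - q)⁻¹ * (q ^ (-1 / 2 - n - ε) *
      √((1 + q ^ (2 * n + 2 * ε + 2 * σ + 1)) * (1 + q ^ (2 * n + 2 * ε - 2 * σ + 1))))) ^ 2 -
    (-((q⁻¹ - q)⁻¹ * (q ^ (1 / 2 - n - ε) *
      √((1 + q ^ (2 * n + 2 * ε + 2 * σ - 1)) * (1 + q ^ (2 * n + 2 * ε - 2 * σ - 1)))))) ^ 2 =
    (q - q⁻¹)⁻¹ * ((q ^ (n + ε)) ^ 2 - ((q ^ (n + ε))⁻¹) ^ 2) := by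
  obtain ⟨h0, h1⟩ := hq
  have ps : ∀ x : ℝ, 0 < 1 + q ^ x := fun x => by
    have := Real.rpow_pos_of_pos h0 x
    linarith
  have p : ∀ x y : ℝ, 0 ≤ (1 + q ^ x) * (1 + q ^ y) := fun x y => (mul_pos (ps x) (ps y)).le
  have hX : (0 : ℝ) < q ^ (n + ε) := Real.rpow_pos_of_pos h0 _
  have hZ : (0 : ℝ) < q ^ (2 * σ) := Real.rpow_pos_of_pos h0 _
  have sq : ∀ x : ℝ, (q ^ x) ^ 2 = q ^ (2 * x) := fun x => by
    rw [mul_comm, Real.rpow_mul h0.le, Real.rpow_two]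
  have a1 : (q ^ (-1 / 2 - n - ε)) ^ 2 = q⁻¹ * ((q ^ (n + ε)) ^ 2)⁻¹ := by
    rw [sq, sq, ← Real.rpow_neg h0.le, ← Real.rpow_neg_one, ← Real.rpow_add h0]
    congr 1; ring
  have a2 : (q ^ (1 / 2 - n - ε)) ^ 2 = q * ((q ^ (n + ε)) ^ 2)⁻¹ := by
    rw [sq, sq, ← Real.rpow_neg h0.le]
    nth_rewrite 2 [← Real.rpow_one q]
    rw [← Real.rpow_add h0]
    congr 1; ring
  have b1 : q ^ (2 * n + 2 * ε + 2 * σ + 1) = (q ^ (n + ε)) ^ 2 * q ^ (2 * σ) * q := by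
    rw [Real.rpow_add h0, Real.rpow_add h0, Real.rpow_one, sq, mul_add]
  have b2 : q ^ (2 * n + 2 * ε - 2 * σ + 1) = (q ^ (n + ε)) ^ 2 / q ^ (2 * σ) * q := by
    rw [Real.rpow_add h0, Real.rpow_sub h0, Real.rpow_one, sq, mul_add]
  have b3 : q ^ (2 * n + 2 * ε + 2 * σ - 1) = (q ^ (n + ε)) ^ 2 * q ^ (2 * σ) / q := by
    rw [Real.rpow_sub h0, Real.rpow_add h0, Real.rpow_one, sq, mul_add]
  have b4 : q ^ (2 * n + 2 * ε - 2 * σ - 1) = (q ^ (n + ε)) ^ 2 / q ^ (2 * σ) / q := by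
    rw [Real.rpow_sub h0, Real.rpow_sub h0, Real.rpow_one, sq, mul_add]
  rw [neg_sq]
  simp only [mul_pow, Real.sq_sqrt (p _ _)]
  rw [a1, a2, b1, b2, b3, b4]
  have hq1 : q⁻¹ - q ≠ 0 := by
    have : 1 < q⁻¹ := (one_lt_inv₀ h0).2 h1
    linarith
  have e : (q - q⁻¹)⁻¹ = -(q⁻¹ - q)⁻¹ := by rw [← inv_neg, neg_sub]
  rw [e]
  generalize hw : (q⁻¹ - q)⁻¹ = w
  have hw' : w * (q⁻¹ - q) = 1 := by rw [← hw]; exact inv_mul_cancel₀ hq1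
  generalize q ^ (2 * σ) = z at *
  generalize q ^ (n + ε) = x at *
  have key : q⁻¹ * (x ^ 2)⁻¹ * ((1 + x ^ 2 * z * q) * (1 + x ^ 2 / z * q)) -
      q * (x ^ 2)⁻¹ * ((1 + x ^ 2 * z / q) * (1 + x ^ 2 / z / q)) =
      -(q⁻¹ - q) * (x ^ 2 - (x⁻¹) ^ 2) := by
    field_simp
    ring
  linear_combination w ^ 2 * key - w * (x ^ 2 - (x⁻¹) ^ 2) * hw'

/-- The positive discrete series `π⁺_k`. -/
def posData (q : ℝ) (hq : q ∈ Set.Ioo (0 : ℝ) 1) (k : ℝ) (hk : 0 < k) : WeightData q ℕ where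
  up n := n + 1
  dn n := n - 1
  κ n := q ^ (k + n)
  c n := (q⁻¹ - q)⁻¹ * (q ^ (-1 / 2 - k - n) *
    √((1 - q ^ (2 * (n : ℝ) + 2)) * (1 - q ^ (4 * k + 2 * n))))
  d n := -((q⁻¹ - q)⁻¹ * (q ^ (1 / 2 - k - n) *
    √((1 - q ^ (2 * (n : ℝ))) * (1 - q ^ (4 * k + 2 * n - 2)))))
  κ_ne n := (Real.rpow_pos_of_pos hq.1 _).ne'
  c_up n := by
    refine Or.inr ⟨rfl, ?_, ?_⟩
    · rw [Nat.cast_succ, ← add_assoc, Real.rpow_add_one hq.1.ne', mul_comm]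
    · push_cast
      ring_nf
  d_dn n := by
    rcases n with _ | n
    · left; simp
    · refine Or.inr ⟨rfl, ?_, ?_⟩
      · rw [Nat.cast_succ, ← add_assoc, Real.rpow_add_one hq.1.ne', Nat.add_sub_cancel,
          mul_comm (q ^ _), inv_mul_cancel_left₀ hq.1.ne']
      · rw [Nat.add_sub_cancel]; push_cast
        ring_nf
  sq_sub n := discrete_c_sq hq hk n

/-- The negative discrete series `π⁻_k`. -/
def negData (q : ℝ) (hq : q ∈ Set.Ioo (0 : ℝ) 1) (k : ℝ) (hk : 0 < k) : WeightData q ℕ where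
  up n := n - 1
  dn n := n + 1
  κ n := q ^ (-(k + n))
  c n := -((q⁻¹ - q)⁻¹ * (q ^ (1 / 2 - k - n) *
    √((1 - q ^ (2 * (n : ℝ))) * (1 - q ^ (4 * k + 2 * n - 2)))))
  d n := (q⁻¹ - q)⁻¹ * (q ^ (-1 / 2 - k - n) *
    √((1 - q ^ (2 * (n : ℝ) + 2)) * (1 - q ^ (4 * k + 2 * n))))
  κ_ne n := (Real.rpow_pos_of_pos hq.1 _).ne'
  d_dn n := by
    refine Or.inr ⟨rfl, ?_, ?_⟩
    · rw [Nat.cast_succ, Real.rpow_neg hq.1.le, Real.rpow_neg hq.1.le, ← add_assoc,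
        Real.rpow_add_one hq.1.ne', mul_inv, mul_comm]
    · push_cast
      ring_nf
  c_up n := by
    rcases n with _ | n
    · left; simp
    · refine Or.inr ⟨rfl, ?_, ?_⟩
      · rw [Nat.cast_succ, Real.rpow_neg hq.1.le, Real.rpow_neg hq.1.le, ← add_assoc,
          Real.rpow_add_one hq.1.ne', Nat.add_sub_cancel, mul_inv, mul_comm (_)⁻¹ q⁻¹,
          mul_inv_cancel_left₀ hq.1.ne']
      · rw [Nat.add_sub_cancel]; push_cast
        ring_nf
  sq_sub n := by
    have := discrete_c_sq hq hk n
    rw [Real.rpow_neg hq.1.le, inv_inv]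
    linarith

/-- The strange series `π^S_{σ,ε}`, for arbitrary real labels. -/
def strangeData (q : ℝ) (hq : q ∈ Set.Ioo (0 : ℝ) 1) (σ ε : ℝ) : WeightData q ℤ where
  up n := n + 1
  dn n := n - 1
  κ n := q ^ (n + ε)
  c n := (q⁻¹ - q)⁻¹ * (q ^ (-1 / 2 - n - ε) *
    √((1 + q ^ (2 * n + 2 * ε + 2 * σ + 1)) * (1 + q ^ (2 * n + 2 * ε - 2 * σ + 1))))
  d n := -((q⁻¹ - q)⁻¹ * (q ^ (1 / 2 - n - ε) *
    √((1 + q ^ (2 * n + 2 * ε + 2 * σ - 1)) * (1 + q ^ (2 * n + 2 * ε - 2 * σ - 1)))))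
  κ_ne n := (Real.rpow_pos_of_pos hq.1 _).ne'
  c_up n := by
    refine Or.inr ⟨by simp, ?_, ?_⟩
    · push_cast
      rw [add_right_comm, Real.rpow_add_one hq.1.ne', mul_comm]
    · push_cast
      ring_nf
  d_dn n := by
    refine Or.inr ⟨by simp, ?_, ?_⟩
    · push_cast
      rw [sub_add_eq_add_sub, Real.rpow_sub_one hq.1.ne', div_eq_inv_mul]
    · push_cast
      ring_nf
  sq_sub n := strange_c_sq hq σ ε n

/-! ### Tensor products and direct sums -/

/-- The inclusion of the algebraic tensor product of the domains into the Hilbert space tensor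
product `ℓ²(ι) ⊗ ℓ²(κ) = ℓ²(ι × κ)`, under which `e_i ⊗ e_j` is the basis vector `e_(i,j)`. -/
def embedTensor (ι κ : Type*) : ((ι →₀ ℂ) ⊗[ℂ] (κ →₀ ℂ)) →ₗ[ℂ] ℓ²(ι × κ, ℂ) :=
  embed (ι × κ) ∘ₗ (finsuppTensorFinsupp' ℂ ι κ).toLinearMap

theorem embedTensor_single {ι κ : Type*} (i : ι) (j : κ) (a b : ℂ) :
    embedTensor ι κ (Finsupp.single i a ⊗ₜ[ℂ] Finsupp.single j b) =
      embed (ι × κ) (Finsupp.single (i, j) (a * b)) := by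
  simp [embedTensor]

theorem inner_embedTensor {ι κ : Type*} (v v' : ι →₀ ℂ) (w w' : κ →₀ ℂ) :
    inner ℂ (embedTensor ι κ (v ⊗ₜ[ℂ] w)) (embedTensor ι κ (v' ⊗ₜ[ℂ] w')) =
      inner ℂ (embed ι v) (embed ι v') * inner ℂ (embed κ w) (embed κ w') := by
  classical
  induction v using Finsupp.induction_linear with
  | zero => simp
  | add f g hf hg => simp only [TensorProduct.add_tmul, map_add, inner_add_left, hf, hg, add_mul]
  | single i a =>
  induction v' using Finsupp.induction_linear with
  | zero => simp
  | add f g hf hg => simp only [TensorProduct.add_tmul, map_add, inner_add_right, hf, hg, add_mul]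
  | single i' a' =>
  induction w using Finsupp.induction_linear with
  | zero => simp
  | add f g hf hg => simp only [TensorProduct.tmul_add, map_add, inner_add_left, hf, hg, mul_add]
  | single j b =>
  induction w' using Finsupp.induction_linear with
  | zero => simp
  | add f g hf hg => simp only [TensorProduct.tmul_add, map_add, inner_add_right, hf, hg, mul_add]
  | single j' b' =>
  simp only [embedTensor_single, inner_embed_single, Prod.mk.injEq]
  by_cases h1 : i = i' <;> by_cases h2 : j = j' <;> simp [h1, h2]
  ring

theorem IsAdj.tensor {ι κ : Type*} {s t : ℂ} {A A' : Module.End ℂ (ι →₀ ℂ)}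
    {B B' : Module.End ℂ (κ →₀ ℂ)} (hA : IsAdj (embed ι) s A A') (hB : IsAdj (embed κ) t B B') :
    IsAdj (embedTensor ι κ) (s * t) (TensorProduct.map A B) (TensorProduct.map A' B') := by
  intro x y
  induction x using TensorProduct.induction_on with
  | zero => simp
  | add f g hf hg => simp only [map_add, inner_add_left, hf, hg, mul_add]
  | tmul v w =>
  induction y using TensorProduct.induction_on with
  | zero => simp
  | add f g hf hg => simp only [map_add, inner_add_right, hf, hg, mul_add]
  | tmul v' w' =>
  simp only [TensorProduct.map_tmul, inner_embedTensor, hA v v', hB w w']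
  ring

theorem IsAdj.add {V H : Type*} [AddCommMonoid V] [Module ℂ V] [NormedAddCommGroup H]
    [InnerProductSpace ℂ H] {j : V →ₗ[ℂ] H} {s : ℂ} {A A' B B' : Module.End ℂ V}
    (hA : IsAdj j s A A') (hB : IsAdj j s B B') : IsAdj j s (A + B) (A' + B') := by
  intro v w
  simp only [LinearMap.add_apply, map_add, inner_add_left, inner_add_right, hA v w, hB v w,
    mul_add]

/-- The representation `π₁ ⊗ π₂` of `U_q ⊗ U_q` on `V ⊗ W`. -/
def tensorRep {q : ℝ} {V W : Type*} [AddCommMonoid V] [Module ℂ V] [AddCommMonoid W] [Module ℂ W]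
    (π₁ : Uq q →ₐ[ℂ] Module.End ℂ V) (π₂ : Uq q →ₐ[ℂ] Module.End ℂ W) :
    Uq q ⊗[ℂ] Uq q →ₐ[ℂ] Module.End ℂ (V ⊗[ℂ] W) :=
  (Module.endTensorEndAlgHom (R := ℂ) (S := ℂ) (A := ℂ) (M := V) (N := W)).comp
    (Algebra.TensorProduct.map π₁ π₂)

/-- The direct sum of two representations of an algebra. -/
def sumRep {A V W : Type*} [Semiring A] [Algebra ℂ A] [AddCommMonoid V] [Module ℂ V]
    [AddCommMonoid W] [Module ℂ W] (ρ₁ : A →ₐ[ℂ] Module.End ℂ V) (ρ₂ : A →ₐ[ℂ] Module.End ℂ W) :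
    A →ₐ[ℂ] Module.End ℂ (V × W) :=
  (LinearMap.prodMapAlgHom ℂ V W).comp (ρ₁.prod ρ₂)

theorem tensorRep_tmul {q : ℝ} {V W : Type*} [AddCommMonoid V] [Module ℂ V] [AddCommMonoid W]
    [Module ℂ W] (π₁ : Uq q →ₐ[ℂ] Module.End ℂ V) (π₂ : Uq q →ₐ[ℂ] Module.End ℂ W) (X Y : Uq q) :
    tensorRep π₁ π₂ (X ⊗ₜ Y) = TensorProduct.map (π₁ X) (π₂ Y) := rfl

theorem comul_gen {q : ℝ} (hq : q ≠ 0) :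
    comul q hq (gen q .K) = gen q .K ⊗ₜ[ℂ] gen q .K ∧
    comul q hq (gen q .Kinv) = gen q .Kinv ⊗ₜ[ℂ] gen q .Kinv ∧
    comul q hq (gen q .E) = gen q .K ⊗ₜ[ℂ] gen q .E + gen q .E ⊗ₜ[ℂ] gen q .Kinv ∧
    comul q hq (gen q .F) = gen q .K ⊗ₜ[ℂ] gen q .F + gen q .F ⊗ₜ[ℂ] gen q .Kinv :=
  lift_gen ..

section
variable {q : ℝ} {ι κ : Type*} (D₁ : WeightData q ι) (D₂ : WeightData q κ)

theorem tensor_adj_K (hq : q ≠ 0) :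
    IsAdj (embedTensor ι κ) 1 (tensorRep D₁.rep D₂.rep (comul q hq (gen q .K)))
      (tensorRep D₁.rep D₂.rep (comul q hq (gen q .K))) := by
  rw [(comul_gen hq).1, tensorRep_tmul]
  simpa using D₁.adj_K.tensor D₂.adj_K

theorem tensor_adj_E (hq : q ≠ 0) :
    IsAdj (embedTensor ι κ) (-1) (tensorRep D₁.rep D₂.rep (comul q hq (gen q .E)))
      (tensorRep D₁.rep D₂.rep (comul q hq (gen q .F))) := by
  rw [(comul_gen hq).2.2.1, (comul_gen hq).2.2.2, map_add, map_add, tensorRep_tmul,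
    tensorRep_tmul, tensorRep_tmul, tensorRep_tmul]
  have h1 := D₁.adj_K.tensor D₂.adj_E
  have h2 := D₁.adj_E.tensor D₂.adj_Kinv
  rw [one_mul] at h1
  rw [mul_one] at h2
  exact h1.add h2

end

/-- The Hilbert space `(ℓ²(ℕ) ⊗ ℓ²(ℤ)) ⊕ (ℓ²(ℤ) ⊗ ℓ²(ℕ))`. -/
abbrev HilbT : Type := WithLp 2 (ℓ²(ℕ × ℤ, ℂ) × ℓ²(ℤ × ℕ, ℂ))

/-- The algebraic span of the vectors `e_i ⊗ e_j` in the two summands. -/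
abbrev CoreT : Type := ((ℕ →₀ ℂ) ⊗[ℂ] (ℤ →₀ ℂ)) × ((ℤ →₀ ℂ) ⊗[ℂ] (ℕ →₀ ℂ))

/-- The inclusion of this span into the Hilbert space. -/
def embedT : CoreT →ₗ[ℂ] HilbT :=
  (WithLp.linearEquiv 2 ℂ (ℓ²(ℕ × ℤ, ℂ) × ℓ²(ℤ × ℕ, ℂ))).symm.toLinearMap ∘ₗ
    (embedTensor ℕ ℤ).prodMap (embedTensor ℤ ℕ)

theorem embedTensor_injective (ι κ : Type*) : Function.Injective (embedTensor ι κ) :=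
  (embed_injective _).comp (finsuppTensorFinsupp' ℂ ι κ).injective

theorem embedTensor_denseRange (ι κ : Type*) : DenseRange (embedTensor ι κ) := by
  have := embed_denseRange (ι × κ)
  have h : Set.range (embedTensor ι κ) = Set.range (embed (ι × κ)) :=
    (finsuppTensorFinsupp' ℂ ι κ).surjective.range_comp (embed (ι × κ))
  rwa [DenseRange, h]

theorem embedT_injective : Function.Injective embedT :=
  (WithLp.linearEquiv 2 ℂ (ℓ²(ℕ × ℤ, ℂ) × ℓ²(ℤ × ℕ, ℂ))).symm.injective.comp
    ((embedTensor_injective ℕ ℤ).prodMap (embedTensor_injective ℤ ℕ))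

theorem embedT_denseRange : DenseRange embedT := by
  have h := (embedTensor_denseRange ℕ ℤ).prodMap (embedTensor_denseRange ℤ ℕ)
  exact (WithLp.homeomorphProd 2 ℓ²(ℕ × ℤ, ℂ) ℓ²(ℤ × ℕ, ℂ)).symm.surjective.denseRange.comp h
    (WithLp.homeomorphProd 2 ℓ²(ℕ × ℤ, ℂ) ℓ²(ℤ × ℕ, ℂ)).symm.continuous

theorem inner_embedT (x y : CoreT) : inner ℂ (embedT x) (embedT y) =
    inner ℂ (embedTensor ℕ ℤ x.1) (embedTensor ℕ ℤ y.1) +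
      inner ℂ (embedTensor ℤ ℕ x.2) (embedTensor ℤ ℕ y.2) := rfl

/-- The action of `U_q` on the domain of `T'`:
`((π⁻_{k₁} ⊗ π^S_{k₂-1/2, ε+k₂}) ⊕ (π^S_{k₁-1/2, -ε-k₁} ⊗ π⁺_{k₂})) Δ`. -/
def actionT (q : ℝ) (hq : q ∈ Set.Ioo (0 : ℝ) 1) (k₁ k₂ : ℝ) (h₁ : 0 < k₁) (h₂ : 0 < k₂)
    (ε : ℝ) : Uq q →ₐ[ℂ] Module.End ℂ CoreT :=
  (sumRep
    (tensorRep (negData q hq k₁ h₁).rep (strangeData q hq (k₂ - 1 / 2) (ε + k₂)).rep)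
    (tensorRep (strangeData q hq (k₁ - 1 / 2) (-ε - k₁)).rep (posData q hq k₂ h₂).rep)).comp
  (comul q hq.1.ne')

theorem actionT_apply (q : ℝ) (hq : q ∈ Set.Ioo (0 : ℝ) 1) (k₁ k₂ : ℝ) (h₁ : 0 < k₁)
    (h₂ : 0 < k₂) (ε : ℝ) (X : Uq q) (v : CoreT) :
    actionT q hq k₁ k₂ h₁ h₂ ε X v =
      (tensorRep (negData q hq k₁ h₁).rep (strangeData q hq (k₂ - 1 / 2) (ε + k₂)).rep
        (comul q hq.1.ne' X) v.1,
      tensorRep (strangeData q hq (k₁ - 1 / 2) (-ε - k₁)).rep (posData q hq k₂ h₂).rep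
        (comul q hq.1.ne' X) v.2) := rfl

/-- The representation `T'_{k₁,k₂,ε}`. -/
def repT (q : ℝ) (hq : q ∈ Set.Ioo (0 : ℝ) 1) (k₁ k₂ : ℝ) (h₁ : 0 < k₁) (h₂ : 0 < k₂)
    (ε : ℝ) : StarRep q HilbT :=
  StarRep.ofCore (actionT q hq k₁ k₂ h₁ h₂ ε) embedT embedT_injective embedT_denseRange
    (by
      intro v w
      rw [inner_embedT, inner_embedT, actionT_apply, actionT_apply,
        tensor_adj_K _ _ hq.1.ne' v.1 w.1, tensor_adj_K _ _ hq.1.ne' v.2 w.2, one_mul, one_mul])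
    (by
      intro v w
      rw [inner_embedT, inner_embedT, actionT_apply, actionT_apply,
        tensor_adj_E _ _ hq.1.ne' v.1 w.1, tensor_adj_E _ _ hq.1.ne' v.2 w.2]
      ring)

section
variable {q : ℝ} {ι : Type*} {H : ι → Type*} [∀ i, NormedAddCommGroup (H i)]
  [∀ i, InnerProductSpace ℂ (H i)] (π : ∀ i, StarRep q (H i))

/-- The domain of the direct sum of the `π_i`: the vectors `φ = (φ_i)` of the Hilbert sum such
that `φ_i` is in the domain of `π_i` for all `i` and `∑ ‖π_i(X) φ_i‖² < ∞` for all `X ∈ U_q`. -/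
def sumDomain : Submodule ℂ (lp H 2) where
  carrier := {φ | ∃ h : ∀ i, φ i ∈ (π i).domain,
    ∀ X : Uq q, Memℓp (fun i => ((π i).action X ⟨φ i, h i⟩ : H i)) 2}
  add_mem' := by
    rintro φ ψ ⟨h, hφ⟩ ⟨h', hψ⟩
    refine ⟨fun i => add_mem (h i) (h' i), fun X => ?_⟩
    have e : (fun i => ((π i).action X ⟨φ i + ψ i, add_mem (h i) (h' i)⟩ : H i)) =
        (fun i => ((π i).action X ⟨φ i, h i⟩ : H i)) +
          fun i => ((π i).action X ⟨ψ i, h' i⟩ : H i) := by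
      funext i
      rw [Pi.add_apply, ← Submodule.coe_add, ← map_add]
      rfl
    exact e ▸ (hφ X).add (hψ X)
  zero_mem' := by
    refine ⟨fun i => zero_mem _, fun X => ?_⟩
    have e : (fun i => ((π i).action X ⟨0, zero_mem _⟩ : H i)) = 0 := by
      funext i
      have : (⟨0, zero_mem _⟩ : (π i).domain) = 0 := rfl
      rw [this, map_zero]
      rfl
    exact e ▸ zero_memℓp
  smul_mem' := by
    rintro c φ ⟨h, hφ⟩
    refine ⟨fun i => Submodule.smul_mem _ c (h i), fun X => ?_⟩
    have e : (fun i => ((π i).action X ⟨c • φ i, Submodule.smul_mem _ c (h i)⟩ : H i)) =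
        c • fun i => ((π i).action X ⟨φ i, h i⟩ : H i) := by
      funext i
      rw [Pi.smul_apply, ← Submodule.coe_smul, ← map_smul]
      rfl
    exact e ▸ (hφ X).const_smul c

theorem single_mem_sumDomain [DecidableEq ι] (i : ι) (v : H i) (hv : v ∈ (π i).domain) :
    lp.single 2 i v ∈ sumDomain π := by
  have h : ∀ j, lp.single 2 i v j ∈ (π j).domain := by
    intro j
    by_cases hj : j = i
    · subst hj; rw [lp.single_apply_self]; exact hv
    · rw [lp.single_apply_ne _ _ _ hj]; exact zero_mem _
  refine ⟨h, fun X => (memℓp_zero ((Set.finite_singleton i).subset fun j hj => ?_)).of_exponent_ge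
    zero_le⟩
  by_contra hji
  refine hj ?_
  have : (⟨lp.single 2 i v j, h j⟩ : (π j).domain) = 0 :=
    Subtype.ext (lp.single_apply_ne 2 i v hji)
  change (((π j).action X ⟨lp.single 2 i v j, h j⟩ : (π j).domain) : H j) = 0
  rw [this, map_zero]
  rfl

theorem sumDomain_dense : Dense (sumDomain π : Set (lp H 2)) := by
  classical
  have hc : ∀ (i : ι) (v : H i), lp.single 2 i v ∈ (sumDomain π).topologicalClosure := by
    intro i v
    exact map_mem_closure (f := fun v => lp.single 2 i v)
      (lp.isometry_single i).continuous ((π i).dense v) (fun w hw => single_mem_sumDomain π i w hw)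
  intro φ
  have hmem : φ ∈ (sumDomain π).topologicalClosure :=
    (sumDomain π).isClosed_topologicalClosure.mem_of_tendsto (lp.hasSum_single (by norm_num) φ)
      (Filter.Eventually.of_forall fun s => sum_mem fun i _ => hc i _)
  exact hmem

/-- The componentwise action of `X ∈ U_q` on this domain. -/
def sumActionFun (X : Uq q) (φ : sumDomain π) : sumDomain π :=
  ⟨⟨fun i => ((π i).action X ⟨φ.1 i, φ.2.1 i⟩ : H i), φ.2.2 X⟩,
    fun i => ((π i).action X ⟨φ.1 i, φ.2.1 i⟩).2, fun Y => by
      have h := φ.2.2 (Y * X)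
      have e : (fun i => ((π i).action (Y * X) ⟨φ.1 i, φ.2.1 i⟩ : H i)) =
          fun i => ((π i).action Y ((π i).action X ⟨φ.1 i, φ.2.1 i⟩) : H i) := by
        funext i
        rw [map_mul, Module.End.mul_apply]
      rw [e] at h
      exact h⟩

theorem sumActionFun_apply (X : Uq q) (φ : sumDomain π) (i : ι) :
    (sumActionFun π X φ).1 i = ((π i).action X ⟨φ.1 i, φ.2.1 i⟩ : H i) := rfl

theorem sumDomain_ext {φ ψ : sumDomain π} (h : ∀ i, φ.1 i = ψ.1 i) : φ = ψ :=
  Subtype.ext (lp.ext (funext h))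

/-- The componentwise action of `U_q` on this domain. -/
def sumAction : Uq q →ₐ[ℂ] Module.End ℂ (sumDomain π) :=
  AlgHom.ofLinearMap
    { toFun := fun X =>
        { toFun := sumActionFun π X
          map_add' := fun φ ψ => sumDomain_ext π fun i => by
            have h : ((π i).action X (⟨φ.1 i, φ.2.1 i⟩ + ⟨ψ.1 i, ψ.2.1 i⟩) : H i) =
                ((π i).action X ⟨φ.1 i, φ.2.1 i⟩ : H i) +
                  ((π i).action X ⟨ψ.1 i, ψ.2.1 i⟩ : H i) := by
              rw [map_add, Submodule.coe_add]
            exact h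
          map_smul' := fun c φ => sumDomain_ext π fun i => by
            have h : ((π i).action X (c • ⟨φ.1 i, φ.2.1 i⟩) : H i) =
                c • ((π i).action X ⟨φ.1 i, φ.2.1 i⟩ : H i) := by
              rw [map_smul, Submodule.coe_smul]
            exact h }
      map_add' := fun X Y => LinearMap.ext fun φ => sumDomain_ext π fun i => by
        change (sumActionFun π (X + Y) φ).1 i =
          (sumActionFun π X φ).1 i + (sumActionFun π Y φ).1 i
        rw [sumActionFun_apply, sumActionFun_apply, sumActionFun_apply, map_add]
        rfl
      map_smul' := fun c X => LinearMap.ext fun φ => sumDomain_ext π fun i => by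
        change (sumActionFun π (c • X) φ).1 i = c • (sumActionFun π X φ).1 i
        rw [sumActionFun_apply, sumActionFun_apply, map_smul]
        rfl }
    (LinearMap.ext fun φ => sumDomain_ext π fun i => by
      change (sumActionFun π 1 φ).1 i = φ.1 i
      rw [sumActionFun_apply, map_one]
      rfl)
    (fun X Y => LinearMap.ext fun φ => sumDomain_ext π fun i => by
      change (sumActionFun π (X * Y) φ).1 i = (sumActionFun π X (sumActionFun π Y φ)).1 i
      rw [sumActionFun_apply, sumActionFun_apply, map_mul, Module.End.mul_apply]
      rfl)

/-- The Hilbert space direct sum of a family of `*`-representations. -/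
def StarRep.directSum : StarRep q (lp H 2) where
  domain := sumDomain π
  dense := sumDomain_dense π
  action := sumAction π
  star_K := fun φ ψ => by
    rw [lp.inner_eq_tsum, lp.inner_eq_tsum]
    exact tsum_congr fun i => (π i).star_K ⟨φ.1 i, φ.2.1 i⟩ ⟨ψ.1 i, ψ.2.1 i⟩
  star_E := fun φ ψ => by
    rw [lp.inner_eq_tsum, lp.inner_eq_tsum, ← tsum_neg]
    exact tsum_congr fun i => (π i).star_E ⟨φ.1 i, φ.2.1 i⟩ ⟨ψ.1 i, ψ.2.1 i⟩

end

/-! ### Big `q`-Jacobi polynomials -/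

/-- `(a; q)_n`. -/
def qPoch (a q : ℝ) (n : ℕ) : ℝ := ∏ i ∈ Finset.range n, (1 - a * q ^ i)

/-- `(a; q)_∞`. -/
def qPochInf (a q : ℝ) : ℝ := ∏' i : ℕ, (1 - a * q ^ i)

/-- The normalized Jacobi theta function `θ(x; q) = (x; q)_∞ (q/x; q)_∞`. -/
def qTheta (x q : ℝ) : ℝ := qPochInf x q * qPochInf (q / x) q

/-- The basic hypergeometric series `₃φ₂(a, b, c; d, e; q, z)`. -/
def phi32 (a b c d e q z : ℝ) : ℝ :=
  ∑' k : ℕ, qPoch a q k * qPoch b q k * qPoch c q k /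
    (qPoch q q k * qPoch d q k * qPoch e q k) * z ^ k

/-- The big `q`-Jacobi polynomial `P_m(x; a, b, c; q)`. -/
def bigQJacobi (m : ℕ) (x a b c q : ℝ) : ℝ :=
  phi32 (q ^ m)⁻¹ (a * b * q ^ (m + 1)) x (a * q) (c * q) q q

/-- The weight `u(x; a, b, c; q)`. -/
def weightU (x a b c q : ℝ) : ℝ :=
  qPochInf (x / a) q * qPochInf (x / c) q / (qPochInf x q * qPochInf (b * x / c) q)

/-- The quotient `(1 - a b q^{2m+1}) (abq; q)_m / (1 - abq)`, with the common factor `1 - abq`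
cancelled so that it also makes sense for `abq = 1`. -/
def weightFactor (m : ℕ) (a b q : ℝ) : ℝ :=
  match m with
  | 0 => 1
  | j + 1 => (1 - a * b * q ^ (2 * (j + 1) + 1)) * qPoch (a * b * q ^ 2) q j

/-- The dual weight `v(m; a, b, c; q)`. -/
def weightV (m : ℕ) (a b c q : ℝ) : ℝ :=
  weightFactor m a b q / (a * q) *
    (qPochInf (a * q) q * qPochInf (b * q) q * qPochInf (c * q) q * qPochInf (a * b * q / c) q /
      (qPochInf q q * qPochInf (a * b * q ^ 2) q * qTheta (c / a) q)) *
    (qPoch (a * q) q m * qPoch (c * q) q m /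
      (qPoch q q m * qPoch (b * q) q m * qPoch (a * b * q / c) q m)) *
    ((-(a * c * q ^ 2)) ^ m)⁻¹ * (q ^ (m.choose 2))⁻¹

/-- The normalized big `q`-Jacobi polynomial
`r_x(m) = √(|x| u(x) v(m)) P_m(x)`. -/
def normBigQJacobi (x : ℝ) (m : ℕ) (a b c q : ℝ) : ℝ :=
  √(|x| * weightU x a b c q * weightV m a b c q) * bigQJacobi m x a b c q

/-- `(Θ f⁻_{p,n})(m)`. -/
def thetaNeg (q k₁ k₂ ε : ℝ) (p : ℤ) (n m : ℕ) : ℝ :=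
  normBigQJacobi (q ^ (2 * n + 4 * k₁)) m
    (q ^ (4 * k₁ - 2)) (q ^ (4 * k₂ - 2)) (-q ^ (4 * k₁ - 2 * p - 2 * ε - 2)) (q ^ 2)

/-- `(Θ f⁺_{p,n})(m)`. -/
def thetaPos (q k₁ k₂ ε : ℝ) (p : ℤ) (n m : ℕ) : ℝ :=
  (-1) ^ n * normBigQJacobi (-q ^ (2 * n + 4 * k₁ - 2 * p - 2 * ε)) m
    (q ^ (4 * k₁ - 2)) (q ^ (4 * k₂ - 2)) (-q ^ (4 * k₁ - 2 * p - 2 * ε - 2)) (q ^ 2)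

/-- The vector `e_i ⊗ e_j` of the summand `ℓ²(ℕ) ⊗ ℓ²(ℤ)`. -/
def basisNeg (i : ℕ) (j : ℤ) : HilbT :=
  embedT (Finsupp.single i 1 ⊗ₜ[ℂ] Finsupp.single j 1, 0)

/-- The vector `e_j ⊗ e_i` of the summand `ℓ²(ℤ) ⊗ ℓ²(ℕ)`. -/
def basisPos (j : ℤ) (i : ℕ) : HilbT :=
  embedT (0, Finsupp.single j 1 ⊗ₜ[ℂ] Finsupp.single i 1)

end SU11

end

/-!
On each weight space of `T'` the intertwiner is the matrix of normalized big `q²`-Jacobi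
polynomials, with rows labelled by the degree `m` and columns by the nodes of a Jackson integral.
This matrix is orthogonal. Its rows are orthonormal: evaluated on `q`-shifted factorials, the
orthogonality functional is an Al-Salam–Verma `q`-beta integral, and the remaining finite sums are
those of `q`-Chu–Vandermonde. The rows are complete because the nodes are bounded: a summable
function on them is determined by its moments. Hence the matrices on the weight spaces glue to a
unitary operator.

This operator visibly intertwines `K`. The operators `E` and `F` change the weight, which replaces
the parameter `c` by `c / q²` or `c q²`; the first-order relations between the big `q²`-Jacobi
polynomials with these parameters say that it intertwines `E` and `F` as well.
-/

noncomputable section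

namespace SU11

/-! ### q-shifted factorials -/

section QPochhammer

open Filter Topology

variable {q : ℝ}

theorem abs_lt_one_of_mem_Ioo (hq : q ∈ Set.Ioo (0 : ℝ) 1) : |q| < 1 :=
  abs_lt.2 ⟨by linarith [hq.1], hq.2⟩

theorem one_sub_mul_pow_pos (hq : q ∈ Set.Ioo (0 : ℝ) 1) {y : ℝ} (hy : y < 1) (i : ℕ) :
    0 < 1 - y * q ^ i := by
  nlinarith [pow_pos hq.1 i, pow_le_one₀ hq.1.le hq.2.le (n := i)]

theorem qPoch_zero (y q : ℝ) : qPoch y q 0 = 1 := Finset.prod_range_zero _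

theorem qPoch_succ (y q : ℝ) (n : ℕ) : qPoch y q (n + 1) = qPoch y q n * (1 - y * q ^ n) :=
  Finset.prod_range_succ _ _

theorem qPoch_add (y q : ℝ) (m n : ℕ) :
    qPoch y q (m + n) = qPoch y q m * qPoch (y * q ^ m) q n := by
  simp only [qPoch, Finset.prod_range_add, pow_add, mul_assoc]

theorem qPoch_succ' (y q : ℝ) (n : ℕ) : qPoch y q (n + 1) = (1 - y) * qPoch (y * q) q n := by
  rw [add_comm, qPoch_add, pow_one, qPoch_succ, qPoch_zero, pow_zero, one_mul, mul_one]

theorem qPoch_pos (hq : q ∈ Set.Ioo (0 : ℝ) 1) {y : ℝ} (hy : y < 1) (n : ℕ) : 0 < qPoch y q n :=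
  Finset.prod_pos fun i _ => one_sub_mul_pow_pos hq hy i

theorem qPoch_ne_zero (hq : q ∈ Set.Ioo (0 : ℝ) 1) {y : ℝ} (hy : y < 1) (n : ℕ) :
    qPoch y q n ≠ 0 := (qPoch_pos hq hy n).ne'

theorem qPoch_inv_pow_eq_zero (hq : q ≠ 0) {m k : ℕ} (h : m < k) : qPoch (q ^ m)⁻¹ q k = 0 :=
  Finset.prod_eq_zero (Finset.mem_range.2 h) (by rw [inv_mul_cancel₀ (pow_ne_zero m hq), sub_self])

theorem inv_pow_succ_mul (hq : q ≠ 0) (m : ℕ) : (q ^ (m + 1))⁻¹ * q = (q ^ m)⁻¹ := by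
  rw [pow_succ, mul_inv, inv_mul_cancel_right₀ hq]

theorem qPoch_inv_pow_self (hq : q ≠ 0) (m : ℕ) :
    qPoch (q ^ m)⁻¹ q m = (-1) ^ m * qPoch q q m * (q ^ ((m + 1).choose 2))⁻¹ := by
  induction m with
  | zero => simp [qPoch_zero]
  | succ m ih =>
    rw [qPoch_succ', qPoch_succ, inv_pow_succ_mul hq, ih, Nat.choose_succ_succ' (m + 1) 1,
      Nat.choose_one_right, pow_add, pow_succ (-1 : ℝ)]
    field_simp
    ring

theorem summable_norm_mul_pow (hq : |q| < 1) (y : ℝ) : Summable fun i : ℕ => ‖-(y * q ^ i)‖ := by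
  simpa only [norm_neg] using ((summable_geometric_of_norm_lt_one hq).mul_left y).norm

theorem tendsto_qPoch (hq : |q| < 1) (y : ℝ) :
    Tendsto (qPoch y q) atTop (𝓝 (qPochInf y q)) := by
  have hmul : Multipliable fun i : ℕ => 1 - y * q ^ i := by
    simpa only [sub_eq_add_neg] using multipliable_one_add_of_summable (summable_norm_mul_pow hq y)
  exact hmul.hasProd.tendsto_prod_nat

theorem qPochInf_zero (q : ℝ) : qPochInf 0 q = 1 := by simp [qPochInf]

theorem qPochInf_eq_qPoch_mul (hq : |q| < 1) (y : ℝ) (n : ℕ) :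
    qPochInf y q = qPoch y q n * qPochInf (y * q ^ n) q := by
  have h_tail := (tendsto_qPoch hq (y * q ^ n)).const_mul (qPoch y q n)
  refine tendsto_nhds_unique ((tendsto_qPoch hq y).comp (tendsto_add_atTop_nat n))
    (h_tail.congr fun m => ?_)
  rw [Function.comp_apply, add_comm, qPoch_add]

theorem qPochInf_eq_one_sub_mul (hq : |q| < 1) (y : ℝ) :
    qPochInf y q = (1 - y) * qPochInf (y * q) q := by
  simpa [qPoch_succ, qPoch_zero] using qPochInf_eq_qPoch_mul hq y 1

theorem qPochInf_nonneg (hq : q ∈ Set.Ioo (0 : ℝ) 1) {y : ℝ} (hy : y ≤ 1) : 0 ≤ qPochInf y q := by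
  refine ge_of_tendsto' (tendsto_qPoch (abs_lt_one_of_mem_Ioo hq) y) fun n =>
    Finset.prod_nonneg fun i _ => ?_
  nlinarith [pow_pos hq.1 i, pow_le_one₀ hq.1.le hq.2.le (n := i)]

theorem qPochInf_pos (hq : q ∈ Set.Ioo (0 : ℝ) 1) {y : ℝ} (hy : y < 1) : 0 < qPochInf y q := by
  refine (qPochInf_nonneg hq hy.le).lt_of_ne' ?_
  have h_ne := tprod_one_add_ne_zero_of_summable (f := fun i : ℕ => -(y * q ^ i))
    (fun i => by simpa only [← sub_eq_add_neg] using (one_sub_mul_pow_pos hq hy i).ne')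
    (summable_norm_mul_pow (abs_lt_one_of_mem_Ioo hq) y)
  simpa only [qPochInf, sub_eq_add_neg] using h_ne

theorem qPochInf_le_qPochInf (hq : q ∈ Set.Ioo (0 : ℝ) 1) {x y : ℝ} (hxy : x ≤ y) (hy : y ≤ 1) :
    qPochInf y q ≤ qPochInf x q := by
  refine le_of_tendsto_of_tendsto' (tendsto_qPoch (abs_lt_one_of_mem_Ioo hq) y)
    (tendsto_qPoch (abs_lt_one_of_mem_Ioo hq) x) fun n =>
    Finset.prod_le_prod (fun i _ => ?_) fun i _ => ?_
  · nlinarith [pow_pos hq.1 i, pow_le_one₀ hq.1.le hq.2.le (n := i)]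
  · nlinarith [pow_pos hq.1 i]

theorem tendsto_qPochInf_mul_pow (hq : q ∈ Set.Ioo (0 : ℝ) 1) (y : ℝ) :
    Tendsto (fun n => qPochInf (y * q ^ n) q) atTop (𝓝 1) := by
  have hq' := abs_lt_one_of_mem_Ioo hq
  obtain ⟨N, hN⟩ : ∃ N : ℕ, y * q ^ N < 1 := by
    have h_zero := (tendsto_pow_atTop_nhds_zero_of_lt_one hq.1.le hq.2).const_mul y
    rw [mul_zero] at h_zero
    exact (h_zero.eventually_lt_const one_pos).exists
  rw [← tendsto_add_atTop_iff_nat N]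
  have h_pos := qPochInf_pos hq hN
  have h_ratio := (tendsto_qPoch hq' (y * q ^ N)).inv₀ h_pos.ne' |>.const_mul
    (qPochInf (y * q ^ N) q)
  rw [mul_inv_cancel₀ h_pos.ne'] at h_ratio
  refine h_ratio.congr fun n => ?_
  rw [qPochInf_eq_qPoch_mul hq' _ n, mul_right_comm, mul_inv_cancel₀ (qPoch_ne_zero hq hN n),
    one_mul, mul_assoc, ← pow_add, add_comm]

theorem sum_qChuVandermonde_succ (hq : q ≠ 0) (hqq : ∀ k, qPoch q q k ≠ 0) {C : ℝ}
    (hC : ∀ k, qPoch C q k ≠ 0) (B : ℝ) (m M : ℕ) :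
    ∑ k ∈ Finset.range (M + 1), qPoch (q ^ (m + 1))⁻¹ q k * qPoch B q k /
        (qPoch q q k * qPoch C q k) * q ^ k =
      ∑ k ∈ Finset.range (M + 1), qPoch (q ^ m)⁻¹ q k * qPoch B q k /
          (qPoch q q k * qPoch C q k) * q ^ k -
        (q ^ m)⁻¹ * (1 - B) / (1 - C) * ∑ k ∈ Finset.range M, qPoch (q ^ m)⁻¹ q k *
          qPoch (B * q) q k / (qPoch q q k * qPoch (C * q) q k) * q ^ k := by
  rw [Finset.sum_range_succ', Finset.sum_range_succ', Finset.mul_sum, add_sub_right_comm,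
    ← Finset.sum_sub_distrib]
  congr 1
  refine Finset.sum_congr rfl fun k _ => ?_
  have h_C := hC (k + 1)
  have h_qq := hqq (k + 1)
  rw [qPoch_succ', mul_ne_zero_iff] at h_C
  rw [qPoch_succ, mul_ne_zero_iff] at h_qq
  obtain ⟨h_one_sub_C, -⟩ := h_C
  obtain ⟨h_qk, h_one_sub_q⟩ := h_qq
  rw [qPoch_succ', qPoch_succ (q ^ m)⁻¹, qPoch_succ' B, qPoch_succ' C, qPoch_succ q,
    inv_pow_succ_mul hq]
  field_simp
  ring

theorem qChuVandermonde (hq : q ≠ 0) (hqq : ∀ k, qPoch q q k ≠ 0) {m M : ℕ} (hmM : m < M)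
    (B : ℝ) {C : ℝ} (hC : ∀ k, qPoch C q k ≠ 0) :
    ∑ k ∈ Finset.range M, qPoch (q ^ m)⁻¹ q k * qPoch B q k / (qPoch q q k * qPoch C q k) * q ^ k =
      (∏ i ∈ Finset.range m, (B - C * q ^ i)) / qPoch C q m := by
  obtain ⟨M, rfl⟩ := Nat.exists_eq_add_one_of_ne_zero (Nat.ne_zero_of_lt hmM)
  induction m generalizing M B C with
  | zero =>
    rw [Finset.sum_range_succ']
    simp [qPoch_succ', qPoch_zero]
  | succ m ih =>
    obtain ⟨M, rfl⟩ := Nat.exists_eq_add_one_of_ne_zero (show M ≠ 0 by omega)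
    have h_shift : ∀ k, (1 - C) ≠ 0 ∧ qPoch (C * q) q k ≠ 0 := fun k =>
      mul_ne_zero_iff.1 (qPoch_succ' C q k ▸ hC (k + 1))
    have h_ratio : qPoch (C * q) q m = qPoch C q m * (1 - C * q ^ m) / (1 - C) := by
      rw [← qPoch_succ, qPoch_succ', mul_div_cancel_left₀ _ (h_shift 0).1]
    have h_prod : ∏ i ∈ Finset.range m, (B * q - C * q * q ^ i) =
        q ^ m * ∏ i ∈ Finset.range m, (B - C * q ^ i) := by
      have h_factor : ∀ i, B * q - C * q * q ^ i = q * (B - C * q ^ i) := fun i => by ring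
      simp only [h_factor, Finset.prod_mul_distrib, Finset.prod_const, Finset.card_range]
    obtain ⟨h_Cm, h_last⟩ := mul_ne_zero_iff.1 (qPoch_succ C q m ▸ hC (m + 1))
    have h_one_sub := (h_shift 0).1
    rw [sum_qChuVandermonde_succ hq hqq hC, ih _ hC _ (by omega),
      ih (B * q) (fun k => (h_shift k).2) _ (by omega), h_prod, Finset.prod_range_succ, qPoch_succ,
      h_ratio]
    field_simp
    ring

end QPochhammer

/-! ### The q-beta integral -/

section QBeta

open Filter Topology

/-- The nodes `a q^(n+1)` and `c q^(n+1)` of the Jackson `q`-integral from `cq` to `aq`. -/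
def jacksonNode (a c q : ℝ) : ℕ ⊕ ℕ → ℝ :=
  Sum.elim (fun n => a * q * q ^ n) fun n => c * q * q ^ n

/-- The Jackson `q`-integral of `f` from `cq` to `aq`, divided by `1 - q`; the absolute values give
the correct signs when `c < 0 < a`. -/
def jacksonInt (a c q : ℝ) (f : ℝ → ℝ) : ℝ := ∑' i, |jacksonNode a c q i| * f (jacksonNode a c q i)

/-- The integrand of the Al-Salam–Verma `q`-beta integral. -/
def qBetaWeight (a c d e q x : ℝ) : ℝ :=
  qPochInf (x / a) q * qPochInf (x / c) q / (qPochInf (d * x) q * qPochInf (e * x) q)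

/-- The Al-Salam–Verma `q`-beta integral, divided by `1 - q`. -/
def qBetaInt (a c d e q : ℝ) : ℝ := jacksonInt a c q (qBetaWeight a c d e q)

/-- The parameters for which the integrand of the `q`-beta integral is positive on
`[cq, aq]`. -/
structure IsQBetaParam (a c d e q : ℝ) : Prop where
  q_mem : q ∈ Set.Ioo (0 : ℝ) 1
  a_pos : 0 < a
  c_neg : c < 0
  d_mul_lt_one : ∀ x ∈ Set.Icc (c * q) (a * q), d * x < 1
  e_mul_lt_one : ∀ x ∈ Set.Icc (c * q) (a * q), e * x < 1

variable {a c d e q : ℝ}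

theorem jacksonNode_mem_Icc (hq : q ∈ Set.Ioo (0 : ℝ) 1) (ha : 0 < a) (hc : c < 0) (i : ℕ ⊕ ℕ) :
    jacksonNode a c q i ∈ Set.Icc (c * q) (a * q) := by
  have haq : 0 < a * q := mul_pos ha hq.1
  have hcq : c * q < 0 := mul_neg_of_neg_of_pos hc hq.1
  rcases i with n | n <;>
  · have h_pos : 0 < q ^ n := pow_pos hq.1 n
    have h_le : q ^ n ≤ 1 := pow_le_one₀ hq.1.le hq.2.le
    simp only [jacksonNode, Sum.elim_inl, Sum.elim_inr]
    constructor <;> nlinarith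

theorem abs_jacksonNode_inl (hq : 0 < q) (ha : 0 < a) (n : ℕ) :
    |jacksonNode a c q (Sum.inl n)| = a * q * q ^ n :=
  abs_of_pos (mul_pos (mul_pos ha hq) (pow_pos hq n))

theorem abs_jacksonNode_inr (hq : 0 < q) (hc : c < 0) (n : ℕ) :
    |jacksonNode a c q (Sum.inr n)| = -(c * q * q ^ n) :=
  abs_of_neg (mul_neg_of_neg_of_pos (mul_neg_of_neg_of_pos hc hq) (pow_pos hq n))

theorem jacksonNode_ne_zero (hq : q ≠ 0) (ha : a ≠ 0) (hc : c ≠ 0) (i : ℕ ⊕ ℕ) :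
    jacksonNode a c q i ≠ 0 := by
  rcases i with n | n
  · exact mul_ne_zero (mul_ne_zero ha hq) (pow_ne_zero n hq)
  · exact mul_ne_zero (mul_ne_zero hc hq) (pow_ne_zero n hq)

theorem jacksonNode_injective (hq : q ∈ Set.Ioo (0 : ℝ) 1) (ha : 0 < a) (hc : c < 0) :
    Function.Injective (jacksonNode a c q) := by
  have h_pow := (pow_right_strictAnti₀ hq.1 hq.2).injective
  have haq : 0 < a * q := mul_pos ha hq.1
  have hcq : c * q < 0 := mul_neg_of_neg_of_pos hc hq.1
  refine Function.Injective.sumElim (fun _ _ h => h_pow (mul_left_cancel₀ haq.ne' h))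
    (fun _ _ h => h_pow (mul_left_cancel₀ hcq.ne h)) fun m n => ne_of_gt ?_
  exact (mul_neg_of_neg_of_pos hcq (pow_pos hq.1 n)).trans (mul_pos haq (pow_pos hq.1 m))

theorem hasSum_abs_jacksonNode (hq : q ∈ Set.Ioo (0 : ℝ) 1) (ha : 0 < a) (hc : c < 0) :
    HasSum (fun i => |jacksonNode a c q i|) ((a - c) * q / (1 - q)) := by
  have h_geom := hasSum_geometric_of_lt_one hq.1.le hq.2
  convert HasSum.sum (f := fun i => |jacksonNode a c q i|)
    ((h_geom.mul_left (a * q)).congr_fun fun n => abs_jacksonNode_inl hq.1 ha n)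
    ((h_geom.mul_left (-(c * q))).congr_fun fun n => ?_) using 1
  · ring
  · rw [Function.comp_apply, abs_jacksonNode_inr hq.1 hc, neg_mul]

theorem qBetaWeight_comm_left (x : ℝ) : qBetaWeight a c d e q x = qBetaWeight c a d e q x := by
  rw [qBetaWeight, qBetaWeight, mul_comm (qPochInf (x / a) q)]

theorem qBetaWeight_comm_right (x : ℝ) : qBetaWeight a c d e q x = qBetaWeight a c e d q x := by
  rw [qBetaWeight, qBetaWeight, mul_comm (qPochInf (d * x) q)]

theorem qBetaInt_comm_right : qBetaInt a c d e q = qBetaInt a c e d q := by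
  simp only [qBetaInt, jacksonInt, qBetaWeight_comm_right (d := d)]

theorem qBetaWeight_mul_q (hq : |q| < 1) {x : ℝ} (hd : d * x ≠ 1) :
    qBetaWeight a c (d * q) e q x = (1 - d * x) * qBetaWeight a c d e q x := by
  have h_ne : 1 - d * x ≠ 0 := sub_ne_zero.2 hd.symm
  rw [qBetaWeight, qBetaWeight, qPochInf_eq_one_sub_mul hq (d * x), mul_right_comm d q x]
  generalize d * x = y at *
  field_simp

theorem qBetaWeight_mul_pow (hq : |q| < 1) {x : ℝ} {m n : ℕ} (hd : qPoch (d * x) q m ≠ 0)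
    (he : qPoch (e * x) q n ≠ 0) :
    qBetaWeight a c (d * q ^ m) (e * q ^ n) q x =
      qBetaWeight a c d e q x * (qPoch (d * x) q m * qPoch (e * x) q n) := by
  rw [qBetaWeight, qBetaWeight, qPochInf_eq_qPoch_mul hq (d * x) m,
    qPochInf_eq_qPoch_mul hq (e * x) n, mul_right_comm d, mul_right_comm e]
  generalize d * x = y, e * x = z at *
  field_simp

theorem qBetaWeight_zero_zero (a c q x : ℝ) :
    qBetaWeight a c 0 0 q x = qPochInf (x / a) q * qPochInf (x / c) q := by
  rw [qBetaWeight, zero_mul, qPochInf_zero, mul_one, div_one]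

theorem tendsto_qBetaWeight_mul_pow (hq : q ∈ Set.Ioo (0 : ℝ) 1) (a c d e x : ℝ) :
    Tendsto (fun n => qBetaWeight a c d e q (x * q ^ n)) atTop (𝓝 1) := by
  have h_lim := ((tendsto_qPochInf_mul_pow hq (x / a)).mul
    (tendsto_qPochInf_mul_pow hq (x / c))).div ((tendsto_qPochInf_mul_pow hq (d * x)).mul
      (tendsto_qPochInf_mul_pow hq (e * x))) (mul_ne_zero one_ne_zero one_ne_zero)
  rw [mul_one, div_one] at h_lim
  refine h_lim.congr fun n => ?_
  simp only [Pi.div_apply, qBetaWeight, mul_div_right_comm, mul_assoc]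

theorem qBetaWeight_sub_qBetaWeight_mul (hq : q ∈ Set.Ioo (0 : ℝ) 1) (ha : a ≠ 0) (hc : c ≠ 0)
    {x : ℝ} (hd : d * x < 1) (he : e * x < 1) :
    qBetaWeight (a * q) (c * q) d e q x - qBetaWeight (a * q) (c * q) d e q (x * q) =
      x * (qBetaWeight a c d e q x *
        (d + e - 1 / (a * q) - 1 / (c * q) + x * (1 / (a * c * q ^ 2) - d * e))) := by
  have hq' := abs_lt_one_of_mem_Ioo hq
  have h_q : q ≠ 0 := hq.1.ne'
  have h_d := (qPochInf_pos hq hd).ne'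
  have h_e := (qPochInf_pos hq he).ne'
  rw [qPochInf_eq_one_sub_mul hq', mul_ne_zero_iff] at h_d h_e
  obtain ⟨h_d₀, h_d₁⟩ := h_d
  obtain ⟨h_e₀, h_e₁⟩ := h_e
  have h_shift : ∀ b : ℝ, x / (b * q) * q = x / b := fun b => by field_simp
  have h_linear : x * (d + e - 1 / (a * q) - 1 / (c * q) + x * (1 / (a * c * q ^ 2) - d * e)) =
      (1 - x / (a * q)) * (1 - x / (c * q)) - (1 - d * x) * (1 - e * x) := by
    field_simp
    ring
  rw [mul_left_comm, h_linear]
  simp only [qBetaWeight, mul_div_mul_right _ _ h_q, ← mul_assoc]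
  rw [qPochInf_eq_one_sub_mul hq' (x / (a * q)), qPochInf_eq_one_sub_mul hq' (x / (c * q)),
    qPochInf_eq_one_sub_mul hq' (d * x), qPochInf_eq_one_sub_mul hq' (e * x), h_shift, h_shift]
  clear h_linear
  generalize x / (a * q) = α, x / (c * q) = γ, x / a = α', x / c = γ', d * x = δ,
    e * x = η at *
  field_simp

theorem tendsto_sum_qBetaWeight_sub (hq : q ∈ Set.Ioo (0 : ℝ) 1) (ha : a ≠ 0) (c d e : ℝ) :
    Tendsto (fun N => ∑ n ∈ Finset.range N, (qBetaWeight (a * q) c d e q (a * q * q ^ n) -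
      qBetaWeight (a * q) c d e q (a * q * q ^ n * q))) atTop (𝓝 (-1)) := by
  have h_end : qBetaWeight (a * q) c d e q (a * q) = 0 := by
    rw [qBetaWeight, div_self (mul_ne_zero ha hq.1.ne'),
      qPochInf_eq_one_sub_mul (abs_lt_one_of_mem_Ioo hq), sub_self, zero_mul, zero_mul, zero_div]
  have h_lim := (tendsto_qBetaWeight_mul_pow hq (a * q) c d e (a * q)).const_sub 0
  rw [zero_sub] at h_lim
  refine h_lim.congr fun N => ?_
  have h_sum := Finset.sum_range_sub' (fun n => qBetaWeight (a * q) c d e q (a * q * q ^ n)) N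
  simp only [pow_zero, mul_one, h_end, pow_succ, ← mul_assoc] at h_sum
  exact h_sum.symm

theorem exists_mul_pow_mul_le (hq : q ∈ Set.Ioo (0 : ℝ) 1) {l r : ℝ} (hlr : l ≤ r)
    (hd : ∀ x ∈ Set.Icc l r, d * x < 1) :
    ∃ δ < 1, ∀ n : ℕ, ∀ x ∈ Set.Icc l r, d * q ^ n * x ≤ δ := by
  refine ⟨max (max (d * l) (d * r)) 0, by simp [hd, hlr], fun n x hx => ?_⟩
  have h_pos := pow_pos hq.1 n
  have h_le : q ^ n ≤ 1 := pow_le_one₀ hq.1.le hq.2.le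
  have h_end : d * x ≤ max (d * l) (d * r) := by
    rcases le_total 0 d with h | h
    · exact le_max_of_le_right (mul_le_mul_of_nonneg_left hx.2 h)
    · exact le_max_of_le_left (mul_le_mul_of_nonpos_left hx.1 h)
  rw [mul_right_comm]
  rcases le_total (d * x) 0 with h | h
  · exact le_max_of_le_right (mul_nonpos_of_nonpos_of_nonneg h h_pos.le)
  · exact le_max_of_le_left ((mul_le_of_le_one_right h h_le).trans h_end)

theorem qBetaWeight_le (hq : q ∈ Set.Ioo (0 : ℝ) 1) {x α γ δ η : ℝ} (hα : α ≤ x / a)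
    (hγ : γ ≤ x / c) (ha : x / a ≤ 1) (hc : x / c ≤ 1) (hd : d * x ≤ δ) (he : e * x ≤ η)
    (hδ : δ < 1) (hη : η < 1) : |qBetaWeight a c d e q x| ≤
      qPochInf α q * qPochInf γ q / (qPochInf δ q * qPochInf η q) := by
  have h_a := qPochInf_nonneg hq ha
  have h_c := qPochInf_nonneg hq hc
  have h_d := qPochInf_pos hq (hd.trans_lt hδ)
  have h_e := qPochInf_pos hq (he.trans_lt hη)
  have h_α := qPochInf_le_qPochInf hq hα ha
  have h_γ := qPochInf_le_qPochInf hq hγ hc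
  have h_δ := qPochInf_le_qPochInf hq hd hδ.le
  have h_η := qPochInf_le_qPochInf hq he hη.le
  have h_δ₀ := qPochInf_pos hq hδ
  have h_η₀ := qPochInf_pos hq hη
  have h_α₀ := h_a.trans h_α
  have h_γ₀ := h_c.trans h_γ
  rw [abs_of_nonneg (by unfold qBetaWeight; positivity), qBetaWeight]
  gcongr

namespace IsQBetaParam

variable (P : IsQBetaParam a c d e q)
include P

theorem abs_q_lt_one : |q| < 1 := abs_lt_one_of_mem_Ioo P.q_mem

theorem comm_right : IsQBetaParam a c e d q :=
  ⟨P.q_mem, P.a_pos, P.c_neg, P.e_mul_lt_one, P.d_mul_lt_one⟩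

theorem mul_pow_left (n : ℕ) : IsQBetaParam a c (d * q ^ n) e q where
  __ := P
  d_mul_lt_one x hx := by
    have h_pos := pow_pos P.q_mem.1 n
    have h_le : q ^ n ≤ 1 := pow_le_one₀ P.q_mem.1.le P.q_mem.2.le
    have hd := P.d_mul_lt_one x hx
    rcases le_total (d * x) 0 with _ | _ <;> nlinarith

theorem node_mem (i : ℕ ⊕ ℕ) : jacksonNode a c q i ∈ Set.Icc (c * q) (a * q) :=
  jacksonNode_mem_Icc P.q_mem P.a_pos P.c_neg i

theorem summable_abs_node : Summable fun i => |jacksonNode a c q i| :=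
  (hasSum_abs_jacksonNode P.q_mem P.a_pos P.c_neg).summable

theorem div_mem {x : ℝ} (hx : x ∈ Set.Icc (c * q) (a * q)) :
    x / a ∈ Set.Icc (c * q / a) q ∧ x / c ∈ Set.Icc (a * q / c) q := by
  have ha := P.a_pos
  refine ⟨⟨by gcongr; exact hx.1, (div_le_iff₀ ha).2 (by linarith [hx.2])⟩, ?_, ?_⟩
  · exact div_le_div_of_nonpos_of_le P.c_neg.le hx.2
  · exact (div_le_iff_of_neg P.c_neg).2 (by linarith [hx.1])

theorem weight_pos {x : ℝ} (hx : x ∈ Set.Icc (c * q) (a * q)) : 0 < qBetaWeight a c d e q x := by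
  obtain ⟨h_a, h_c⟩ := P.div_mem hx
  exact div_pos (mul_pos (qPochInf_pos P.q_mem (h_a.2.trans_lt P.q_mem.2))
    (qPochInf_pos P.q_mem (h_c.2.trans_lt P.q_mem.2))) (mul_pos
    (qPochInf_pos P.q_mem (P.d_mul_lt_one x hx)) (qPochInf_pos P.q_mem (P.e_mul_lt_one x hx)))

theorem exists_weight_mul_pow_bound :
    ∃ B, ∀ n : ℕ, ∀ i, |qBetaWeight a c (d * q ^ n) (e * q ^ n) q (jacksonNode a c q i)| ≤ B := by
  have h_le := (P.node_mem (Sum.inl 0)).1.trans (P.node_mem (Sum.inl 0)).2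
  obtain ⟨δ, hδ, h_δ⟩ := exists_mul_pow_mul_le P.q_mem h_le P.d_mul_lt_one
  obtain ⟨η, hη, h_η⟩ := exists_mul_pow_mul_le P.q_mem h_le P.e_mul_lt_one
  refine ⟨qPochInf (c * q / a) q * qPochInf (a * q / c) q / (qPochInf δ q * qPochInf η q),
    fun n i => ?_⟩
  have hx := P.node_mem i
  obtain ⟨h_a, h_c⟩ := P.div_mem hx
  exact qBetaWeight_le P.q_mem h_a.1 h_c.1 (h_a.2.trans P.q_mem.2.le) (h_c.2.trans P.q_mem.2.le)
    (h_δ n _ hx) (h_η n _ hx) hδ hη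

theorem summable_node_mul_weight_mul {f : ℝ → ℝ} {M : ℝ}
    (hf : ∀ x ∈ Set.Icc (c * q) (a * q), |f x| ≤ M) :
    Summable fun i => |jacksonNode a c q i| *
      (qBetaWeight a c d e q (jacksonNode a c q i) * f (jacksonNode a c q i)) := by
  obtain ⟨B, hB⟩ := P.exists_weight_mul_pow_bound
  refine (P.summable_abs_node.mul_right (B * M)).of_norm_bounded fun i => ?_
  have h_weight := hB 0 i
  simp only [pow_zero, mul_one] at h_weight
  have h_f := hf _ (P.node_mem i)
  have h_B := (abs_nonneg _).trans h_weight
  rw [norm_mul, norm_mul, Real.norm_eq_abs, abs_abs, Real.norm_eq_abs, Real.norm_eq_abs]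
  gcongr

theorem summable_node_mul_weight :
    Summable fun i => |jacksonNode a c q i| * qBetaWeight a c d e q (jacksonNode a c q i) := by
  simpa only [mul_one] using P.summable_node_mul_weight_mul (f := fun _ => 1) (M := 1) (by simp)

theorem node_mul_weight_pos (i : ℕ ⊕ ℕ) :
    0 < |jacksonNode a c q i| * qBetaWeight a c d e q (jacksonNode a c q i) :=
  mul_pos (abs_pos.2 (jacksonNode_ne_zero P.q_mem.1.ne' P.a_pos.ne' P.c_neg.ne i))
    (P.weight_pos (P.node_mem i))

theorem qBetaInt_pos : 0 < qBetaInt a c d e q :=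
  P.summable_node_mul_weight.tsum_pos (fun i => (P.node_mul_weight_pos i).le) (Sum.inl 0)
    (P.node_mul_weight_pos _)

-- On each half of the support the sum telescopes: the primitive is the weight for the parameters
-- `aq` and `cq`, which vanishes at the end point and tends to `1` at the origin.
theorem hasSum_node_mul_weight_mul :
    HasSum (fun i => |jacksonNode a c q i| * (qBetaWeight a c d e q (jacksonNode a c q i) *
      (d + e - 1 / (a * q) - 1 / (c * q) +
        jacksonNode a c q i * (1 / (a * c * q ^ 2) - d * e)))) 0 := by
  have h_cont : Continuous fun x : ℝ =>
      d + e - 1 / (a * q) - 1 / (c * q) + x * (1 / (a * c * q ^ 2) - d * e) := by fun_prop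
  obtain ⟨M, hM⟩ := isCompact_Icc.exists_bound_of_continuousOn h_cont.continuousOn
  have h_summable := P.summable_node_mul_weight_mul hM
  have h_diff (i) := qBetaWeight_sub_qBetaWeight_mul P.q_mem P.a_pos.ne' P.c_neg.ne
    (P.d_mul_lt_one _ (P.node_mem i)) (P.e_mul_lt_one _ (P.node_mem i))
  have h_left := (h_summable.comp_injective Sum.inl_injective).hasSum_iff_tendsto_nat.2 <|
    (tendsto_sum_qBetaWeight_sub P.q_mem P.a_pos.ne' (c * q) d e).congr fun N =>
      Finset.sum_congr rfl fun n _ => by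
        rw [Function.comp_apply, abs_jacksonNode_inl P.q_mem.1 P.a_pos]
        exact h_diff (Sum.inl n)
  have h_right := (h_summable.comp_injective Sum.inr_injective).hasSum_iff_tendsto_nat.2 <|
    (tendsto_sum_qBetaWeight_sub P.q_mem P.c_neg.ne (a * q) d e).neg.congr fun N => by
      rw [← Finset.sum_neg_distrib]
      refine Finset.sum_congr rfl fun n _ => ?_
      rw [Function.comp_apply, abs_jacksonNode_inr P.q_mem.1 P.c_neg, neg_mul,
        qBetaWeight_comm_left, qBetaWeight_comm_left (a := c * q)]
      exact congrArg _ (h_diff (Sum.inr n))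
  simpa using h_left.sum h_right

theorem qBetaInt_mul_q :
    qBetaInt a c (d * q) e q * (1 - a * c * d * e * q ^ 2) =
      (1 - a * d * q) * (1 - c * d * q) * qBetaInt a c d e q := by
  have h_sum := (P.summable_node_mul_weight.hasSum.mul_left
    ((1 - a * d * q) * (1 - c * d * q))).sub
      (P.hasSum_node_mul_weight_mul.mul_left (d * a * c * q ^ 2))
  rw [mul_zero, sub_zero] at h_sum
  rw [mul_comm (qBetaInt _ _ _ _ _), qBetaInt, jacksonInt, ← tsum_mul_left]
  refine (h_sum.congr_fun fun i => ?_).tsum_eq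
  rw [qBetaWeight_mul_q P.abs_q_lt_one (P.d_mul_lt_one _ (P.node_mem i)).ne]
  have hq := P.q_mem.1.ne'
  have ha := P.a_pos.ne'
  have hc := P.c_neg.ne
  field_simp
  ring

theorem qBetaInt_mul_pow_left (k : ℕ) :
    qBetaInt a c (d * q ^ k) e q * qPoch (a * c * d * e * q ^ 2) q k =
      qPoch (a * d * q) q k * qPoch (c * d * q) q k * qBetaInt a c d e q := by
  induction k with
  | zero => simp [qPoch_zero]
  | succ k ih =>
    have h_step := (P.mul_pow_left k).qBetaInt_mul_q
    rw [pow_succ, ← mul_assoc, qPoch_succ, qPoch_succ, qPoch_succ]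
    linear_combination qPoch (a * c * d * e * q ^ 2) q k * h_step +
      (1 - a * d * q * q ^ k) * (1 - c * d * q * q ^ k) * ih

theorem qBetaInt_mul_pow (k l : ℕ) :
    qBetaInt a c (d * q ^ k) (e * q ^ l) q * qPoch (a * c * d * e * q ^ 2) q (k + l) =
      qPoch (a * d * q) q k * qPoch (c * d * q) q k *
        (qPoch (a * e * q) q l * qPoch (c * e * q) q l) * qBetaInt a c d e q := by
  have h_left := P.qBetaInt_mul_pow_left k
  have h_right := (P.mul_pow_left k).comm_right.qBetaInt_mul_pow_left l
  rw [qBetaInt_comm_right, qBetaInt_comm_right (d := e), show a * c * e * (d * q ^ k) * q ^ 2 =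
    a * c * d * e * q ^ 2 * q ^ k by ring] at h_right
  rw [qPoch_add]
  linear_combination qPoch (a * c * d * e * q ^ 2) q k * h_right +
    qPoch (a * e * q) q l * qPoch (c * e * q) q l * h_left

theorem tendsto_qBetaInt_mul_pow :
    Tendsto (fun n : ℕ => qBetaInt a c (d * q ^ n) (e * q ^ n) q) atTop
      (𝓝 (qBetaInt a c 0 0 q)) := by
  obtain ⟨B, hB⟩ := P.exists_weight_mul_pow_bound
  refine tendsto_tsum_of_dominated_convergence (bound := fun i => |jacksonNode a c q i| * B)
    (P.summable_abs_node.mul_right B) (fun i => Tendsto.const_mul _ ?_)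
    (Eventually.of_forall fun n i => ?_)
  · have h_lim := (tendsto_const_nhds (x := qPochInf (jacksonNode a c q i / a) q *
      qPochInf (jacksonNode a c q i / c) q)).div
        ((tendsto_qPochInf_mul_pow P.q_mem (d * jacksonNode a c q i)).mul
          (tendsto_qPochInf_mul_pow P.q_mem (e * jacksonNode a c q i)))
        (mul_ne_zero one_ne_zero one_ne_zero)
    rw [mul_one, div_one] at h_lim
    rw [qBetaWeight_zero_zero]
    refine h_lim.congr fun n => ?_
    rw [Pi.div_apply, qBetaWeight, mul_right_comm d, mul_right_comm e]
  · rw [norm_mul, Real.norm_eq_abs, abs_abs]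
    exact mul_le_mul_of_nonneg_left (hB n i) (abs_nonneg _)

theorem qBetaInt_zero_zero_mul :
    qBetaInt a c 0 0 q * qPochInf (a * c * d * e * q ^ 2) q =
      qPochInf (a * d * q) q * qPochInf (c * d * q) q *
        (qPochInf (a * e * q) q * qPochInf (c * e * q) q) * qBetaInt a c d e q := by
  have h_double : Tendsto (fun n : ℕ => n + n) atTop atTop :=
    tendsto_atTop_mono (fun n => Nat.le_add_left n n) tendsto_id
  have h_poch := tendsto_qPoch P.abs_q_lt_one
  have h_lhs := P.tendsto_qBetaInt_mul_pow.mul ((h_poch (a * c * d * e * q ^ 2)).comp h_double)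
  have h_rhs := (((h_poch (a * d * q)).mul (h_poch (c * d * q))).mul
    ((h_poch (a * e * q)).mul (h_poch (c * e * q)))).mul_const (qBetaInt a c d e q)
  exact tendsto_nhds_unique h_lhs (h_rhs.congr fun n => (P.qBetaInt_mul_pow n n).symm)

end IsQBetaParam

theorem isQBetaParam_inv_inv (hq : q ∈ Set.Ioo (0 : ℝ) 1) (ha : 0 < a) (hc : c < 0) :
    IsQBetaParam a c c⁻¹ a⁻¹ q where
  q_mem := hq
  a_pos := ha
  c_neg := hc
  d_mul_lt_one x hx := by
    rw [inv_mul_eq_div, div_lt_one_of_neg hc]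
    nlinarith [hx.1, hq.2]
  e_mul_lt_one x hx := by
    rw [inv_mul_eq_div, div_lt_one ha]
    nlinarith [hx.2, hq.2]

theorem qBetaInt_inv_inv (hq : q ∈ Set.Ioo (0 : ℝ) 1) (ha : 0 < a) (hc : c < 0) :
    qBetaInt a c c⁻¹ a⁻¹ q = (a - c) * q / (1 - q) := by
  have P := isQBetaParam_inv_inv hq ha hc
  refine ((hasSum_abs_jacksonNode hq ha hc).congr_fun fun i => ?_).tsum_eq
  have h_weight := (P.weight_pos (P.node_mem i)).ne'
  rw [qBetaWeight, inv_mul_eq_div, inv_mul_eq_div, mul_comm (qPochInf (_ / c) q)] at h_weight ⊢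
  rw [div_self (div_ne_zero_iff.1 h_weight).2, mul_one]

-- For `d = 1 / c` and `e = 1 / a` the weight is identically `1`, so the `q`-integral is a geometric
-- series; this fixes the constant in the recurrence.
theorem qBetaInt_zero_zero (hq : q ∈ Set.Ioo (0 : ℝ) 1) (ha : 0 < a) (hc : c < 0) :
    qBetaInt a c 0 0 q = a * q * qPochInf q q * qTheta (c / a) q := by
  have hq' := abs_lt_one_of_mem_Ioo hq
  have h_eval := (isQBetaParam_inv_inv hq ha hc).qBetaInt_zero_zero_mul
  have h_qq : qPochInf (q * q) q ≠ 0 := (qPochInf_pos hq (by nlinarith [hq.1, hq.2])).ne'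
  have h_one_sub : 1 - q ≠ 0 := (sub_pos.2 hq.2).ne'
  have h_arg : a * c * c⁻¹ * a⁻¹ * q ^ 2 = q * q ∧ a * c⁻¹ * q = q / (c / a) ∧
      c * c⁻¹ * q = q ∧ a * a⁻¹ * q = q ∧ c * a⁻¹ * q = c / a * q := by
    have ha' := ha.ne'
    have hc' := hc.ne
    refine ⟨?_, ?_, ?_, ?_, ?_⟩ <;> field_simp
  obtain ⟨h_prod, h_ac, h_cc, h_aa, h_ca⟩ := h_arg
  rw [qBetaInt_inv_inv hq ha hc, h_prod, h_ac, h_cc, h_aa, h_ca] at h_eval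
  refine mul_right_cancel₀ h_qq (h_eval.trans ?_)
  rw [qTheta, qPochInf_eq_one_sub_mul hq' (c / a), qPochInf_eq_one_sub_mul hq' q]
  field_simp

theorem IsQBetaParam.qBetaInt_eq (P : IsQBetaParam a c d e q) :
    qPochInf (a * d * q) q * qPochInf (c * d * q) q *
        (qPochInf (a * e * q) q * qPochInf (c * e * q) q) * qBetaInt a c d e q =
      a * q * qPochInf q q * qTheta (c / a) q * qPochInf (a * c * d * e * q ^ 2) q := by
  rw [← P.qBetaInt_zero_zero_mul, qBetaInt_zero_zero P.q_mem P.a_pos P.c_neg]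

end QBeta

/-! ### Orthogonality of the big q-Jacobi polynomials -/

section BigQJacobi

open Polynomial

theorem linearMap_eq_zero_of_degree {K E : Type*} [Field K] [AddCommGroup E] [Module K E]
    {p : ℕ → K[X]} (hp : ∀ k, (p k).degree = k) (L : K[X] →ₗ[K] E) {n : ℕ}
    (hL : ∀ k ≤ n, L (p k) = 0) {f : K[X]} (hf : f.degree ≤ n) : L f = 0 := by
  let S : Polynomial.Sequence K := ⟨p, hp⟩
  have h_le : degreeLE K n ≤ LinearMap.ker L := by
    rw [← S.span_degreeLE fun k _ => (leadingCoeff_ne_zero.2 (S.ne_zero k)).isUnit,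
      Submodule.span_le]
    rintro _ ⟨k, hk, rfl⟩
    exact hL k hk
  exact h_le (mem_degreeLE.2 hf)

theorem linearMap_mul_coeff_of_degree {K : Type*} [Field K] {p : ℕ → K[X]}
    (hp : ∀ k, (p k).degree = k) (L : K[X] →ₗ[K] K) {n : ℕ} (hL : ∀ k < n, L (p k) = 0) {f : K[X]}
    (hf : f.degree ≤ n) : L f * (p n).coeff n = f.coeff n * L (p n) := by
  have h_zero := linearMap_eq_zero_of_degree hp ((p n).coeff n • L - L (p n) • lcoeff K n) (n := n)
    (fun k hk => ?_) hf
  · simp only [LinearMap.sub_apply, LinearMap.smul_apply, lcoeff_apply, smul_eq_mul] at h_zero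
    linear_combination h_zero
  · rcases hk.eq_or_lt with rfl | hk
    · simp [mul_comm]
    · simp [hL k hk, coeff_eq_zero_of_degree_lt ((hp k).trans_lt (Nat.cast_lt.2 hk))]

/-- The conditions on the parameters under which the big `q`-Jacobi polynomials are orthogonal with
respect to a positive measure. -/
structure IsBigQJacobiParam (a b c q : ℝ) : Prop where
  q_mem : q ∈ Set.Ioo (0 : ℝ) 1
  a_pos : 0 < a
  aq_lt_one : a * q < 1
  b_pos : 0 < b
  bq_lt_one : b * q < 1
  c_neg : c < 0

/-- The coefficient of `(x; q)_k` in the big `q`-Jacobi polynomial `P_m(x; a, b, c; q)`. -/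
def bigQJacobiCoeff (a b c q : ℝ) (m k : ℕ) : ℝ :=
  qPoch (q ^ m)⁻¹ q k * qPoch (a * b * q ^ (m + 1)) q k /
    (qPoch q q k * qPoch (a * q) q k * qPoch (c * q) q k) * q ^ k

/-- The polynomial `(eX; q)_k`. -/
def qPochPoly (e q : ℝ) (k : ℕ) : ℝ[X] := ∏ i ∈ Finset.range k, (1 - C (e * q ^ i) * X)

/-- The big `q`-Jacobi polynomial `P_m(X; a, b, c; q)` as an element of `ℝ[X]`. -/
def bigQJacobiPoly (a b c q : ℝ) (m : ℕ) : ℝ[X] :=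
  ∑ k ∈ Finset.range (m + 1), C (bigQJacobiCoeff a b c q m k) * qPochPoly 1 q k

variable {a b c q : ℝ}

theorem bigQJacobi_eq_sum (hq : q ≠ 0) (a b c x : ℝ) {m M : ℕ} (h : m < M) :
    bigQJacobi m x a b c q = ∑ k ∈ Finset.range M, bigQJacobiCoeff a b c q m k * qPoch x q k := by
  rw [bigQJacobi, phi32, tsum_eq_sum (s := Finset.range M)]
  · exact Finset.sum_congr rfl fun k _ => by rw [bigQJacobiCoeff]; ring
  · intro k hk
    rw [qPoch_inv_pow_eq_zero hq (h.trans_le (by simpa using hk))]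
    simp

theorem eval_qPochPoly (e q x : ℝ) (k : ℕ) : (qPochPoly e q k).eval x = qPoch (e * x) q k := by
  simp only [qPochPoly, qPoch, eval_prod, eval_sub, eval_one, eval_mul, eval_C, eval_X]
  exact Finset.prod_congr rfl fun i _ => by ring

theorem natDegree_qPochPoly_le (e q : ℝ) (k : ℕ) : (qPochPoly e q k).natDegree ≤ k := by
  refine (natDegree_prod_le _ _).trans ((Finset.sum_le_card_nsmul _ _ 1 fun i _ => ?_).trans
    (by simp))
  compute_degree

theorem coeff_qPochPoly (e q : ℝ) (k : ℕ) :
    (qPochPoly e q k).coeff k = (-e) ^ k * q ^ (k.choose 2) := by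
  induction k with
  | zero => simp [qPochPoly]
  | succ k ih =>
    have h_succ : qPochPoly e q (k + 1) = qPochPoly e q k * (1 - C (e * q ^ k) * X) :=
      Finset.prod_range_succ _ _
    rw [h_succ, mul_sub, mul_one, coeff_sub,
      coeff_eq_zero_of_natDegree_lt (Nat.lt_succ_of_le (natDegree_qPochPoly_le e q k)),
      ← mul_assoc, coeff_mul_X, coeff_mul_C, ih, Nat.choose_succ_succ' k 1, Nat.choose_one_right,
      pow_add]
    ring

theorem degree_qPochPoly {e : ℝ} (he : e ≠ 0) (hq : q ≠ 0) (k : ℕ) :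
    (qPochPoly e q k).degree = k := by
  refine degree_eq_of_le_of_coeff_ne_zero
    (natDegree_le_iff_degree_le.1 (natDegree_qPochPoly_le e q k)) ?_
  rw [coeff_qPochPoly]
  exact mul_ne_zero (pow_ne_zero _ (neg_ne_zero.2 he)) (pow_ne_zero _ hq)

theorem eval_bigQJacobiPoly (hq : q ≠ 0) (a b c x : ℝ) (m : ℕ) :
    (bigQJacobiPoly a b c q m).eval x = bigQJacobi m x a b c q := by
  rw [bigQJacobi_eq_sum hq a b c x m.lt_succ_self, bigQJacobiPoly]
  simp [eval_finsetSum, eval_qPochPoly]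

theorem degree_bigQJacobiPoly_le (a b c q : ℝ) (m : ℕ) : (bigQJacobiPoly a b c q m).degree ≤ m := by
  refine natDegree_le_iff_degree_le.1 (natDegree_sum_le_of_forall_le _ _ fun k hk => ?_)
  refine (natDegree_C_mul_le _ _).trans ((natDegree_qPochPoly_le _ _ _).trans ?_)
  simpa [Nat.lt_succ_iff] using hk

theorem coeff_bigQJacobiPoly (hq : q ≠ 0) {m : ℕ} (hqq : qPoch q q m ≠ 0) (a b c : ℝ) :
    (bigQJacobiPoly a b c q m).coeff m =
      qPoch (a * b * q ^ (m + 1)) q m / (qPoch (a * q) q m * qPoch (c * q) q m) := by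
  have h_coeff : (bigQJacobiPoly a b c q m).coeff m =
      bigQJacobiCoeff a b c q m m * ((-1) ^ m * q ^ (m.choose 2)) := by
    rw [bigQJacobiPoly, finsetSum_coeff, Finset.sum_range_succ, Finset.sum_eq_zero, zero_add,
      coeff_C_mul, coeff_qPochPoly]
    intro k hk
    rw [coeff_C_mul, coeff_eq_zero_of_natDegree_lt
      ((natDegree_qPochPoly_le _ _ _).trans_lt (Finset.mem_range.1 hk)), mul_zero]
  have h_sign : (-1 : ℝ) ^ m * (-1) ^ m = 1 := by simp [← mul_pow]
  rw [h_coeff, bigQJacobiCoeff, qPoch_inv_pow_self hq, Nat.choose_succ_succ' m 1,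
    Nat.choose_one_right, pow_add]
  generalize qPoch (a * b * q ^ (m + 1)) q m = X
  rw [mul_assoc (qPoch q q m)]
  generalize qPoch (a * q) q m * qPoch (c * q) q m = Y
  field_simp
  linear_combination X / Y * h_sign

theorem weightFactor_mul (a b q : ℝ) (m : ℕ) :
    qPoch (a * b * q ^ (m + 1)) q m * weightFactor m a b q =
      qPoch (a * b * q ^ 2) q m * qPoch (a * b * q ^ (m + 2)) q m := by
  rcases m with _ | j
  · simp [weightFactor, qPoch_zero]
  · have h_split := qPoch_add (a * b * q ^ 2) q j (j + 2)
    rw [show a * b * q ^ 2 * q ^ j = a * b * q ^ (j + 1 + 1) by ring,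
      qPoch_succ _ q (j + 1)] at h_split
    rw [show a * b * q ^ (j + 1 + 2) = a * b * q ^ 2 * q ^ (j + 1) by ring, ← qPoch_add,
      show j + 1 + (j + 1) = j + (j + 2) by ring, h_split]
    simp only [weightFactor]
    ring

theorem two_mul_choose_two_add (m : ℕ) : 2 * m.choose 2 + 2 * m = (m + 1) * m := by
  induction m with
  | zero => rfl
  | succ m ih =>
    rw [Nat.choose_succ_succ' m 1, Nat.choose_one_right]
    linarith

theorem mul_pow_succ_pow (hc : c ≠ 0) (a b q : ℝ) (m : ℕ) :
    (a * b * q ^ (m + 1)) ^ m =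
      (-(b / c)) ^ m * q ^ (m.choose 2) * ((-(a * c * q ^ 2)) ^ m * q ^ (m.choose 2)) := by
  have h_base : -(b / c) * -(a * c * q ^ 2) = a * b * q ^ 2 := by field_simp
  rw [mul_mul_mul_comm, ← mul_pow, h_base, mul_pow, mul_pow (a * b), ← pow_mul, ← pow_mul,
    ← two_mul_choose_two_add]
  ring

namespace IsBigQJacobiParam

variable (P : IsBigQJacobiParam a b c q)
include P

theorem q_ne_zero : q ≠ 0 := P.q_mem.1.ne'

theorem cq_neg : c * q < 0 := mul_neg_of_neg_of_pos P.c_neg P.q_mem.1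

theorem isQBetaParam : IsQBetaParam a c 1 (b / c) q where
  q_mem := P.q_mem
  a_pos := P.a_pos
  c_neg := P.c_neg
  d_mul_lt_one x hx := by linarith [hx.2, P.aq_lt_one]
  e_mul_lt_one x hx := by
    refine (mul_le_mul_of_nonpos_left hx.1 (div_neg_of_pos_of_neg P.b_pos P.c_neg).le).trans_lt ?_
    rw [← mul_assoc, div_mul_cancel₀ _ P.c_neg.ne]
    exact P.bq_lt_one

theorem abq_div_c_lt_one : a * b * q / c < 1 :=
  (div_neg_of_pos_of_neg (mul_pos (mul_pos P.a_pos P.b_pos) P.q_mem.1) P.c_neg).trans one_pos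

theorem abq_pow_lt_one (n : ℕ) : a * b * q ^ (n + 2) < 1 := by
  have h_aq := mul_pos P.a_pos P.q_mem.1
  have h_abqq : a * b * q ^ 2 < 1 := by nlinarith [P.aq_lt_one, P.bq_lt_one]
  have h_pos := mul_pos (mul_pos P.a_pos P.b_pos) (pow_pos P.q_mem.1 2)
  have h_pow : q ^ n ≤ 1 := pow_le_one₀ P.q_mem.1.le P.q_mem.2.le
  rw [pow_add]
  nlinarith

theorem weightFactor_pos (m : ℕ) : 0 < weightFactor m a b q := by
  rcases m with _ | j
  · exact one_pos
  · refine mul_pos ?_ (qPoch_pos P.q_mem (P.abq_pow_lt_one 0) _)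
    rw [show 2 * (j + 1) + 1 = 2 * j + 1 + 2 by ring]
    exact sub_pos.2 (P.abq_pow_lt_one _)

theorem degree_bigQJacobiPoly (m : ℕ) : (bigQJacobiPoly a b c q m).degree = m := by
  refine degree_eq_of_le_of_coeff_ne_zero (degree_bigQJacobiPoly_le a b c q m) ?_
  rw [coeff_bigQJacobiPoly P.q_ne_zero (qPoch_ne_zero P.q_mem P.q_mem.2 m)]
  have h_num : qPoch (a * b * q ^ (m + 1)) q m ≠ 0 := by
    rcases m with _ | m
    · simp [qPoch_zero]
    · exact qPoch_ne_zero P.q_mem (P.abq_pow_lt_one m) _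
  exact div_ne_zero h_num (mul_ne_zero (qPoch_ne_zero P.q_mem P.aq_lt_one m)
    (qPoch_ne_zero P.q_mem (P.cq_neg.trans one_pos) m))

theorem summable_eval (f : ℝ[X]) : Summable fun i => |jacksonNode a c q i| *
    (qBetaWeight a c 1 (b / c) q (jacksonNode a c q i) * f.eval (jacksonNode a c q i)) := by
  obtain ⟨B, hB⟩ := isCompact_Icc.exists_bound_of_continuousOn f.continuous.continuousOn
  exact P.isQBetaParam.summable_node_mul_weight_mul hB

/-- Integration of polynomials against the orthogonality measure of the big `q`-Jacobi
polynomials. -/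
def integral : ℝ[X] →ₗ[ℝ] ℝ where
  toFun f := jacksonInt a c q fun x => qBetaWeight a c 1 (b / c) q x * f.eval x
  map_add' f g := by
    rw [jacksonInt, jacksonInt, jacksonInt, ← (P.summable_eval f).tsum_add (P.summable_eval g)]
    exact tsum_congr fun i => by rw [eval_add]; ring
  map_smul' r f := by
    rw [jacksonInt, jacksonInt, smul_eq_mul, RingHom.id_apply, ← tsum_mul_left]
    exact tsum_congr fun i => by rw [eval_smul, smul_eq_mul]; ring

theorem qBetaInt_mul_pow_mul_pow (k l : ℕ) :
    qBetaInt a c (1 * q ^ k) (b / c * q ^ l) q *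
        (qPoch (a * b * q ^ 2) q l * qPoch (a * b * q ^ (l + 2)) q k) =
      qPoch (a * q) q k * qPoch (c * q) q k * (qPoch (a * b * q / c) q l * qPoch (b * q) q l) *
        qBetaInt a c 1 (b / c) q := by
  have hc := P.c_neg.ne
  have h_eval := P.isQBetaParam.qBetaInt_mul_pow k l
  rwa [show a * c * 1 * (b / c) * q ^ 2 = a * b * q ^ 2 by field_simp, mul_one, mul_one,
    show a * (b / c) * q = a * b * q / c by ring, show c * (b / c) * q = b * q by field_simp,
    add_comm k l, qPoch_add, show a * b * q ^ 2 * q ^ l = a * b * q ^ (l + 2) by ring] at h_eval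

theorem qBetaInt_eq_div :
    qBetaInt a c 1 (b / c) q = a * q * (qPochInf q q * qPochInf (a * b * q ^ 2) q *
      qTheta (c / a) q) / (qPochInf (a * q) q * qPochInf (b * q) q * qPochInf (c * q) q *
        qPochInf (a * b * q / c) q) := by
  have hc := P.c_neg.ne
  have h_eval := P.isQBetaParam.qBetaInt_eq
  rw [show a * c * 1 * (b / c) * q ^ 2 = a * b * q ^ 2 by field_simp, mul_one, mul_one,
    show a * (b / c) * q = a * b * q / c by ring, show c * (b / c) * q = b * q by field_simp]
    at h_eval
  have h_aq := (qPochInf_pos P.q_mem P.aq_lt_one).ne'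
  have h_bq := (qPochInf_pos P.q_mem P.bq_lt_one).ne'
  have h_cq := (qPochInf_pos P.q_mem (P.cq_neg.trans one_pos)).ne'
  have h_abc := (qPochInf_pos P.q_mem P.abq_div_c_lt_one).ne'
  rw [eq_div_iff (by positivity)]
  linear_combination h_eval

theorem integral_qPochPoly_mul (k l : ℕ) :
    P.integral (qPochPoly 1 q k * qPochPoly (b / c) q l) =
      qBetaInt a c (1 * q ^ k) (b / c * q ^ l) q := by
  refine tsum_congr fun i => ?_
  have h_node := P.isQBetaParam.node_mem i
  simp only [eval_mul, eval_qPochPoly]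
  rw [qBetaWeight_mul_pow P.isQBetaParam.abs_q_lt_one
    (qPoch_ne_zero P.q_mem (P.isQBetaParam.d_mul_lt_one _ h_node) k)
    (qPoch_ne_zero P.q_mem (P.isQBetaParam.e_mul_lt_one _ h_node) l)]

theorem integral_mul_qPochPoly (m l : ℕ) :
    P.integral (bigQJacobiPoly a b c q m * qPochPoly (b / c) q l) =
      qPoch (a * b * q / c) q l * qPoch (b * q) q l * qBetaInt a c 1 (b / c) q /
        qPoch (a * b * q ^ 2) q l * ((∏ i ∈ Finset.range m,
          (a * b * q ^ (m + 1) - a * b * q ^ (l + 2) * q ^ i)) /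
            qPoch (a * b * q ^ (l + 2)) q m) := by
  have h_abq := qPoch_ne_zero P.q_mem (P.abq_pow_lt_one 0) l
  rw [← qChuVandermonde P.q_ne_zero (qPoch_ne_zero P.q_mem P.q_mem.2) m.lt_succ_self _
    (qPoch_ne_zero P.q_mem (P.abq_pow_lt_one l)), bigQJacobiPoly, Finset.sum_mul, map_sum,
    Finset.mul_sum]
  refine Finset.sum_congr rfl fun k _ => ?_
  have h_abql := qPoch_ne_zero P.q_mem (P.abq_pow_lt_one l) k
  have h_aq := qPoch_ne_zero P.q_mem P.aq_lt_one k
  have h_cq := qPoch_ne_zero P.q_mem (P.cq_neg.trans one_pos) k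
  have h_q := qPoch_ne_zero P.q_mem P.q_mem.2 k
  rw [mul_assoc, ← smul_eq_C_mul, map_smul, P.integral_qPochPoly_mul, smul_eq_mul,
    eq_div_of_mul_eq (mul_ne_zero h_abq h_abql) (P.qBetaInt_mul_pow_mul_pow k l), bigQJacobiCoeff]
  generalize qPoch (a * b * q ^ 2) q l = X₁ at *
  generalize qPoch (a * b * q ^ (l + 2)) q k = X₂ at *
  generalize qPoch (a * q) q k = X₃ at *
  generalize qPoch (c * q) q k = X₄ at *
  generalize qPoch q q k = X₅ at *
  field_simp

theorem integral_mul_qPochPoly_of_lt {m l : ℕ} (h : l < m) :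
    P.integral (bigQJacobiPoly a b c q m * qPochPoly (b / c) q l) = 0 := by
  rw [P.integral_mul_qPochPoly, Finset.prod_eq_zero (i := m - 1 - l), zero_div, mul_zero]
  · exact Finset.mem_range.2 (by omega)
  · rw [mul_assoc (a * b), ← pow_add, show l + 2 + (m - 1 - l) = m + 1 by omega, sub_self]

theorem integral_mul_qPochPoly_self (m : ℕ) :
    P.integral (bigQJacobiPoly a b c q m * qPochPoly (b / c) q m) =
      qPoch (a * b * q / c) q m * qPoch (b * q) q m * qBetaInt a c 1 (b / c) q /
        qPoch (a * b * q ^ 2) q m * ((a * b * q ^ (m + 1)) ^ m * qPoch q q m /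
          qPoch (a * b * q ^ (m + 2)) q m) := by
  rw [P.integral_mul_qPochPoly]
  congr 3
  have h_const := Finset.prod_const (s := Finset.range m) (a * b * q ^ (m + 1))
  rw [Finset.card_range] at h_const
  rw [qPoch, ← h_const, ← Finset.prod_mul_distrib]
  exact Finset.prod_congr rfl fun i _ => by ring

theorem integral_mul_mul_eq {m : ℕ} {f : ℝ[X]} (hf : f.degree ≤ m) :
    P.integral (bigQJacobiPoly a b c q m * f) * ((-(b / c)) ^ m * q ^ (m.choose 2)) =
      f.coeff m * P.integral (bigQJacobiPoly a b c q m * qPochPoly (b / c) q m) := by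
  rw [← coeff_qPochPoly]
  exact linearMap_mul_coeff_of_degree (p := qPochPoly (b / c) q)
    (degree_qPochPoly (div_ne_zero P.b_pos.ne' P.c_neg.ne) P.q_ne_zero)
    (P.integral ∘ₗ LinearMap.mulLeft ℝ (bigQJacobiPoly a b c q m))
    (fun l hl => P.integral_mul_qPochPoly_of_lt hl) hf

theorem neg_div_pow_mul_ne_zero (m : ℕ) : (-(b / c)) ^ m * q ^ (m.choose 2) ≠ 0 :=
  mul_ne_zero (pow_ne_zero _ (neg_ne_zero.2 (div_ne_zero P.b_pos.ne' P.c_neg.ne)))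
    (pow_ne_zero _ P.q_ne_zero)

theorem integral_mul_of_lt {m n : ℕ} (h : n < m) :
    P.integral (bigQJacobiPoly a b c q m * bigQJacobiPoly a b c q n) = 0 := by
  have h_lt : (bigQJacobiPoly a b c q n).degree < m :=
    (degree_bigQJacobiPoly_le a b c q n).trans_lt (Nat.cast_lt.2 h)
  have h_eq := P.integral_mul_mul_eq h_lt.le
  rw [coeff_eq_zero_of_degree_lt h_lt, zero_mul] at h_eq
  exact (mul_eq_zero.1 h_eq).resolve_right (P.neg_div_pow_mul_ne_zero m)

theorem integral_mul_self_mul_weightFactor (m : ℕ) :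
    P.integral (bigQJacobiPoly a b c q m * bigQJacobiPoly a b c q m) * weightFactor m a b q =
      (-(a * c * q ^ 2)) ^ m * q ^ (m.choose 2) * qBetaInt a c 1 (b / c) q *
        (qPoch q q m * qPoch (b * q) q m * qPoch (a * b * q / c) q m) /
          (qPoch (a * q) q m * qPoch (c * q) q m) := by
  have h_q := qPoch_ne_zero P.q_mem P.q_mem.2 m
  have h_abq : qPoch (a * b * q ^ 2) q m ≠ 0 := qPoch_ne_zero P.q_mem (P.abq_pow_lt_one 0) m
  have h_abqm := qPoch_ne_zero P.q_mem (P.abq_pow_lt_one m) m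
  have h_eq := P.integral_mul_mul_eq (degree_bigQJacobiPoly_le a b c q m)
  rw [P.integral_mul_qPochPoly_self, coeff_bigQJacobiPoly P.q_ne_zero h_q,
    mul_pow_succ_pow P.c_neg.ne] at h_eq
  refine mul_right_cancel₀ (P.neg_div_pow_mul_ne_zero m) ?_
  rw [mul_right_comm, h_eq, div_mul_eq_mul_div, div_mul_eq_mul_div, mul_right_comm,
    weightFactor_mul]
  generalize qPoch (a * b * q ^ 2) q m = X₁ at *
  generalize qPoch (a * b * q ^ (m + 2)) q m = X₂ at *
  generalize qPoch (a * q) q m * qPoch (c * q) q m = X₃ at *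
  rw [div_mul_eq_mul_div]
  field_simp

theorem weightV_eq (m : ℕ) : weightV m a b c q = weightFactor m a b q / qBetaInt a c 1 (b / c) q *
    (qPoch (a * q) q m * qPoch (c * q) q m /
      (qPoch q q m * qPoch (b * q) q m * qPoch (a * b * q / c) q m)) *
    ((-(a * c * q ^ 2)) ^ m)⁻¹ * (q ^ (m.choose 2))⁻¹ := by
  rw [weightV, P.qBetaInt_eq_div, div_div_eq_mul_div, div_mul_div_comm, mul_comm (a * q)]

theorem weightV_mul_integral (m : ℕ) :
    weightV m a b c q * P.integral (bigQJacobiPoly a b c q m * bigQJacobiPoly a b c q m) = 1 := by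
  have h_factor := (P.weightFactor_pos m).ne'
  have h_int := P.isQBetaParam.qBetaInt_pos.ne'
  have h_pow : (-(a * c * q ^ 2)) ^ m ≠ 0 := pow_ne_zero _
    (neg_ne_zero.2 (mul_ne_zero (mul_ne_zero P.a_pos.ne' P.c_neg.ne) (pow_ne_zero _ P.q_ne_zero)))
  have h_choose : q ^ m.choose 2 ≠ 0 := pow_ne_zero _ P.q_ne_zero
  have h_q := qPoch_ne_zero P.q_mem P.q_mem.2 m
  have h_aq := qPoch_ne_zero P.q_mem P.aq_lt_one m
  have h_bq := qPoch_ne_zero P.q_mem P.bq_lt_one m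
  have h_cq := qPoch_ne_zero P.q_mem (P.cq_neg.trans one_pos) m
  have h_abc := qPoch_ne_zero P.q_mem P.abq_div_c_lt_one m
  rw [P.weightV_eq, eq_div_of_mul_eq h_factor (P.integral_mul_self_mul_weightFactor m)]
  generalize qPoch (a * b * q / c) q m = X₁ at *
  generalize qPoch (a * q) q m = X₂ at *
  generalize qPoch (b * q) q m = X₃ at *
  generalize qPoch (c * q) q m = X₄ at *
  generalize qPoch q q m = X₅ at *
  generalize (-(a * c * q ^ 2)) ^ m = X₆ at *
  field_simp

end IsBigQJacobiParam

end BigQJacobi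

/-! ### Completeness of the big q-Jacobi polynomials -/

section Completeness

open Filter Topology Polynomial

-- If `x i` is the node to be isolated and `B` bounds all distances between nodes, the polynomial
-- `1 - (X - x i)² / B²` is `1` at `x i` and lies in `[0, 1)` at the other nodes, so its powers
-- converge to the indicator of `x i`.
theorem exists_eval_eq_one {ι : Type*} {x : ι → ℝ} (hx : Function.Injective x)
    (h_bdd : Bornology.IsBounded (Set.range x)) (i : ι) :
    ∃ p : ℝ[X], p.eval (x i) = 1 ∧ ∀ j ≠ i, p.eval (x j) ∈ Set.Ico 0 1 := by
  obtain ⟨B, hB, h_dist⟩ : ∃ B, 0 < B ∧ ∀ j, dist (x j) (x i) ≤ B := by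
    obtain ⟨B, hB⟩ := Metric.isBounded_iff.1 h_bdd
    exact ⟨max B 1, by positivity, fun j =>
      (hB (Set.mem_range_self j) (Set.mem_range_self i)).trans (le_max_left _ _)⟩
  refine ⟨1 - C (B ^ 2)⁻¹ * (X - C (x i)) ^ 2, by simp, fun j hj => ?_⟩
  have h_ne := sub_ne_zero.2 (hx.ne hj)
  have h_sq : (B ^ 2)⁻¹ * (x j - x i) ^ 2 ≤ 1 := by
    rw [inv_mul_le_one₀ (by positivity)]
    exact sq_le_sq' (neg_le_of_abs_le (h_dist j)) (le_of_abs_le (h_dist j))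
  simp only [eval_sub, eval_one, eval_mul, eval_C, eval_pow, eval_X]
  exact ⟨sub_nonneg.2 h_sq, sub_lt_self _ (by positivity)⟩

theorem eq_zero_of_tsum_eval_mul_eq_zero {ι : Type*} {x : ι → ℝ} (hx : Function.Injective x)
    (h_bdd : Bornology.IsBounded (Set.range x)) {g : ι → ℂ} (hg : Summable fun i => ‖g i‖)
    (h_moment : ∀ p : ℝ[X], ∑' i, ((p.eval (x i) : ℝ) : ℂ) * g i = 0) (i : ι) : g i = 0 := by
  classical
  obtain ⟨p, h_one, h_mem⟩ := exists_eval_eq_one hx h_bdd i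
  have h_Icc (j) : p.eval (x j) ∈ Set.Icc (0 : ℝ) 1 := by
    rcases eq_or_ne j i with rfl | hj
    · simp [h_one]
    · exact Set.Ico_subset_Icc_self (h_mem j hj)
  have h_lim := tendsto_tsum_of_dominated_convergence (𝓕 := atTop)
    (f := fun (n : ℕ) j => (((p ^ n).eval (x j) : ℝ) : ℂ) * g j)
    (g := fun j => if j = i then g i else 0) hg (fun j => ?_)
    (Eventually.of_forall fun n j => ?_)
  · simp only [h_moment, tsum_ite_eq] at h_lim
    exact tendsto_nhds_unique h_lim tendsto_const_nhds
  · simp only [eval_pow, Complex.ofReal_pow]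
    split_ifs with hj
    · simp [hj, h_one]
    · have h_pow := tendsto_pow_atTop_nhds_zero_of_lt_one (h_mem j hj).1 (h_mem j hj).2
      simpa using ((Complex.continuous_ofReal.tendsto 0).comp h_pow).mul_const (g j)
  · rw [norm_mul, Complex.norm_real, eval_pow, norm_pow, Real.norm_eq_abs,
      abs_of_nonneg (h_Icc j).1]
    exact mul_le_of_le_one_left (norm_nonneg _) (pow_le_one₀ (h_Icc j).1 (h_Icc j).2)

theorem weightU_eq_qBetaWeight (x a b c q : ℝ) :
    weightU x a b c q = qBetaWeight a c 1 (b / c) q x := by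
  rw [weightU, qBetaWeight, one_mul, div_mul_eq_mul_div]

namespace IsBigQJacobiParam

variable {a b c q : ℝ} (P : IsBigQJacobiParam a b c q)
include P

theorem node_mul_weightU_pos (i : ℕ ⊕ ℕ) :
    0 < |jacksonNode a c q i| * weightU (jacksonNode a c q i) a b c q := by
  rw [weightU_eq_qBetaWeight]
  exact P.isQBetaParam.node_mul_weight_pos i

theorem weightV_pos (m : ℕ) : 0 < weightV m a b c q := by
  have h_nonneg : 0 ≤ P.integral (bigQJacobiPoly a b c q m * bigQJacobiPoly a b c q m) :=
    tsum_nonneg fun i => mul_nonneg (abs_nonneg _) <|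
      mul_nonneg (P.isQBetaParam.weight_pos (P.isQBetaParam.node_mem i)).le <| by
        rw [eval_mul]
        exact mul_self_nonneg _
  refine pos_of_mul_pos_left ?_ h_nonneg
  rw [P.weightV_mul_integral]
  exact one_pos

theorem normBigQJacobi_node (i : ℕ ⊕ ℕ) (m : ℕ) :
    normBigQJacobi (jacksonNode a c q i) m a b c q =
      √(weightV m a b c q) * ((bigQJacobiPoly a b c q m).eval (jacksonNode a c q i) *
        √(|jacksonNode a c q i| * weightU (jacksonNode a c q i) a b c q)) := by
  rw [normBigQJacobi, Real.sqrt_mul (P.node_mul_weightU_pos i).le, eval_bigQJacobiPoly P.q_ne_zero]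
  ring

theorem sqrt_weightV_mul_integral (m n : ℕ) :
    √(weightV m a b c q) * √(weightV n a b c q) *
      P.integral (bigQJacobiPoly a b c q m * bigQJacobiPoly a b c q n) =
        if m = n then 1 else 0 := by
  rcases lt_trichotomy m n with hmn | rfl | hmn
  · rw [mul_comm (bigQJacobiPoly _ _ _ _ _), P.integral_mul_of_lt hmn, mul_zero, if_neg hmn.ne]
  · rw [Real.mul_self_sqrt (P.weightV_pos m).le, P.weightV_mul_integral, if_pos rfl]
  · rw [P.integral_mul_of_lt hmn, mul_zero, if_neg hmn.ne']

theorem hasSum_normBigQJacobi_mul (m n : ℕ) :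
    HasSum (fun i => normBigQJacobi (jacksonNode a c q i) m a b c q *
      normBigQJacobi (jacksonNode a c q i) n a b c q) (if m = n then 1 else 0) := by
  have h_sum := (P.summable_eval (bigQJacobiPoly a b c q m * bigQJacobiPoly a b c q n)).hasSum
  rw [← P.sqrt_weightV_mul_integral m n]
  refine (h_sum.mul_left (√(weightV m a b c q) * √(weightV n a b c q))).congr_fun fun i => ?_
  have h_sqrt := Real.mul_self_sqrt (P.node_mul_weightU_pos i).le
  rw [P.normBigQJacobi_node, P.normBigQJacobi_node, eval_mul, ← weightU_eq_qBetaWeight]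
  linear_combination (√(weightV m a b c q) * √(weightV n a b c q) *
    (bigQJacobiPoly a b c q m).eval (jacksonNode a c q i) *
      (bigQJacobiPoly a b c q n).eval (jacksonNode a c q i)) * h_sqrt

theorem summable_sqrt_mul {g : ℕ ⊕ ℕ → ℂ} (hg : Summable fun i => ‖g i‖ ^ 2) :
    Summable fun i =>
      ‖(√(|jacksonNode a c q i| * weightU (jacksonNode a c q i) a b c q) : ℂ) * g i‖ := by
  have h_mass : Summable fun i =>
      |jacksonNode a c q i| * weightU (jacksonNode a c q i) a b c q := by
    simpa only [weightU_eq_qBetaWeight] using P.isQBetaParam.summable_node_mul_weight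
  refine (h_mass.add hg).of_nonneg_of_le (fun i => norm_nonneg _) fun i => ?_
  have h_sq := Real.sq_sqrt (P.node_mul_weightU_pos i).le
  rw [norm_mul, Complex.norm_real, Real.norm_eq_abs, abs_of_nonneg (Real.sqrt_nonneg _)]
  nlinarith [sq_nonneg (√(|jacksonNode a c q i| * weightU (jacksonNode a c q i) a b c q) - ‖g i‖),
    Real.sqrt_nonneg (|jacksonNode a c q i| * weightU (jacksonNode a c q i) a b c q),
    norm_nonneg (g i)]

theorem summable_eval_mul {g : ℕ ⊕ ℕ → ℂ} (hg : Summable fun i => ‖g i‖) (p : ℝ[X]) :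
    Summable fun i => ((p.eval (jacksonNode a c q i) : ℝ) : ℂ) * g i := by
  obtain ⟨B, hB⟩ := isCompact_Icc.exists_bound_of_continuousOn (s := Set.Icc (c * q) (a * q))
    p.continuous.continuousOn
  refine (hg.mul_left B).of_norm_bounded fun i => ?_
  rw [norm_mul, Complex.norm_real]
  exact mul_le_mul_of_nonneg_right (hB _ (P.isQBetaParam.node_mem i)) (norm_nonneg _)

theorem eq_zero_of_tsum_bigQJacobiPoly_mul_eq_zero {g : ℕ ⊕ ℕ → ℂ}
    (hg : Summable fun i => ‖g i‖) (h_orth : ∀ m, ∑' i,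
      (((bigQJacobiPoly a b c q m).eval (jacksonNode a c q i) : ℝ) : ℂ) * g i = 0)
    (i : ℕ ⊕ ℕ) : g i = 0 := by
  let L : ℝ[X] →ₗ[ℝ] ℂ :=
    { toFun := fun p => ∑' i, ((p.eval (jacksonNode a c q i) : ℝ) : ℂ) * g i
      map_add' := fun p r => by
        rw [← (P.summable_eval_mul hg p).tsum_add (P.summable_eval_mul hg r)]
        exact tsum_congr fun i => by rw [eval_add]; push_cast; ring
      map_smul' := fun r p => by
        rw [RingHom.id_apply, Complex.real_smul, ← tsum_mul_left]
        exact tsum_congr fun i => by rw [eval_smul, smul_eq_mul]; push_cast; ring }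
  refine eq_zero_of_tsum_eval_mul_eq_zero
    (jacksonNode_injective P.q_mem P.a_pos P.c_neg)
    ((Metric.isBounded_Icc (c * q) (a * q)).subset
      (Set.range_subset_iff.2 P.isQBetaParam.node_mem)) hg (fun p => ?_) i
  exact linearMap_eq_zero_of_degree P.degree_bigQJacobiPoly L (fun m _ => h_orth m)
    degree_le_natDegree

theorem eq_zero_of_tsum_normBigQJacobi_mul_eq_zero {g : ℕ ⊕ ℕ → ℂ}
    (hg : Summable fun i => ‖g i‖ ^ 2)
    (h_orth : ∀ m, ∑' i, (normBigQJacobi (jacksonNode a c q i) m a b c q : ℂ) * g i = 0)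
    (i : ℕ ⊕ ℕ) : g i = 0 := by
  have h_zero := P.eq_zero_of_tsum_bigQJacobiPoly_mul_eq_zero (P.summable_sqrt_mul hg)
    (fun m => ?_) i
  · exact (mul_eq_zero.1 h_zero).resolve_left
      (Complex.ofReal_ne_zero.2 (Real.sqrt_pos.2 (P.node_mul_weightU_pos i)).ne')
  · have h_sqrt : (√(weightV m a b c q) : ℂ) ≠ 0 :=
      Complex.ofReal_ne_zero.2 (Real.sqrt_pos.2 (P.weightV_pos m)).ne'
    refine (mul_eq_zero.1 ((tsum_mul_left.symm.trans (tsum_congr fun i => ?_)).trans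
      (h_orth m))).resolve_left h_sqrt
    rw [P.normBigQJacobi_node]
    push_cast
    ring

end IsBigQJacobiParam

end Completeness

/-! ### Contiguous relations -/

section Contiguous

variable {a b c q : ℝ}

theorem mul_one_sub_mul_pow_qPoch (c q : ℝ) (k : ℕ) :
    qPoch c q k * (1 - c * q ^ k) = (1 - c) * qPoch (c * q) q k := by
  rw [← qPoch_succ, qPoch_succ']

theorem qPoch_sub_qPoch_div (ha : a ≠ 0) (hq : q ≠ 0) (hc : c ≠ 0) (b x : ℝ) (k : ℕ) :
    (1 - b * x / c) * qPoch x q (k + 1) - (1 - x / (a * q)) * qPoch (x / q) q (k + 1) =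
      x * ((1 - q ^ (k + 1)) / q * (1 - (q ^ (k + 1))⁻¹ / a) * qPoch x q k +
        ((q ^ (k + 2))⁻¹ / a - b / c) * qPoch x q (k + 1)) := by
  have hk := pow_ne_zero k hq
  rw [qPoch_succ' (x / q), div_mul_cancel₀ _ hq, qPoch_succ, pow_succ q k,
    show q ^ (k + 2) = q ^ k * q * q by ring]
  generalize qPoch x q k = X
  generalize q ^ k = t at *
  field_simp
  ring

theorem sum_mul_qPoch_sub_sum_mul_qPoch_div (ha : a ≠ 0) (hq : q ≠ 0) (hc : c ≠ 0) (b x : ℝ)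
    (A : ℕ → ℝ) (M : ℕ) :
    (1 - b * x / c) * ∑ k ∈ Finset.range (M + 1), A k * qPoch x q k -
        (1 - x / (a * q)) * ∑ k ∈ Finset.range (M + 1), A k * qPoch (x / q) q k +
        x * (A (M + 1) * ((1 - q ^ (M + 1)) / q * (1 - (q ^ (M + 1))⁻¹ / a)) * qPoch x q M) =
      x * ∑ k ∈ Finset.range (M + 1),
        (A (k + 1) * ((1 - q ^ (k + 1)) / q * (1 - (q ^ (k + 1))⁻¹ / a)) +
          A k * ((q ^ (k + 1))⁻¹ / a - b / c)) * qPoch x q k := by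
  induction M with
  | zero =>
    simp only [zero_add, Finset.sum_range_one, qPoch_zero, pow_one]
    field_simp
    ring
  | succ M ih =>
    rw [Finset.sum_range_succ _ (M + 1), Finset.sum_range_succ _ (M + 1),
      Finset.sum_range_succ (fun k => (A (k + 1) * _ + _) * _) (M + 1)]
    linear_combination ih + A (M + 1) * qPoch_sub_qPoch_div ha hq hc b x M

namespace IsBigQJacobiParam

variable (P : IsBigQJacobiParam a b c q)
include P

theorem div_q : IsBigQJacobiParam a b (c / q) q where
  __ := P
  c_neg := div_neg_of_neg_of_pos P.c_neg P.q_mem.1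

theorem bigQJacobiCoeff_div_mul (m k : ℕ) :
    bigQJacobiCoeff a b (c / q) q m k * (1 - c) =
      bigQJacobiCoeff a b c q m k * (1 - c * q ^ k) := by
  have h_poch := mul_one_sub_mul_pow_qPoch c q k
  have h_c := qPoch_ne_zero P.q_mem (P.c_neg.trans one_pos) k
  have h_cq := qPoch_ne_zero P.q_mem (P.cq_neg.trans one_pos) k
  have h_div : (1 - c) / qPoch c q k = (1 - c * q ^ k) / qPoch (c * q) q k := by
    rw [div_eq_div_iff h_c h_cq]
    linarith
  rw [bigQJacobiCoeff, bigQJacobiCoeff, div_mul_cancel₀ _ P.q_ne_zero]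
  linear_combination (qPoch (q ^ m)⁻¹ q k * qPoch (a * b * q ^ (m + 1)) q k /
    (qPoch q q k * qPoch (a * q) q k) * q ^ k) * h_div

theorem bigQJacobiCoeff_succ_mul (m k : ℕ) :
    bigQJacobiCoeff a b c q m (k + 1) *
        ((1 - q ^ (k + 1)) * (1 - a * q ^ (k + 1)) * (1 - c * q ^ (k + 1))) =
      bigQJacobiCoeff a b c q m k *
        (q * (1 - (q ^ m)⁻¹ * q ^ k) * (1 - a * b * q ^ (m + 1) * q ^ k)) := by
  have h_q := (one_sub_mul_pow_pos P.q_mem P.q_mem.2 k).ne'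
  have h_aq := (one_sub_mul_pow_pos P.q_mem P.aq_lt_one k).ne'
  have h_cq := (one_sub_mul_pow_pos P.q_mem (P.cq_neg.trans one_pos) k).ne'
  simp only [bigQJacobiCoeff, qPoch_succ]
  rw [show q ^ (k + 1) = q * q ^ k from pow_succ' q k, ← mul_assoc a, ← mul_assoc c]
  generalize 1 - q * q ^ k = u at *
  generalize 1 - a * q * q ^ k = v at *
  generalize 1 - c * q * q ^ k = w at *
  generalize 1 - (q ^ m)⁻¹ * q ^ k = r
  generalize 1 - a * b * q ^ (m + 1) * q ^ k = s
  generalize qPoch (q ^ m)⁻¹ q k = X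
  generalize qPoch (a * b * q ^ (m + 1)) q k = Y
  field_simp

theorem bigQJacobi_sub_mul_q (m : ℕ) (x : ℝ) :
    (1 - x / c) * bigQJacobi m x a b c q - (1 - x) * bigQJacobi m (q * x) a b c q =
      x * (1 - 1 / c) * bigQJacobi m x a b (c / q) q := by
  have h0 := P.q_ne_zero
  have hc := P.c_neg.ne
  simp only [bigQJacobi_eq_sum h0 _ _ _ _ m.lt_succ_self, Finset.mul_sum,
    ← Finset.sum_sub_distrib]
  refine Finset.sum_congr rfl fun k _ => ?_
  have h_poch := mul_one_sub_mul_pow_qPoch x q k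
  have h_coeff := P.bigQJacobiCoeff_div_mul m k
  have h_inv : c * (1 / c) = 1 := mul_one_div_cancel hc
  rw [mul_comm q x, div_eq_mul_one_div x]
  linear_combination bigQJacobiCoeff a b c q m k * h_poch +
    (x * (1 / c) * qPoch x q k) * h_coeff +
    (x * qPoch x q k * (bigQJacobiCoeff a b (c / q) q m k -
      bigQJacobiCoeff a b c q m k * q ^ k)) * h_inv

theorem bigQJacobiCoeff_div_succ_add (m k : ℕ) :
    a * q * (c - 1) * (bigQJacobiCoeff a b (c / q) q m (k + 1) *
      ((1 - q ^ (k + 1)) / q * (1 - (q ^ (k + 1))⁻¹ / a)) +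
      bigQJacobiCoeff a b (c / q) q m k * ((q ^ (k + 1))⁻¹ / a - b / c)) =
      c * ((1 - a * b * q ^ (m + 1) / c) * (1 - (q ^ m)⁻¹ / c)) *
        bigQJacobiCoeff a b c q m k := by
  have h0 := P.q_ne_zero
  have ha := P.a_pos.ne'
  have hc := P.c_neg.ne
  have h_c : 1 - c * q ^ k ≠ 0 :=
    (one_sub_mul_pow_pos P.q_mem (P.c_neg.trans one_pos) k).ne'
  have h_succ := P.div_q.bigQJacobiCoeff_succ_mul m k
  have h_div := P.bigQJacobiCoeff_div_mul m k
  rw [show c / q * q ^ (k + 1) = c * q ^ k by rw [pow_succ]; field_simp] at h_succ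
  have hk := pow_ne_zero k h0
  have hm := pow_ne_zero m h0
  have h_A' : bigQJacobiCoeff a b (c / q) q m (k + 1) *
      ((1 - q ^ (k + 1)) / q * (1 - (q ^ (k + 1))⁻¹ / a)) * (1 - c * q ^ k) =
      -(bigQJacobiCoeff a b (c / q) q m k * ((1 - (q ^ m)⁻¹ * q ^ k) *
        (1 - a * b * q ^ (m + 1) * q ^ k)) / (a * q ^ (k + 1))) := by
    linear_combination (norm := (field_simp; ring)) (-1 / (a * q ^ (k + 1) * q)) * h_succ
  refine mul_right_cancel₀ h_c ?_
  rw [mul_assoc _ (bigQJacobiCoeff a b c q m k), ← h_div, mul_assoc, add_mul, h_A', pow_succ q k,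
    pow_succ q m]
  generalize q ^ k = t at *
  generalize q ^ m = s at *
  field_simp
  ring

theorem bigQJacobi_sub_div_q (m : ℕ) (x : ℝ) :
    a * q * (c - 1) * ((1 - b * x / c) * bigQJacobi m x a b (c / q) q -
      (1 - x / (a * q)) * bigQJacobi m (x / q) a b (c / q) q) =
      c * x * ((1 - a * b * q ^ (m + 1) / c) * (1 - (q ^ m)⁻¹ / c)) *
        bigQJacobi m x a b c q := by
  have h0 := P.q_ne_zero
  have hc := P.c_neg.ne
  have h_zero : bigQJacobiCoeff a b (c / q) q m (m + 1) = 0 := by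
    rw [bigQJacobiCoeff, qPoch_inv_pow_eq_zero h0 m.lt_succ_self]
    simp
  have h_sum := sum_mul_qPoch_sub_sum_mul_qPoch_div P.a_pos.ne' h0 hc b x
    (bigQJacobiCoeff a b (c / q) q m) m
  rw [h_zero, zero_mul, zero_mul, mul_zero, add_zero] at h_sum
  simp only [bigQJacobi_eq_sum h0 _ _ _ _ m.lt_succ_self]
  rw [h_sum, Finset.mul_sum, Finset.mul_sum, Finset.mul_sum]
  refine Finset.sum_congr rfl fun k _ => ?_
  linear_combination (x * qPoch x q k) * P.bigQJacobiCoeff_div_succ_add m k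

end IsBigQJacobiParam

end Contiguous

section NormalizedContiguous

variable {a b c q : ℝ}

theorem qTheta_div (h0 : q ≠ 0) (hq : |q| < 1) {x : ℝ} (hx : x ≠ 0) :
    qTheta (x / q) q = -(x / q) * qTheta x q := by
  rw [qTheta, qTheta, qPochInf_eq_one_sub_mul hq (x / q), qPochInf_eq_one_sub_mul hq (q / x),
    div_mul_cancel₀ _ h0, show q / (x / q) = q / x * q by field_simp]
  field_simp
  ring

theorem sqrt_mul_mul_sqrt_eq {A B u v : ℝ} (hA : 0 ≤ A) (hB : 0 ≤ B) (h : u * B = v * A) :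
    √(A * B) * √u = A * √v := by
  rw [← Real.sqrt_mul (mul_nonneg hA hB), show A * B * u = A ^ 2 * v by linear_combination A * h,
    Real.sqrt_mul (sq_nonneg _), Real.sqrt_sq hA]

namespace IsBigQJacobiParam

variable (P : IsBigQJacobiParam a b c q)
include P

theorem mem_Icc_div {x : ℝ} (hx : x ∈ Set.Icc (c * q) (a * q)) :
    x ∈ Set.Icc (c / q * q) (a * q) := by
  rw [div_mul_cancel₀ _ P.q_ne_zero]
  exact ⟨by nlinarith [hx.1, P.c_neg, P.q_mem.2], hx.2⟩

theorem mul_q_mem_Icc {y : ℝ} (hy : y ∈ Set.Icc (c / q * q) (a * q)) :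
    y * q ∈ Set.Icc (c * q) (a * q) := by
  rw [div_mul_cancel₀ _ P.q_ne_zero] at hy
  have h_aq := mul_pos P.a_pos P.q_mem.1
  exact ⟨mul_le_mul_of_nonneg_right hy.1 P.q_mem.1.le, by nlinarith [hy.2, P.q_mem.1, P.q_mem.2]⟩

theorem one_sub_pos {x : ℝ} (hx : x ∈ Set.Icc (c * q) (a * q)) :
    0 < 1 - x ∧ 0 < 1 - x / a ∧ 0 < 1 - x / c ∧ 0 < 1 - b * x / c := by
  obtain ⟨h_a, h_c⟩ := P.isQBetaParam.div_mem hx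
  have h_one := P.isQBetaParam.d_mul_lt_one x hx
  have h_bc := P.isQBetaParam.e_mul_lt_one x hx
  have h_q := P.q_mem.2
  rw [div_mul_eq_mul_div] at h_bc
  exact ⟨by linarith, by linarith [h_a.2], by linarith [h_c.2], by linarith⟩

theorem weightU_pos {x : ℝ} (hx : x ∈ Set.Icc (c * q) (a * q)) : 0 < weightU x a b c q := by
  rw [weightU_eq_qBetaWeight]
  exact P.isQBetaParam.weight_pos hx

theorem weightU_div {x : ℝ} (hx : x ∈ Set.Icc (c * q) (a * q)) :
    weightU x a b (c / q) q * (1 - x / c) = weightU x a b c q * (1 - b * x / c) := by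
  have h0 := P.q_ne_zero
  have hc := P.c_neg.ne
  have hq := P.isQBetaParam.abs_q_lt_one
  obtain ⟨-, -, -, h_bx⟩ := P.one_sub_pos hx
  rw [weightU, weightU, qPochInf_eq_one_sub_mul hq (x / c),
    qPochInf_eq_one_sub_mul hq (b * x / c), show x / (c / q) = x / c * q by field_simp,
    show b * x / (c / q) = b * x / c * q by field_simp]
  generalize b * x / c = z at *
  generalize x / c = y
  field_simp

theorem weightU_mul_q {y : ℝ} (hy : y ∈ Set.Icc (c / q * q) (a * q)) :
    weightU (y * q) a b c q * (1 - y / a) = weightU y a b (c / q) q * (1 - y) := by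
  have h0 := P.q_ne_zero
  have hc := P.c_neg.ne
  have hq := P.isQBetaParam.abs_q_lt_one
  obtain ⟨h_y, -, -, -⟩ := P.div_q.one_sub_pos hy
  rw [weightU, weightU, qPochInf_eq_one_sub_mul hq y, qPochInf_eq_one_sub_mul hq (y / a),
    show y * q / a = y / a * q by ring, show y / (c / q) = y * q / c by field_simp,
    show b * y / (c / q) = b * (y * q) / c by field_simp]
  generalize b * (y * q) / c = z
  generalize y * q / c = w
  generalize y / a = u
  field_simp

theorem qBetaInt_div_mul :
    qBetaInt a (c / q) 1 (b / (c / q)) q * (1 - c) =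
      -(c / (a * q)) * (1 - a * b * q / c) * qBetaInt a c 1 (b / c) q := by
  have h0 := P.q_ne_zero
  have ha := P.a_pos.ne'
  have hc := P.c_neg.ne
  have hq := P.isQBetaParam.abs_q_lt_one
  have h_c : 1 - c ≠ 0 := by linarith [P.c_neg]
  have h_abc : 1 - a * b * q / c ≠ 0 := (sub_pos.2 P.abq_div_c_lt_one).ne'
  rw [P.qBetaInt_eq_div, P.div_q.qBetaInt_eq_div, div_mul_cancel₀ _ h0,
    div_right_comm c q a, qTheta_div h0 hq (div_ne_zero hc ha), div_div c a q,
    qPochInf_eq_one_sub_mul hq c, qPochInf_eq_one_sub_mul hq (a * b * q / c),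
    show a * b * q / (c / q) = a * b * q / c * q by field_simp]
  generalize qPochInf (a * b * q / c * q) q = X
  generalize 1 - a * b * q / c = u at *
  generalize qPochInf (a * b * q ^ 2) q = Y
  generalize qTheta (c / a) q = T
  generalize qPochInf (a * q) q = A
  generalize qPochInf (b * q) q = B
  generalize qPochInf (c * q) q = C
  generalize qPochInf q q = D
  field_simp

theorem eigenvalue_factors_pos (m : ℕ) :
    0 < 1 - a * b * q ^ (m + 1) / c ∧ 0 < 1 - (q ^ m)⁻¹ / c := by
  have h_pow := pow_pos P.q_mem.1
  have h_ab : a * b * q ^ (m + 1) / c < 0 :=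
    div_neg_of_pos_of_neg (mul_pos (mul_pos P.a_pos P.b_pos) (h_pow _)) P.c_neg
  have h_inv : (q ^ m)⁻¹ / c < 0 := div_neg_of_pos_of_neg (inv_pos.2 (h_pow m)) P.c_neg
  exact ⟨by linarith, by linarith⟩

theorem weightV_div (m : ℕ) :
    weightV m a b (c / q) q * ((1 - a * b * q ^ (m + 1) / c) * (1 - (q ^ m)⁻¹ / c)) =
      ((c - 1) / c) ^ 2 * (a * q) * weightV m a b c q := by
  have h0 := P.q_ne_zero
  have ha := P.a_pos.ne'
  have hc := P.c_neg.ne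
  have hc1 := P.c_neg.trans one_pos
  have h_abc' : a * b * q / (c / q) = a * b * q / c * q := by field_simp
  have h_pow := pow_ne_zero m h0
  have h_c : 1 - c ≠ 0 := (sub_pos.2 hc1).ne'
  have h_c' : 1 - c * q ^ m ≠ 0 := (one_sub_mul_pow_pos P.q_mem hc1 m).ne'
  have h_abc : 1 - a * b * q / c ≠ 0 := (sub_pos.2 P.abq_div_c_lt_one).ne'
  have h_abc'' : 1 - a * b * q / c * q ^ m ≠ 0 :=
    (one_sub_mul_pow_pos P.q_mem P.abq_div_c_lt_one m).ne'
  have h_int := eq_div_of_mul_eq h_c P.qBetaInt_div_mul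
  have h_poch_c := eq_div_of_mul_eq h_c' (mul_one_sub_mul_pow_qPoch c q m)
  have h_poch_abc := eq_div_of_mul_eq h_abc
    ((mul_comm _ _).trans (mul_one_sub_mul_pow_qPoch (a * b * q / c) q m).symm)
  have h_scale : (-(a * c * q ^ 2)) ^ m = (-(a * (c / q) * q ^ 2)) ^ m * q ^ m := by
    rw [← mul_pow]; congr 1; field_simp
  rw [P.weightV_eq, P.div_q.weightV_eq, div_mul_cancel₀ _ h0, h_abc', h_scale, h_int, h_poch_c,
    h_poch_abc, show a * b * q ^ (m + 1) / c = a * b * q / c * q ^ m by ring]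
  generalize qBetaInt a c 1 (b / c) q = I
  generalize qPoch (a * b * q / c) q m = R
  generalize a * b * q / c = r at *
  generalize qPoch (c * q) q m = C
  generalize (-(a * (c / q) * q ^ 2)) ^ m = Z
  generalize q ^ m = t at *
  field_simp
  ring

theorem sqrt_weightV_div (m : ℕ) :
    √((1 - a * b * q ^ (m + 1) / c) * (1 - (q ^ m)⁻¹ / c)) * √(weightV m a b (c / q) q) =
      (c - 1) / c * √(a * q) * √(weightV m a b c q) := by
  obtain ⟨h_ab, h_inv⟩ := P.eigenvalue_factors_pos m
  have h_c : 0 ≤ (c - 1) / c := div_nonneg_of_nonpos (by linarith [P.c_neg]) P.c_neg.le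
  rw [← Real.sqrt_mul (mul_pos h_ab h_inv).le, mul_comm, P.weightV_div,
    Real.sqrt_mul (mul_nonneg (sq_nonneg _) (mul_pos P.a_pos P.q_mem.1).le),
    Real.sqrt_mul (sq_nonneg _), Real.sqrt_sq h_c]

theorem normBigQJacobi_eq_of_mem {x : ℝ} (hx : x ∈ Set.Icc (c * q) (a * q)) (m : ℕ) :
    normBigQJacobi x m a b c q =
      √(|x|) * √(weightU x a b c q) * (√(weightV m a b c q) * bigQJacobi m x a b c q) := by
  rw [normBigQJacobi, Real.sqrt_mul (mul_nonneg (abs_nonneg _) (P.weightU_pos hx).le),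
    Real.sqrt_mul (abs_nonneg _), mul_assoc]

theorem sqrt_weightV_mul_bigQJacobi_sub_div_q (m : ℕ) (x : ℝ) :
    √(weightV m a b (c / q) q) * ((1 - b * x / c) * bigQJacobi m x a b (c / q) q -
      (1 - x / (a * q)) * bigQJacobi m (x / q) a b (c / q) q) =
      x / √(a * q) * √((1 - a * b * q ^ (m + 1) / c) * (1 - (q ^ m)⁻¹ / c)) *
        (√(weightV m a b c q) * bigQJacobi m x a b c q) := by
  have hc := P.c_neg.ne
  have h_aq := mul_pos P.a_pos P.q_mem.1
  have h_factor : a * q * (c - 1) ≠ 0 := mul_ne_zero h_aq.ne' (by linarith [P.c_neg])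
  obtain ⟨h_ab, h_inv⟩ := P.eigenvalue_factors_pos m
  have h_V := P.sqrt_weightV_div m
  have h_P := P.bigQJacobi_sub_div_q m x
  have h_sq := Real.mul_self_sqrt (mul_pos h_ab h_inv).le
  refine mul_left_cancel₀ h_factor ?_
  rw [mul_left_comm, h_P]
  generalize √((1 - a * b * q ^ (m + 1) / c) * (1 - (q ^ m)⁻¹ / c)) = C at *
  have h_V' : √(weightV m a b (c / q) q) * C * c = (c - 1) * √(a * q) * √(weightV m a b c q) := by
    rw [mul_comm _ C, h_V]
    field_simp
  linear_combination -(√(weightV m a b (c / q) q) * c * x * bigQJacobi m x a b c q) * h_sq +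
    (x * C * bigQJacobi m x a b c q) * h_V' - ((c - 1) * x * C * √(weightV m a b c q) *
      bigQJacobi m x a b c q) * Real.div_sqrt (x := a * q)

theorem sqrt_weightV_mul_bigQJacobi_sub_mul_q (m : ℕ) (y : ℝ) :
    √(weightV m a b c q) * ((1 - y / c) * bigQJacobi m y a b c q -
      (1 - y) * bigQJacobi m (y * q) a b c q) =
      y / √(a * q) * √((1 - a * b * q ^ (m + 1) / c) * (1 - (q ^ m)⁻¹ / c)) *
        (√(weightV m a b (c / q) q) * bigQJacobi m y a b (c / q) q) := by
  have hc := P.c_neg.ne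
  have h_sqrt : √(a * q) ≠ 0 := (Real.sqrt_pos.2 (mul_pos P.a_pos P.q_mem.1)).ne'
  have h_V := P.sqrt_weightV_div m
  rw [mul_comm y q, P.bigQJacobi_sub_mul_q, mul_assoc (y / _), ← mul_assoc (√(_ * _)), h_V]
  generalize √(a * q) = r at *
  field_simp

theorem sqrt_mul_normBigQJacobi_div_q {x : ℝ}
    (hx : x = a * q ∨ x / q ∈ Set.Icc (c / q * q) (a * q)) (m : ℕ) :
    √q * √((1 - x / (a * q)) * (1 - x / q)) * normBigQJacobi (x / q) m a b (c / q) q =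
      √(|x|) * ((1 - x / (a * q)) * √(weightU x a b c q)) *
        (√(weightV m a b (c / q) q) * bigQJacobi m (x / q) a b (c / q) q) := by
  rcases hx with rfl | hx
  · rw [div_self (mul_pos P.a_pos P.q_mem.1).ne']
    simp
  · obtain ⟨h_y, h_ya, -, -⟩ := P.div_q.one_sub_pos hx
    have h_U := sqrt_mul_mul_sqrt_eq h_ya.le h_y.le (P.weightU_mul_q hx).symm
    rw [div_div, mul_comm q a, div_mul_cancel₀ _ P.q_ne_zero] at h_U
    have h_abs : √q * √(|x / q|) = √(|x|) := by
      rw [← Real.sqrt_mul P.q_mem.1.le, abs_div, abs_of_pos P.q_mem.1,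
        mul_div_cancel₀ _ P.q_ne_zero]
    rw [P.div_q.normBigQJacobi_eq_of_mem hx, ← h_abs, ← h_U]
    ring

theorem sqrt_mul_normBigQJacobi_of_mem {x : ℝ} (hx : x = c ∨ x ∈ Set.Icc (c * q) (a * q))
    (m : ℕ) :
    √((1 - b * x / c) * (1 - x / c)) * normBigQJacobi x m a b c q =
      √(|x|) * ((1 - x / c) * √(weightU x a b (c / q) q)) *
        (√(weightV m a b c q) * bigQJacobi m x a b c q) := by
  rcases hx with rfl | hx
  · rw [div_self P.c_neg.ne]
    simp
  · obtain ⟨-, -, h_c, h_bc⟩ := P.one_sub_pos hx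
    rw [P.normBigQJacobi_eq_of_mem hx, mul_comm (1 - b * x / c),
      ← sqrt_mul_mul_sqrt_eq h_c.le h_bc.le (P.weightU_div hx).symm]
    ring

theorem normBigQJacobi_sub_div_q {x : ℝ} (hx : x ∈ Set.Icc (c * q) (a * q))
    (hx' : x = a * q ∨ x / q ∈ Set.Icc (c / q * q) (a * q)) (m : ℕ) :
    √((1 - b * x / c) * (1 - x / c)) * normBigQJacobi x m a b (c / q) q -
      √q * √((1 - x / (a * q)) * (1 - x / q)) * normBigQJacobi (x / q) m a b (c / q) q =
      x / √(a * q) * √((1 - a * b * q ^ (m + 1) / c) * (1 - (q ^ m)⁻¹ / c)) *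
        normBigQJacobi x m a b c q := by
  obtain ⟨-, -, h_c, h_bc⟩ := P.one_sub_pos hx
  have h_U := sqrt_mul_mul_sqrt_eq h_bc.le h_c.le (P.weightU_div hx)
  rw [P.sqrt_mul_normBigQJacobi_div_q hx', P.div_q.normBigQJacobi_eq_of_mem (P.mem_Icc_div hx),
    P.normBigQJacobi_eq_of_mem hx]
  linear_combination
    (√(|x|) * √(weightV m a b (c / q) q) * bigQJacobi m x a b (c / q) q) * h_U +
      √(|x|) * √(weightU x a b c q) * P.sqrt_weightV_mul_bigQJacobi_sub_div_q m x

theorem normBigQJacobi_sub_mul_q {y : ℝ} (hy : y ∈ Set.Icc (c / q * q) (a * q))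
    (hy' : y = c ∨ y ∈ Set.Icc (c * q) (a * q)) (m : ℕ) :
    √((1 - b * y / c) * (1 - y / c)) * normBigQJacobi y m a b c q -
      (√q)⁻¹ * √((1 - y / a) * (1 - y)) * normBigQJacobi (y * q) m a b c q =
      y / √(a * q) * √((1 - a * b * q ^ (m + 1) / c) * (1 - (q ^ m)⁻¹ / c)) *
        normBigQJacobi y m a b (c / q) q := by
  obtain ⟨h_y, h_ya, -, -⟩ := P.div_q.one_sub_pos hy
  have h_U := sqrt_mul_mul_sqrt_eq h_y.le h_ya.le (P.weightU_mul_q hy)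
  have h_sqrt : √(|y * q|) = √q * √(|y|) := by
    rw [abs_mul, abs_of_pos P.q_mem.1, mul_comm, Real.sqrt_mul P.q_mem.1.le]
  have h_inv : (√q)⁻¹ * √q = 1 := inv_mul_cancel₀ (Real.sqrt_pos.2 P.q_mem.1).ne'
  rw [P.sqrt_mul_normBigQJacobi_of_mem hy', P.div_q.normBigQJacobi_eq_of_mem hy,
    P.normBigQJacobi_eq_of_mem (P.mul_q_mem_Icc hy), h_sqrt, mul_comm (1 - y / a)]
  linear_combination
    √(|y|) * √(weightU y a b (c / q) q) * P.sqrt_weightV_mul_bigQJacobi_sub_mul_q m y -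
      (√(|y|) * √(weightV m a b c q) * bigQJacobi m (y * q) a b c q) * h_U -
      (√((1 - y) * (1 - y / a)) * √(|y|) * √(weightU (y * q) a b c q) *
        √(weightV m a b c q) * bigQJacobi m (y * q) a b c q) * h_inv

end IsBigQJacobiParam

end NormalizedContiguous

/-! ### Matrix coefficients of the tensor products -/

section Coefficients

/-- The parameters `a` (for `k = k₁`) and `b` (for `k = k₂`) of the big `q²`-Jacobi polynomials
in the intertwiner. -/
def jacobiA (q k : ℝ) : ℝ := q ^ (4 * k - 2)

/-- The parameter `c` of the big `q²`-Jacobi polynomials on the weight space of index `p`. -/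
def jacobiC (q k₁ ε p : ℝ) : ℝ := -q ^ (4 * k₁ - 2 * p - 2 * ε - 2)

/-- The positive node at which the polynomials are evaluated to get the image of `f⁻_{p,n}`. -/
def nodeNeg (q k₁ : ℝ) (n : ℕ) : ℝ := q ^ (2 * n + 4 * k₁)

/-- The negative node at which the polynomials are evaluated to get the image of `f⁺_{p,n}`. -/
def nodePos (q k₁ ε p : ℝ) (n : ℕ) : ℝ := -q ^ (2 * n + 4 * k₁ - 2 * p - 2 * ε)

/-- The factor common to all matrix coefficients between the weight spaces of index `p` and
`p + 1`. -/
def couplingScale (q k₁ k₂ ε p : ℝ) : ℝ := (q⁻¹ - q)⁻¹ * q ^ (-1 / 2 - p - ε + k₁ - k₂)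

section Nodes

variable {q k₁ ε p : ℝ} (hq : 0 < q)
include hq

theorem rpow_two_mul_natCast (n : ℕ) : q ^ (2 * (n : ℝ)) = (q ^ 2) ^ n := by
  rw [Real.rpow_mul hq.le, Real.rpow_natCast, Real.rpow_two]

theorem jacobiA_mul_sq (k : ℝ) : jacobiA q k * q ^ 2 = q ^ (4 * k) := by
  rw [jacobiA, ← Real.rpow_two, ← Real.rpow_add hq, sub_add_cancel]

theorem sqrt_jacobiA_mul_sq (k : ℝ) : √(jacobiA q k * q ^ 2) = q ^ (2 * k) := by
  rw [jacobiA_mul_sq hq, show 4 * k = 2 * k + 2 * k by ring, Real.rpow_add hq,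
    Real.sqrt_mul_self (Real.rpow_pos_of_pos hq _).le]

theorem jacobiC_add_one : jacobiC q k₁ ε (p + 1) = jacobiC q k₁ ε p / q ^ 2 := by
  rw [jacobiC, jacobiC, neg_div, ← Real.rpow_two, ← Real.rpow_sub hq]
  ring_nf

theorem nodePos_add_one (n : ℕ) : nodePos q k₁ ε (p + 1) n = nodePos q k₁ ε p n / q ^ 2 := by
  rw [nodePos, nodePos, neg_div, ← Real.rpow_two, ← Real.rpow_sub hq]
  ring_nf

theorem jacksonNode_inl (c : ℝ) (n : ℕ) :
    jacksonNode (jacobiA q k₁) c (q ^ 2) (Sum.inl n) = nodeNeg q k₁ n := by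
  simp only [jacksonNode, Sum.elim_inl]
  rw [jacobiA_mul_sq hq, ← rpow_two_mul_natCast hq, ← Real.rpow_add hq, add_comm, nodeNeg]

theorem jacksonNode_inr (a : ℝ) (n : ℕ) :
    jacksonNode a (jacobiC q k₁ ε p) (q ^ 2) (Sum.inr n) = nodePos q k₁ ε p n := by
  simp only [jacksonNode, Sum.elim_inr, jacobiC, nodePos]
  rw [← rpow_two_mul_natCast hq, ← Real.rpow_two, neg_mul, neg_mul, ← Real.rpow_add hq,
    ← Real.rpow_add hq]
  ring_nf

theorem nodeNeg_zero : nodeNeg q k₁ 0 = jacobiA q k₁ * q ^ 2 := by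
  rw [jacobiA_mul_sq hq, nodeNeg, Nat.cast_zero, mul_zero, zero_add]

theorem nodeNeg_succ (n : ℕ) : nodeNeg q k₁ (n + 1) = nodeNeg q k₁ n * q ^ 2 := by
  rw [nodeNeg, nodeNeg, ← Real.rpow_two, ← Real.rpow_add hq]
  push_cast
  ring_nf

end Nodes

theorem nodePos_add_one_zero (q k₁ ε p : ℝ) :
    nodePos q k₁ ε (p + 1) 0 = jacobiC q k₁ ε p := by
  rw [nodePos, jacobiC]
  push_cast
  ring_nf

theorem nodePos_add_one_succ (q k₁ ε p : ℝ) (n : ℕ) :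
    nodePos q k₁ ε (p + 1) (n + 1) = nodePos q k₁ ε p n := by
  rw [nodePos, nodePos]
  push_cast
  ring_nf

section Parameters

variable {q k₁ k₂ : ℝ} (hq : q ∈ Set.Ioo (0 : ℝ) 1) (h₁ : 0 < k₁) (h₂ : 0 < k₂) (ε p : ℝ)
include hq h₁ h₂

theorem isBigQJacobiParam_jacobi :
    IsBigQJacobiParam (jacobiA q k₁) (jacobiA q k₂) (jacobiC q k₁ ε p) (q ^ 2) := by
  have h_lt (k : ℝ) (hk : 0 < k) : jacobiA q k * q ^ 2 < 1 := by
    rw [jacobiA_mul_sq hq.1]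
    exact Real.rpow_lt_one hq.1.le hq.2 (by linarith)
  exact ⟨⟨pow_pos hq.1 2, pow_lt_one₀ hq.1.le hq.2 two_ne_zero⟩, Real.rpow_pos_of_pos hq.1 _,
    h_lt k₁ h₁, Real.rpow_pos_of_pos hq.1 _, h_lt k₂ h₂,
    neg_neg_of_pos (Real.rpow_pos_of_pos hq.1 _)⟩

theorem nodeNeg_mem_Icc (n : ℕ) :
    nodeNeg q k₁ n ∈ Set.Icc (jacobiC q k₁ ε p * q ^ 2) (jacobiA q k₁ * q ^ 2) :=
  jacksonNode_inl hq.1 (jacobiC q k₁ ε p) n ▸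
    (isBigQJacobiParam_jacobi hq h₁ h₂ ε p).isQBetaParam.node_mem _

theorem nodePos_mem_Icc (n : ℕ) :
    nodePos q k₁ ε p n ∈ Set.Icc (jacobiC q k₁ ε p * q ^ 2) (jacobiA q k₁ * q ^ 2) :=
  jacksonNode_inr hq.1 (jacobiA q k₁) n ▸
    (isBigQJacobiParam_jacobi hq h₁ h₂ ε p).isQBetaParam.node_mem _

theorem nodeNeg_eq_or_div_mem_Icc (n : ℕ) :
    nodeNeg q k₁ n = jacobiA q k₁ * q ^ 2 ∨ nodeNeg q k₁ n / q ^ 2 ∈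
      Set.Icc (jacobiC q k₁ ε p / q ^ 2 * q ^ 2) (jacobiA q k₁ * q ^ 2) := by
  rcases n with _ | n
  · exact Or.inl (nodeNeg_zero hq.1)
  · right
    rw [nodeNeg_succ hq.1, mul_div_cancel_right₀ _ (pow_pos hq.1 2).ne',
      ← jacobiC_add_one hq.1]
    exact nodeNeg_mem_Icc hq h₁ h₂ ε (p + 1) n

theorem nodePos_div_mem_Icc (n : ℕ) :
    nodePos q k₁ ε p n / q ^ 2 ∈
      Set.Icc (jacobiC q k₁ ε p / q ^ 2 * q ^ 2) (jacobiA q k₁ * q ^ 2) := by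
  rw [← nodePos_add_one hq.1, ← jacobiC_add_one hq.1]
  exact nodePos_mem_Icc hq h₁ h₂ ε (p + 1) n

theorem nodePos_div_eq_or_mem_Icc (n : ℕ) :
    nodePos q k₁ ε p n / q ^ 2 = jacobiC q k₁ ε p ∨ nodePos q k₁ ε p n / q ^ 2 ∈
      Set.Icc (jacobiC q k₁ ε p * q ^ 2) (jacobiA q k₁ * q ^ 2) := by
  rw [← nodePos_add_one hq.1]
  rcases n with _ | n
  · exact Or.inl (nodePos_add_one_zero q k₁ ε p)
  · exact Or.inr (nodePos_add_one_succ q k₁ ε p n ▸ nodePos_mem_Icc hq h₁ h₂ ε p n)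

end Parameters

section Data

variable {q k₁ k₂ ε : ℝ} (hq : q ∈ Set.Ioo (0 : ℝ) 1)

theorem negData_d (h₁ : 0 < k₁) (n : ℕ) :
    (negData q hq k₁ h₁).d n = -(negData q hq k₁ h₁).c (n + 1) := by
  simp only [negData]
  push_cast
  ring_nf

theorem posData_d_succ (h₂ : 0 < k₂) (n : ℕ) :
    (posData q hq k₂ h₂).d (n + 1) = -(posData q hq k₂ h₂).c n := by
  simp only [posData]
  push_cast
  ring_nf

theorem strangeData_d_add_one (σ ε : ℝ) (j : ℤ) :
    (strangeData q hq σ ε).d (j + 1) = -(strangeData q hq σ ε).c j := by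
  simp only [strangeData]
  push_cast
  ring_nf

theorem negData_c_zero (h₁ : 0 < k₁) : (negData q hq k₁ h₁).c 0 = 0 := by
  simp [negData]

theorem posData_d_zero (h₂ : 0 < k₂) : (posData q hq k₂ h₂).d 0 = 0 := by
  simp [posData]

theorem strangeData_c_eq (p : ℤ) (m : ℕ) :
    (strangeData q hq (k₁ + k₂ - 1 / 2 + m) (ε - k₁ + k₂)).c p =
      couplingScale q k₁ k₂ ε p *
        √((1 - jacobiA q k₁ * jacobiA q k₂ * (q ^ 2) ^ (m + 1) / jacobiC q k₁ ε p) *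
          (1 - ((q ^ 2) ^ m)⁻¹ / jacobiC q k₁ ε p)) := by
  have h0 := hq.1
  simp only [strangeData, couplingScale, jacobiA, jacobiC]
  rw [div_neg, div_neg, sub_neg_eq_add, sub_neg_eq_add, ← rpow_two_mul_natCast h0,
    ← rpow_two_mul_natCast h0, ← Real.rpow_neg h0.le, ← Real.rpow_add h0, ← Real.rpow_add h0,
    ← Real.rpow_sub h0, ← Real.rpow_sub h0, mul_assoc]
  push_cast
  ring_nf

theorem negData_κ_mul_strangeData_c (h₁ : 0 < k₁) (n : ℕ) (p : ℤ) :
    (negData q hq k₁ h₁).κ n * (strangeData q hq (k₂ - 1 / 2) (ε + k₂)).c (n + p) =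
      couplingScale q k₁ k₂ ε p * (√(jacobiA q k₁ * q ^ 2) / nodeNeg q k₁ n) *
        √((1 - jacobiA q k₂ * nodeNeg q k₁ n / jacobiC q k₁ ε p) *
          (1 - nodeNeg q k₁ n / jacobiC q k₁ ε p)) := by
  have h0 := hq.1
  rw [sqrt_jacobiA_mul_sq h0]
  simp only [negData, strangeData, couplingScale, jacobiA, jacobiC, nodeNeg]
  rw [div_neg, div_neg, sub_neg_eq_add, sub_neg_eq_add, ← Real.rpow_add h0,
    ← Real.rpow_sub h0, ← Real.rpow_sub h0, ← Real.rpow_sub h0, mul_assoc (_)⁻¹,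
    ← Real.rpow_add h0, mul_left_comm, ← mul_assoc (q ^ _), ← Real.rpow_add h0, ← mul_assoc]
  push_cast
  ring_nf

theorem negData_c_mul_strangeData_κ_inv (h₁ : 0 < k₁) (n : ℕ) (p : ℤ) :
    (negData q hq k₁ h₁).c n * ((strangeData q hq (k₂ - 1 / 2) (ε + k₂)).κ (n + p))⁻¹ =
      -(couplingScale q k₁ k₂ ε p * (√(jacobiA q k₁ * q ^ 2) / nodeNeg q k₁ n) *
        (√(q ^ 2) * √((1 - nodeNeg q k₁ n / (jacobiA q k₁ * q ^ 2)) *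
          (1 - nodeNeg q k₁ n / q ^ 2)))) := by
  have h0 := hq.1
  have h_ratio : nodeNeg q k₁ n / q ^ (4 * k₁) = q ^ (2 * (n : ℝ)) := by
    rw [nodeNeg, ← Real.rpow_sub h0, add_sub_cancel_right]
  have h_ratio' : nodeNeg q k₁ n / q ^ 2 = q ^ (4 * k₁ + 2 * n - 2) := by
    rw [nodeNeg, ← Real.rpow_two, ← Real.rpow_sub h0, add_comm]
  have h_pow : q ^ (1 / 2 - k₁ - n) * (q ^ (((n + p : ℤ) : ℝ) + (ε + k₂)))⁻¹ =
      q ^ (-1 / 2 - p - ε + k₁ - k₂) * (q ^ (2 * k₁) / nodeNeg q k₁ n) * q := by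
    rw [nodeNeg, ← Real.rpow_neg h0.le, ← Real.rpow_add h0, ← Real.rpow_sub h0,
      ← Real.rpow_add h0, ← Real.rpow_add_one h0.ne']
    push_cast
    ring_nf
  rw [sqrt_jacobiA_mul_sq h0, jacobiA_mul_sq h0, Real.sqrt_sq h0.le, h_ratio, h_ratio']
  simp only [negData, strangeData, couplingScale]
  linear_combination (-(q⁻¹ - q)⁻¹ *
    √((1 - q ^ (2 * (n : ℝ))) * (1 - q ^ (4 * k₁ + 2 * n - 2)))) * h_pow

theorem strangeData_κ_mul_posData_c (h₂ : 0 < k₂) {N : ℤ} (hε : 2 * ε = N) (n : ℕ) (p : ℤ) :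
    (strangeData q hq (k₁ - 1 / 2) (-ε - k₁)).κ (N - n + p) * (posData q hq k₂ h₂).c n =
      -(couplingScale q k₁ k₂ ε p * (√(jacobiA q k₁ * q ^ 2) / nodePos q k₁ ε p n) *
        √((1 - jacobiA q k₂ * nodePos q k₁ ε p n / jacobiC q k₁ ε p) *
          (1 - nodePos q k₁ ε p n / jacobiC q k₁ ε p))) := by
  have h0 := hq.1
  have h_ratio : jacobiA q k₂ * nodePos q k₁ ε p n / jacobiC q k₁ ε p =
      q ^ (4 * k₂ + 2 * n) := by
    rw [jacobiA, nodePos, jacobiC, mul_neg, neg_div_neg_eq, ← Real.rpow_add h0,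
      ← Real.rpow_sub h0]
    ring_nf
  have h_ratio' : nodePos q k₁ ε p n / jacobiC q k₁ ε p = q ^ (2 * (n : ℝ) + 2) := by
    rw [nodePos, jacobiC, neg_div_neg_eq, ← Real.rpow_sub h0]
    ring_nf
  have h_pow : q ^ (((N - n + p : ℤ) : ℝ) + (-ε - k₁)) * q ^ (-1 / 2 - k₂ - n) =
      -(q ^ (-1 / 2 - p - ε + k₁ - k₂) * (q ^ (2 * k₁) / nodePos q k₁ ε p n)) := by
    rw [nodePos, div_neg, mul_neg, neg_neg, ← Real.rpow_sub h0, ← Real.rpow_add h0,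
      ← Real.rpow_add h0]
    push_cast
    rw [← hε]
    ring_nf
  rw [sqrt_jacobiA_mul_sq h0, h_ratio, h_ratio', mul_comm (1 - q ^ (4 * k₂ + 2 * n))]
  simp only [strangeData, posData, couplingScale]
  linear_combination ((q⁻¹ - q)⁻¹ *
    √((1 - q ^ (2 * (n : ℝ) + 2)) * (1 - q ^ (4 * k₂ + 2 * n)))) * h_pow

theorem sqrt_one_add_rpow_mul (h0 : 0 < q) (y z : ℝ) :
    √((1 + q ^ y) * (1 + q ^ z)) =
      q ^ ((y + z) / 2) * √((1 + q ^ (-y)) * (1 + q ^ (-z))) := by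
  have h_inv (y : ℝ) : 1 + q ^ y = q ^ y * (1 + q ^ (-y)) := by
    rw [mul_add, ← Real.rpow_add h0, add_neg_cancel, Real.rpow_zero, mul_one, add_comm]
  rw [h_inv y, h_inv z, mul_mul_mul_comm, ← Real.rpow_add h0,
    Real.sqrt_mul (Real.rpow_pos_of_pos h0 _).le, Real.sqrt_eq_rpow, ← Real.rpow_mul h0.le,
    mul_one_div]

theorem strangeData_c_eq_nodePos {N : ℤ} (hε : 2 * ε = N) (n : ℕ) (p : ℤ) :
    (strangeData q hq (k₁ - 1 / 2) (-ε - k₁)).c (N - n + p) =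
      (q⁻¹ - q)⁻¹ * q ^ (1 / 2 + ε - n + p - k₁) *
        √((1 - nodePos q k₁ ε p n / (jacobiA q k₁ * q ^ 2)) *
          (1 - nodePos q k₁ ε p n / q ^ 2)) := by
  have h0 := hq.1
  have h_node (y : ℝ) : 1 - nodePos q k₁ ε p n / q ^ y =
      1 + q ^ (2 * n + 4 * k₁ - 2 * p - 2 * ε - y) := by
    rw [nodePos, neg_div, sub_neg_eq_add, ← Real.rpow_sub h0]
  rw [jacobiA_mul_sq h0, ← Real.rpow_two, h_node, h_node]
  simp only [strangeData]
  rw [sqrt_one_add_rpow_mul h0, mul_assoc, ← mul_assoc (q ^ _), ← Real.rpow_add h0,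
    ← mul_assoc]
  push_cast
  rw [← hε]
  ring_nf

theorem strangeData_c_mul_posData_κ_inv (h₂ : 0 < k₂) {N : ℤ} (hε : 2 * ε = N) (n : ℕ) (p : ℤ) :
    (strangeData q hq (k₁ - 1 / 2) (-ε - k₁)).c (N - n + p) * ((posData q hq k₂ h₂).κ n)⁻¹ =
      -(couplingScale q k₁ k₂ ε p * (√(jacobiA q k₁ * q ^ 2) / nodePos q k₁ ε p n) *
        (√(q ^ 2) * √((1 - nodePos q k₁ ε p n / (jacobiA q k₁ * q ^ 2)) *
          (1 - nodePos q k₁ ε p n / q ^ 2)))) := by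
  have h0 := hq.1
  have h_pow : q ^ (1 / 2 + ε - n + p - k₁) * (q ^ (k₂ + n))⁻¹ =
      -(q ^ (-1 / 2 - p - ε + k₁ - k₂) * (q ^ (2 * k₁) / nodePos q k₁ ε p n) * q) := by
    rw [nodePos, div_neg, mul_neg, neg_mul, neg_neg, ← Real.rpow_neg h0.le, ← Real.rpow_sub h0,
      ← Real.rpow_add h0, ← Real.rpow_add h0, ← Real.rpow_add_one h0.ne']
    ring_nf
  rw [strangeData_c_eq_nodePos hq hε, sqrt_jacobiA_mul_sq h0, Real.sqrt_sq h0.le]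
  simp only [posData, couplingScale]
  linear_combination ((q⁻¹ - q)⁻¹ * √((1 - nodePos q k₁ ε p n / (jacobiA q k₁ * q ^ 2)) *
    (1 - nodePos q k₁ ε p n / q ^ 2))) * h_pow

end Data

section Theta

variable {q k₁ k₂ ε : ℝ}

theorem thetaNeg_eq (q k₁ k₂ ε : ℝ) (p : ℤ) (n m : ℕ) : thetaNeg q k₁ k₂ ε p n m =
    normBigQJacobi (nodeNeg q k₁ n) m (jacobiA q k₁) (jacobiA q k₂) (jacobiC q k₁ ε p)
      (q ^ 2) := rfl

theorem thetaNeg_add_one (hq : 0 < q) (p : ℤ) (n m : ℕ) : thetaNeg q k₁ k₂ ε (p + 1) n m =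
    normBigQJacobi (nodeNeg q k₁ n) m (jacobiA q k₁) (jacobiA q k₂) (jacobiC q k₁ ε p / q ^ 2)
      (q ^ 2) := by
  rw [thetaNeg_eq, ← jacobiC_add_one hq, Int.cast_add, Int.cast_one]

theorem thetaPos_eq (q k₁ k₂ ε : ℝ) (p : ℤ) (n m : ℕ) : thetaPos q k₁ k₂ ε p n m =
    (-1) ^ n * normBigQJacobi (nodePos q k₁ ε p n) m (jacobiA q k₁) (jacobiA q k₂)
      (jacobiC q k₁ ε p) (q ^ 2) := rfl

theorem thetaPos_add_one (hq : 0 < q) (p : ℤ) (n m : ℕ) : thetaPos q k₁ k₂ ε (p + 1) n m =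
    (-1) ^ n * normBigQJacobi (nodePos q k₁ ε p n / q ^ 2) m (jacobiA q k₁) (jacobiA q k₂)
      (jacobiC q k₁ ε p / q ^ 2) (q ^ 2) := by
  rw [thetaPos_eq, ← jacobiC_add_one hq, ← nodePos_add_one hq, Int.cast_add, Int.cast_one]

theorem negData_c_mul_thetaNeg_pred (hq : q ∈ Set.Ioo (0 : ℝ) 1) (h₁ : 0 < k₁) (p : ℤ)
    (n m : ℕ) :
    (negData q hq k₁ h₁).c n * thetaNeg q k₁ k₂ ε (p + 1) (n - 1) m =
      (negData q hq k₁ h₁).c n * normBigQJacobi (nodeNeg q k₁ n / q ^ 2) m (jacobiA q k₁)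
        (jacobiA q k₂) (jacobiC q k₁ ε p / q ^ 2) (q ^ 2) := by
  rcases n with _ | n
  · simp only [negData_c_zero, zero_mul]
  · rw [thetaNeg_add_one hq.1, nodeNeg_succ hq.1,
      mul_div_cancel_right₀ _ (pow_pos hq.1 2).ne', Nat.add_sub_cancel]

theorem strangeData_κ_mul_posData_d_mul_thetaPos_pred (hq : q ∈ Set.Ioo (0 : ℝ) 1) (h₂ : 0 < k₂)
    {N : ℤ} (hε : 2 * ε = N) (p : ℤ) (n m : ℕ) :
    (strangeData q hq (k₁ - 1 / 2) (-ε - k₁)).κ (N - n + (p + 1)) * (posData q hq k₂ h₂).d n *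
        thetaPos q k₁ k₂ ε p (n - 1) m =
      -((-1) ^ n * (couplingScale q k₁ k₂ ε p *
        (√(jacobiA q k₁ * q ^ 2) / nodePos q k₁ ε (p + 1) n) *
        √((1 - jacobiA q k₂ * nodePos q k₁ ε (p + 1) n / jacobiC q k₁ ε p) *
          (1 - nodePos q k₁ ε (p + 1) n / jacobiC q k₁ ε p)) *
        normBigQJacobi (nodePos q k₁ ε (p + 1) n) m (jacobiA q k₁) (jacobiA q k₂)
          (jacobiC q k₁ ε p) (q ^ 2))) := by
  rcases n with _ | n
  · have hc : jacobiC q k₁ ε p ≠ 0 := neg_ne_zero.2 (Real.rpow_pos_of_pos hq.1 _).ne'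
    simp only [posData_d_zero, nodePos_add_one_zero, div_self hc, sub_self, mul_zero,
      Real.sqrt_zero, zero_mul, neg_zero]
  · rw [posData_d_succ, Nat.add_sub_cancel, thetaPos_eq, nodePos_add_one_succ,
      show N - ((n + 1 : ℕ) : ℤ) + (p + 1) = N - n + p by push_cast; ring, mul_neg,
      strangeData_κ_mul_posData_c hq h₂ hε, pow_succ (-1 : ℝ)]
    ring

theorem mul_sqrt_mul_div_eq (hq : 0 < q) (t r a y : ℝ) :
    t * (r / (y * q)) * (√q * √((1 - y * q / (a * q)) * (1 - y * q / q))) =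
      t * (r / y) * ((√q)⁻¹ * √((1 - y / a) * (1 - y))) := by
  have h_sqrt : √q / q = (√q)⁻¹ := Real.sqrt_div_self
  rw [mul_div_mul_right _ _ hq.ne', mul_div_cancel_right₀ _ hq.ne', ← h_sqrt, ← div_div]
  ring

theorem mul_add_mul_eq_of_contiguous {t r s₁ s₂ S W W₁ W₂ A B C x : ℝ} (hx : x ≠ 0) (hr : r ≠ 0)
    (hA : A = t * (r / x) * s₁) (hB : B = -(t * (r / x) * s₂)) (hC : C = t * S)
    (h : s₁ * W₁ - s₂ * W₂ = x / r * S * W) : A * W₁ + B * W₂ = C * W := by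
  have h_cancel : r / x * (x / r) = 1 := by rw [div_mul_div_cancel₀ hx, div_self hr]
  rw [hA, hB, hC]
  linear_combination t * (r / x) * h + t * S * W * h_cancel

theorem sqrt_jacobiA_mul_sq_ne_zero (hq : 0 < q) : √(jacobiA q k₁ * q ^ 2) ≠ 0 := by
  rw [sqrt_jacobiA_mul_sq hq]
  exact (Real.rpow_pos_of_pos hq _).ne'

theorem nodeNeg_ne_zero (hq : 0 < q) (n : ℕ) : nodeNeg q k₁ n ≠ 0 :=
  (Real.rpow_pos_of_pos hq _).ne'

theorem nodePos_ne_zero (hq : 0 < q) (p : ℝ) (n : ℕ) : nodePos q k₁ ε p n ≠ 0 :=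
  neg_ne_zero.2 (Real.rpow_pos_of_pos hq _).ne'

variable (hq : q ∈ Set.Ioo (0 : ℝ) 1) (h₁ : 0 < k₁) (h₂ : 0 < k₂) {N : ℤ}
include h₁ h₂

theorem thetaNeg_E (p : ℤ) (n m : ℕ) :
    (negData q hq k₁ h₁).κ n * (strangeData q hq (k₂ - 1 / 2) (ε + k₂)).c (n + p) *
        thetaNeg q k₁ k₂ ε (p + 1) n m +
      (negData q hq k₁ h₁).c n * ((strangeData q hq (k₂ - 1 / 2) (ε + k₂)).κ (n + p))⁻¹ *
        thetaNeg q k₁ k₂ ε (p + 1) (n - 1) m =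
      (strangeData q hq (k₁ + k₂ - 1 / 2 + m) (ε - k₁ + k₂)).c p * thetaNeg q k₁ k₂ ε p n m := by
  have h_contiguous := (isBigQJacobiParam_jacobi hq h₁ h₂ ε p).normBigQJacobi_sub_div_q
    (nodeNeg_mem_Icc hq h₁ h₂ ε p n) (nodeNeg_eq_or_div_mem_Icc hq h₁ h₂ ε p n) m
  rw [mul_right_comm ((negData q hq k₁ h₁).c n), negData_c_mul_thetaNeg_pred hq h₁,
    mul_right_comm ((negData q hq k₁ h₁).c n), thetaNeg_add_one hq.1, thetaNeg_eq]
  exact mul_add_mul_eq_of_contiguous (nodeNeg_ne_zero hq.1 n) (sqrt_jacobiA_mul_sq_ne_zero hq.1)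
    (negData_κ_mul_strangeData_c hq h₁ n p) (negData_c_mul_strangeData_κ_inv hq h₁ n p)
    (strangeData_c_eq hq p m) h_contiguous

theorem thetaNeg_F (p : ℤ) (n m : ℕ) :
    (negData q hq k₁ h₁).κ n * (strangeData q hq (k₂ - 1 / 2) (ε + k₂)).d (n + (p + 1)) *
        thetaNeg q k₁ k₂ ε p n m +
      (negData q hq k₁ h₁).d n * ((strangeData q hq (k₂ - 1 / 2) (ε + k₂)).κ (n + (p + 1)))⁻¹ *
        thetaNeg q k₁ k₂ ε p (n + 1) m =
      (strangeData q hq (k₁ + k₂ - 1 / 2 + m) (ε - k₁ + k₂)).d (p + 1) *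
        thetaNeg q k₁ k₂ ε (p + 1) n m := by
  have P := isBigQJacobiParam_jacobi hq h₁ h₂ ε p
  have h_mem := nodeNeg_mem_Icc hq h₁ h₂ ε p n
  have h_contiguous := P.normBigQJacobi_sub_mul_q (P.mem_Icc_div h_mem) (Or.inr h_mem) m
  have h_down := negData_c_mul_strangeData_κ_inv (k₂ := k₂) (ε := ε) hq h₁ (n + 1) p
  rw [show ((n + 1 : ℕ) : ℤ) + p = n + (p + 1) by push_cast; ring, nodeNeg_succ hq.1,
    mul_sqrt_mul_div_eq P.q_mem.1] at h_down
  have h := mul_add_mul_eq_of_contiguous (nodeNeg_ne_zero hq.1 n) (sqrt_jacobiA_mul_sq_ne_zero hq.1)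
    (negData_κ_mul_strangeData_c hq h₁ n p) h_down (strangeData_c_eq hq p m) h_contiguous
  rw [← add_assoc (n : ℤ) p 1, strangeData_d_add_one, strangeData_d_add_one, negData_d,
    add_assoc (n : ℤ) p 1, thetaNeg_add_one hq.1, thetaNeg_eq, thetaNeg_eq, nodeNeg_succ hq.1]
  linear_combination -h

theorem thetaPos_E (hε : 2 * ε = N) (p : ℤ) (n m : ℕ) :
    (strangeData q hq (k₁ - 1 / 2) (-ε - k₁)).κ (N - n + p) * (posData q hq k₂ h₂).c n *
        thetaPos q k₁ k₂ ε (p + 1) (n + 1) m +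
      (strangeData q hq (k₁ - 1 / 2) (-ε - k₁)).c (N - n + p) * ((posData q hq k₂ h₂).κ n)⁻¹ *
        thetaPos q k₁ k₂ ε (p + 1) n m =
      (strangeData q hq (k₁ + k₂ - 1 / 2 + m) (ε - k₁ + k₂)).c p * thetaPos q k₁ k₂ ε p n m := by
  have h_contiguous := (isBigQJacobiParam_jacobi hq h₁ h₂ ε p).normBigQJacobi_sub_div_q
    (nodePos_mem_Icc hq h₁ h₂ ε p n) (Or.inr (nodePos_div_mem_Icc hq h₁ h₂ ε p n)) m
  have h := mul_add_mul_eq_of_contiguous (nodePos_ne_zero hq.1 p n)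
    (sqrt_jacobiA_mul_sq_ne_zero hq.1)
    (neg_eq_iff_eq_neg.2 (strangeData_κ_mul_posData_c hq h₂ hε n p))
    (strangeData_c_mul_posData_κ_inv hq h₂ hε n p) (strangeData_c_eq hq p m) h_contiguous
  rw [thetaPos_add_one hq.1 p n, thetaPos_add_one hq.1, thetaPos_eq, ← nodePos_add_one hq.1,
    nodePos_add_one_succ, pow_succ (-1 : ℝ)]
  linear_combination (-1) ^ n * h

theorem thetaPos_F (hε : 2 * ε = N) (p : ℤ) (n m : ℕ) :
    (strangeData q hq (k₁ - 1 / 2) (-ε - k₁)).κ (N - n + (p + 1)) * (posData q hq k₂ h₂).d n *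
        thetaPos q k₁ k₂ ε p (n - 1) m +
      (strangeData q hq (k₁ - 1 / 2) (-ε - k₁)).d (N - n + (p + 1)) *
        ((posData q hq k₂ h₂).κ n)⁻¹ * thetaPos q k₁ k₂ ε p n m =
      (strangeData q hq (k₁ + k₂ - 1 / 2 + m) (ε - k₁ + k₂)).d (p + 1) *
        thetaPos q k₁ k₂ ε (p + 1) n m := by
  have P := isBigQJacobiParam_jacobi hq h₁ h₂ ε p
  have h_contiguous := P.normBigQJacobi_sub_mul_q (nodePos_div_mem_Icc hq h₁ h₂ ε p n)
    (nodePos_div_eq_or_mem_Icc hq h₁ h₂ ε p n) m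
  have h_node : nodePos q k₁ ε p n = nodePos q k₁ ε p n / q ^ 2 * q ^ 2 :=
    (div_mul_cancel₀ _ P.q_ne_zero).symm
  have h_down := strangeData_c_mul_posData_κ_inv (k₁ := k₁) hq h₂ hε n p
  rw [h_node, mul_sqrt_mul_div_eq P.q_mem.1] at h_down
  have h := mul_add_mul_eq_of_contiguous (div_ne_zero (nodePos_ne_zero hq.1 p n) P.q_ne_zero)
    (sqrt_jacobiA_mul_sq_ne_zero hq.1) rfl h_down (strangeData_c_eq hq p m) h_contiguous
  rw [← h_node] at h
  rw [strangeData_κ_mul_posData_d_mul_thetaPos_pred hq h₂ hε, ← add_assoc (N - n : ℤ) p 1,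
    strangeData_d_add_one, strangeData_d_add_one, thetaPos_add_one hq.1, thetaPos_eq,
    nodePos_add_one hq.1]
  linear_combination -(-1) ^ n * h

end Theta

end Coefficients

/-! ### Unitary operators from orthonormal matrices on the fibres -/

section Unitary

theorem exists_hilbertBasis_coe_eq {ι E : Type*} [NormedAddCommGroup E] [InnerProductSpace ℂ E]
    [CompleteSpace E] {G : ι → E} (hG : Orthonormal ℂ G)
    (h_total : ∀ v, (∀ s, inner ℂ (G s) v = 0) → v = 0) :
    ∃ B : HilbertBasis ι ℂ E, ⇑B = G :=
  ⟨HilbertBasis.mkOfOrthogonalEqBot hG ((Submodule.eq_bot_iff _).2 fun v hv =>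
      h_total v fun s => hv _ (Submodule.subset_span (Set.mem_range_self s))),
    HilbertBasis.coe_mkOfOrthogonalEqBot _ _⟩

variable {ι X M : Type*}

/-- The vector of `ℓ²(ι × X)` supported on the fibre over `p`, where it is given by the real
square-summable function `w`. -/
def fibreVec [DecidableEq ι] (p : ι) (w : X → ℝ) (hw : Summable fun i => w i * w i) :
    ℓ²(ι × X, ℂ) :=
  ⟨fun s => if s.1 = p then (w s.2 : ℂ) else 0, by
    refine memℓp_gen (((Prod.mk_right_injective p).summable_iff fun s hs => ?_).1
      (hw.congr fun i => ?_))
    · have h_ne : s.1 ≠ p := fun h => hs ⟨s.2, by rw [← h]⟩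
      simp [h_ne]
    · simp [Complex.norm_real, ← sq]⟩

theorem fibreVec_apply [DecidableEq ι] (p : ι) (w : X → ℝ) (hw : Summable fun i => w i * w i)
    (s : ι × X) : fibreVec p w hw s = if s.1 = p then (w s.2 : ℂ) else 0 := rfl

theorem inner_fibreVec [DecidableEq ι] (p : ι) (w : X → ℝ) (hw : Summable fun i => w i * w i)
    (v : ℓ²(ι × X, ℂ)) : inner ℂ (fibreVec p w hw) v = ∑' i, (w i : ℂ) * v (p, i) := by
  rw [lp.inner_eq_tsum, ← (Prod.mk_right_injective p).tsum_eq]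
  · exact tsum_congr fun i => by simp [fibreVec_apply, mul_comm]
  · intro s hs
    by_contra h
    have h_ne : s.1 ≠ p := fun h' => h ⟨s.2, by rw [← h']⟩
    exact hs (by simp [fibreVec_apply, h_ne])

theorem orthonormal_fibreVec [DecidableEq ι] [DecidableEq M] {θ : ι → X → M → ℝ}
    (hθ : ∀ p m n, HasSum (fun i => θ p i m * θ p i n) (if m = n then 1 else 0)) :
    Orthonormal ℂ fun s : ι × M =>
      fibreVec s.1 (fun i => θ s.1 i s.2) (hθ s.1 s.2 s.2).summable := by
  rw [orthonormal_iff_ite]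
  rintro ⟨p, m⟩ ⟨p', n⟩
  rw [inner_fibreVec]
  by_cases hp : p = p'
  · subst hp
    have h_sum := (Complex.hasSum_ofReal.2 (hθ p m n)).tsum_eq
    simp only [Complex.ofReal_mul] at h_sum
    simp only [fibreVec_apply, if_true, h_sum]
    by_cases hmn : m = n <;> simp [hmn]
  · simp [fibreVec_apply, hp]

theorem eq_zero_of_inner_fibreVec_eq_zero [DecidableEq ι] {θ : ι → X → M → ℝ}
    (hθ : ∀ p m, Summable fun i => θ p i m * θ p i m)
    (h_total : ∀ p (g : X → ℂ), (Summable fun i => ‖g i‖ ^ 2) →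
      (∀ m, ∑' i, (θ p i m : ℂ) * g i = 0) → ∀ i, g i = 0)
    {v : ℓ²(ι × X, ℂ)}
    (hv : ∀ s : ι × M, inner ℂ (fibreVec s.1 (fun i => θ s.1 i s.2) (hθ s.1 s.2)) v = 0) :
    v = 0 := by
  have h_sq : Summable fun s => ‖v s‖ ^ 2 := by
    simpa using (lp.memℓp v).summable (by norm_num)
  ext ⟨p, i⟩
  refine h_total p (fun i => v (p, i)) (h_sq.comp_injective (Prod.mk_right_injective p))
    (fun m => ?_) i
  rw [← hv (p, m), inner_fibreVec]

theorem exists_unitary_of_fibres [DecidableEq ι] [DecidableEq X] [DecidableEq M]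
    {θ : ι → X → M → ℝ}
    (hθ : ∀ p m n, HasSum (fun i => θ p i m * θ p i n) (if m = n then 1 else 0))
    (h_total : ∀ p (g : X → ℂ), (Summable fun i => ‖g i‖ ^ 2) →
      (∀ m, ∑' i, (θ p i m : ℂ) * g i = 0) → ∀ i, g i = 0) :
    ∃ U : ℓ²(ι × X, ℂ) ≃ₗᵢ[ℂ] ℓ²(ι × M, ℂ), ∀ p i s,
      U (lp.single 2 (p, i) 1) s = if s.1 = p then (θ p i s.2 : ℂ) else 0 := by
  obtain ⟨B, hB⟩ := exists_hilbertBasis_coe_eq (orthonormal_fibreVec hθ) fun _ =>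
    eq_zero_of_inner_fibreVec_eq_zero (fun p m => (hθ p m m).summable) h_total
  refine ⟨B.repr, fun p i s => ?_⟩
  rw [B.repr_apply_apply, hB, lp.inner_single_right, fibreVec_apply]
  by_cases hs : s.1 = p
  · subst hs
    simp
  · simp [hs, Ne.symm hs]

theorem exists_curry_unitary (ι M : Type*) :
    ∃ V : lp (fun _ : M => ℓ²(ι, ℂ)) 2 ≃ₗᵢ[ℂ] ℓ²(ι × M, ℂ), ∀ v p m, V v (p, m) = v m p := by
  classical
  let e : ι × M → lp (fun _ : M => ℓ²(ι, ℂ)) 2 := fun s => lp.single 2 s.2 (lp.single 2 s.1 1)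
  have h_inner (s : ι × M) (v : lp (fun _ : M => ℓ²(ι, ℂ)) 2) : inner ℂ (e s) v = v s.2 s.1 := by
    simp [e, lp.inner_single_left]
  have h_orthonormal : Orthonormal ℂ e := by
    rw [orthonormal_iff_ite]
    rintro ⟨p, m⟩ ⟨p', n⟩
    rw [h_inner]
    by_cases hm : m = n
    · subst hm
      by_cases hp : p = p' <;> simp [e, hp]
    · simp [e, hm]
  obtain ⟨B, hB⟩ := exists_hilbertBasis_coe_eq h_orthonormal fun v hv =>
    lp.ext (funext fun m => lp.ext (funext fun p => (h_inner (p, m) v).symm.trans (hv (p, m))))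
  exact ⟨B.repr, fun v p m => by rw [B.repr_apply_apply, hB, h_inner]⟩

/-- The orthonormal basis `f⁻_{p,n}` (on the left summand) and `f⁺_{p,n}` (on the right one) of
the `p`-th weight space, where `N = 2ε`. -/
def fVec (N p : ℤ) : ℕ ⊕ ℕ → HilbT :=
  Sum.elim (fun n => basisNeg n (n + p)) fun n => basisPos (N - n + p) n

theorem embedTensor_single_one {κ κ' : Type*} [DecidableEq κ] [DecidableEq κ'] (s : κ) (t : κ') :
    embedTensor κ κ' (Finsupp.single s 1 ⊗ₜ[ℂ] Finsupp.single t 1) = lp.single 2 (s, t) 1 := by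
  ext r
  simp [embedTensor_single, embed_apply, Finsupp.single_apply, Pi.single_apply, eq_comm]

theorem basisNeg_eq (i : ℕ) (j : ℤ) :
    basisNeg i j = WithLp.toLp 2 (lp.single 2 (i, j) 1, 0) := by
  rw [← embedTensor_single_one, ← map_zero (embedTensor ℤ ℕ)]
  rfl

theorem basisPos_eq (j : ℤ) (i : ℕ) :
    basisPos j i = WithLp.toLp 2 (0, lp.single 2 (j, i) 1) := by
  rw [← embedTensor_single_one, ← map_zero (embedTensor ℕ ℤ)]
  rfl

theorem inner_basisNeg (i : ℕ) (j : ℤ) (v : HilbT) : inner ℂ (basisNeg i j) v = v.fst (i, j) := by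
  rw [basisNeg_eq, WithLp.prod_inner_apply]
  simp [lp.inner_single_left]

theorem inner_basisPos (j : ℤ) (i : ℕ) (v : HilbT) : inner ℂ (basisPos j i) v = v.snd (j, i) := by
  rw [basisPos_eq, WithLp.prod_inner_apply]
  simp [lp.inner_single_left]

theorem orthonormal_fVec (N : ℤ) :
    Orthonormal ℂ fun s : ℤ × (ℕ ⊕ ℕ) => fVec N s.1 s.2 := by
  rw [orthonormal_iff_ite]
  rintro ⟨p, i | i⟩ ⟨p', j | j⟩ <;>
    simp only [fVec, Sum.elim_inl, Sum.elim_inr, inner_basisNeg, inner_basisPos] <;>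
    simp only [basisNeg_eq, basisPos_eq]
  · by_cases h : i = j <;> simp [h, Pi.single_apply]
  · simp
  · simp
  · by_cases h : i = j <;> simp [h, Pi.single_apply]

theorem eq_zero_of_inner_fVec_eq_zero (N : ℤ) {v : HilbT}
    (hv : ∀ s : ℤ × (ℕ ⊕ ℕ), inner ℂ (fVec N s.1 s.2) v = 0) : v = 0 := by
  have h_fst : v.fst = 0 := by
    ext ⟨i, j⟩
    simpa only [fVec, Sum.elim_inl, inner_basisNeg, add_sub_cancel, lp.coeFn_zero,
      Pi.zero_apply] using hv (j - i, Sum.inl i)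
  have h_snd : v.snd = 0 := by
    ext ⟨j, i⟩
    simpa only [fVec, Sum.elim_inr, inner_basisPos, add_sub_cancel, lp.coeFn_zero,
      Pi.zero_apply] using hv (j - (N - i), Sum.inr i)
  exact WithLp.ofLp_injective 2 (Prod.ext h_fst h_snd)

theorem exists_fVec_unitary (N : ℤ) :
    ∃ V : HilbT ≃ₗᵢ[ℂ] ℓ²(ℤ × (ℕ ⊕ ℕ), ℂ), ∀ p i, V (fVec N p i) = lp.single 2 (p, i) 1 := by
  obtain ⟨B, hB⟩ := exists_hilbertBasis_coe_eq (orthonormal_fVec N) fun _ =>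
    eq_zero_of_inner_fVec_eq_zero N
  exact ⟨B.repr, fun p i => by rw [← B.repr_self, hB]⟩

end Unitary

/-! ### The intertwining operator -/

section TensorProduct

variable {q : ℝ} {ι κ V : Type*} [AddCommMonoid V] [Module ℂ V]

/-- The algebraic basis vector `e_i ⊗ e_j`. -/
abbrev basisTmul (i : ι) (j : κ) : (ι →₀ ℂ) ⊗[ℂ] (κ →₀ ℂ) :=
  Finsupp.single i 1 ⊗ₜ[ℂ] Finsupp.single j 1

theorem ext_basisTmul {f g : (ι →₀ ℂ) ⊗[ℂ] (κ →₀ ℂ) →ₗ[ℂ] V}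
    (h : ∀ i j, f (basisTmul i j) = g (basisTmul i j)) : f = g :=
  TensorProduct.ext (Finsupp.lhom_ext' fun i => LinearMap.ext_ring (Finsupp.lhom_ext' fun j =>
    LinearMap.ext_ring (h i j)))

theorem ext_basisTmul_neg {f g : (ℕ →₀ ℂ) ⊗[ℂ] (ℤ →₀ ℂ) →ₗ[ℂ] V}
    (h : ∀ (p : ℤ) (n : ℕ), f (basisTmul n (n + p)) = g (basisTmul n (n + p))) : f = g :=
  ext_basisTmul fun i j => by simpa only [add_sub_cancel] using h (j - i) i

theorem ext_basisTmul_pos (N : ℤ) {f g : (ℤ →₀ ℂ) ⊗[ℂ] (ℕ →₀ ℂ) →ₗ[ℂ] V}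
    (h : ∀ (p : ℤ) (n : ℕ), f (basisTmul (N - n + p) n) = g (basisTmul (N - n + p) n)) : f = g :=
  ext_basisTmul fun j i => by simpa only [add_sub_cancel] using h (j - (N - i)) i

variable (hq : q ≠ 0) (D₁ : WeightData q ι) (D₂ : WeightData q κ) (i : ι) (j : κ)

theorem map_shift_basisTmul (s : ι → ι) (t : κ → κ) (c : ι → ℝ) (d : κ → ℝ) :
    TensorProduct.map (shift s c) (shift t d) (basisTmul i j) =
      ((c i * d j : ℝ) : ℂ) • basisTmul (s i) (t j) := by
  rw [TensorProduct.map_tmul, shift_single, shift_single, one_mul, one_mul,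
    ← Finsupp.smul_single_one, ← Finsupp.smul_single_one (t j), TensorProduct.smul_tmul_smul,
    Complex.ofReal_mul]

theorem tensorRep_comul_K : tensorRep D₁.rep D₂.rep (comul q hq (gen q .K)) (basisTmul i j) =
    ((D₁.κ i * D₂.κ j : ℝ) : ℂ) • basisTmul i j := by
  rw [(comul_gen hq).1, tensorRep_tmul, D₁.rep_K, D₂.rep_K, map_shift_basisTmul]
  rfl

theorem tensorRep_comul_Kinv :
    tensorRep D₁.rep D₂.rep (comul q hq (gen q .Kinv)) (basisTmul i j) =
      (((D₁.κ i)⁻¹ * (D₂.κ j)⁻¹ : ℝ) : ℂ) • basisTmul i j := by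
  rw [(comul_gen hq).2.1, tensorRep_tmul, D₁.rep_Kinv, D₂.rep_Kinv, map_shift_basisTmul]
  rfl

theorem tensorRep_comul_E : tensorRep D₁.rep D₂.rep (comul q hq (gen q .E)) (basisTmul i j) =
    ((D₁.κ i * D₂.c j : ℝ) : ℂ) • basisTmul i (D₂.up j) +
      ((D₁.c i * (D₂.κ j)⁻¹ : ℝ) : ℂ) • basisTmul (D₁.up i) j := by
  rw [(comul_gen hq).2.2.1, map_add, LinearMap.add_apply, tensorRep_tmul, tensorRep_tmul,
    D₁.rep_K, D₂.rep_E, D₁.rep_E, D₂.rep_Kinv, map_shift_basisTmul, map_shift_basisTmul]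
  rfl

theorem tensorRep_comul_F : tensorRep D₁.rep D₂.rep (comul q hq (gen q .F)) (basisTmul i j) =
    ((D₁.κ i * D₂.d j : ℝ) : ℂ) • basisTmul i (D₂.dn j) +
      ((D₁.d i * (D₂.κ j)⁻¹ : ℝ) : ℂ) • basisTmul (D₁.dn i) j := by
  rw [(comul_gen hq).2.2.2, map_add, LinearMap.add_apply, tensorRep_tmul, tensorRep_tmul,
    D₁.rep_K, D₂.rep_F, D₁.rep_F, D₂.rep_Kinv, map_shift_basisTmul, map_shift_basisTmul]
  rfl

end TensorProduct

section Intertwiner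

/-- The `m`-th component of the intertwiner on the algebraic core of the summand
`ℓ²(ℕ) ⊗ ℓ²(ℤ)`. -/
def coreMapNeg (q k₁ k₂ ε : ℝ) (m : ℕ) : (ℕ →₀ ℂ) ⊗[ℂ] (ℤ →₀ ℂ) →ₗ[ℂ] (ℤ →₀ ℂ) :=
  (Finsupp.linearCombination ℂ fun s : ℕ × ℤ =>
      Finsupp.single (s.2 - s.1) (thetaNeg q k₁ k₂ ε (s.2 - s.1) s.1 m : ℂ)) ∘ₗ
    (finsuppTensorFinsupp' ℂ ℕ ℤ).toLinearMap

/-- The `m`-th component of the intertwiner on the algebraic core of the summand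
`ℓ²(ℤ) ⊗ ℓ²(ℕ)`, where `N = 2ε`. -/
def coreMapPos (q k₁ k₂ ε : ℝ) (N : ℤ) (m : ℕ) : (ℤ →₀ ℂ) ⊗[ℂ] (ℕ →₀ ℂ) →ₗ[ℂ] (ℤ →₀ ℂ) :=
  (Finsupp.linearCombination ℂ fun s : ℤ × ℕ =>
      Finsupp.single (s.1 - (N - s.2)) (thetaPos q k₁ k₂ ε (s.1 - (N - s.2)) s.2 m : ℂ)) ∘ₗ
    (finsuppTensorFinsupp' ℂ ℤ ℕ).toLinearMap

variable {q k₁ k₂ ε : ℝ} {N : ℤ}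

theorem coreMapNeg_basisTmul (m n : ℕ) {j p : ℤ} (h : j = n + p) :
    coreMapNeg q k₁ k₂ ε m (basisTmul n j) =
      Finsupp.single p (thetaNeg q k₁ k₂ ε p n m : ℂ) := by
  subst h
  simp [coreMapNeg]

theorem coreMapPos_basisTmul (m n : ℕ) {j p : ℤ} (h : j = N - n + p) :
    coreMapPos q k₁ k₂ ε N m (basisTmul j n) =
      Finsupp.single p (thetaPos q k₁ k₂ ε p n m : ℂ) := by
  subst h
  simp [coreMapPos]

theorem smul_coreMapNeg_basisTmul_pred {n : ℕ} {r : ℝ} (hr : n = 0 → r = 0) (m : ℕ) (p : ℤ) :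
    (r : ℂ) • coreMapNeg q k₁ k₂ ε m (basisTmul (n - 1) ((n : ℤ) + p)) =
      (r : ℂ) • Finsupp.single (p + 1) (thetaNeg q k₁ k₂ ε (p + 1) (n - 1) m : ℂ) := by
  rcases n with _ | n
  · simp [hr rfl]
  · rw [coreMapNeg_basisTmul m _ (p := p + 1) (by push_cast [Nat.add_sub_cancel]; ring)]

theorem smul_coreMapPos_basisTmul_pred {n : ℕ} {r : ℝ} (hr : n = 0 → r = 0) (m : ℕ) (p : ℤ) :
    (r : ℂ) • coreMapPos q k₁ k₂ ε N m (basisTmul (N - n + (p + 1)) (n - 1)) =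
      (r : ℂ) • Finsupp.single p (thetaPos q k₁ k₂ ε p (n - 1) m : ℂ) := by
  rcases n with _ | n
  · simp [hr rfl]
  · rw [coreMapPos_basisTmul m _ (p := p) (by push_cast [Nat.add_sub_cancel]; ring)]

theorem smul_single_add_smul_single {ι : Type*} {i : ι} {r s t x y z : ℝ}
    (h : r * x + s * y = t * z) :
    (r : ℂ) • Finsupp.single i (x : ℂ) + (s : ℂ) • Finsupp.single i (y : ℂ) =
      Finsupp.single i ((z : ℂ) * t) := by
  rw [Finsupp.smul_single, Finsupp.smul_single, ← Finsupp.single_add, smul_eq_mul, smul_eq_mul,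
    mul_comm (z : ℂ)]
  exact_mod_cast congrArg (fun w : ℝ => Finsupp.single i (w : ℂ)) h

variable (hq : q ∈ Set.Ioo (0 : ℝ) 1)

theorem negData_κ_mul_strangeData_κ (h₁ : 0 < k₁) (p : ℤ) (n m : ℕ) :
    (negData q hq k₁ h₁).κ n * (strangeData q hq (k₂ - 1 / 2) (ε + k₂)).κ (n + p) =
      (strangeData q hq (k₁ + k₂ - 1 / 2 + m) (ε - k₁ + k₂)).κ p := by
  simp only [negData, strangeData]
  rw [← Real.rpow_add hq.1]
  push_cast
  ring_nf

theorem strangeData_κ_mul_posData_κ (h₂ : 0 < k₂) (hε : 2 * ε = N) (p : ℤ) (n m : ℕ) :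
    (strangeData q hq (k₁ - 1 / 2) (-ε - k₁)).κ (N - n + p) * (posData q hq k₂ h₂).κ n =
      (strangeData q hq (k₁ + k₂ - 1 / 2 + m) (ε - k₁ + k₂)).κ p := by
  simp only [posData, strangeData]
  rw [← Real.rpow_add hq.1]
  push_cast
  rw [← hε]
  ring_nf

theorem coreMapNeg_comp_gen (h₁ : 0 < k₁) (h₂ : 0 < k₂) (m : ℕ) (g : Gen) :
    coreMapNeg q k₁ k₂ ε m ∘ₗ
        tensorRep (negData q hq k₁ h₁).rep (strangeData q hq (k₂ - 1 / 2) (ε + k₂)).rep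
          (comul q hq.1.ne' (gen q g)) =
      (strangeData q hq (k₁ + k₂ - 1 / 2 + m) (ε - k₁ + k₂)).rep (gen q g) ∘ₗ
        coreMapNeg q k₁ k₂ ε m := by
  refine ext_basisTmul_neg fun p n => ?_
  rw [LinearMap.comp_apply, LinearMap.comp_apply, coreMapNeg_basisTmul m n rfl]
  cases g with
  | K =>
    rw [tensorRep_comul_K, map_smul, coreMapNeg_basisTmul m n rfl, WeightData.rep_K, shift_single,
      negData_κ_mul_strangeData_κ hq h₁ p n m, Finsupp.smul_single, smul_eq_mul, mul_comm, id]
  | Kinv =>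
    rw [tensorRep_comul_Kinv, map_smul, coreMapNeg_basisTmul m n rfl, WeightData.rep_Kinv,
      shift_single, ← mul_inv, negData_κ_mul_strangeData_κ hq h₁ p n m, Finsupp.smul_single,
      smul_eq_mul, mul_comm, id]
  | E =>
    have h_pred : n = 0 → (negData q hq k₁ h₁).c n *
        ((strangeData q hq (k₂ - 1 / 2) (ε + k₂)).κ (n + p))⁻¹ = 0 := by
      rintro rfl
      rw [negData_c_zero, zero_mul]
    rw [tensorRep_comul_E, map_add, map_smul, map_smul, WeightData.rep_E, shift_single]
    refine .trans ?_ (smul_single_add_smul_single (thetaNeg_E hq h₁ h₂ p n m))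
    exact congrArg₂ (· + ·) (congrArg _ (coreMapNeg_basisTmul m n (add_assoc _ _ _)))
      (smul_coreMapNeg_basisTmul_pred h_pred m p)
  | F =>
    obtain ⟨p, rfl⟩ : ∃ p', p = p' + 1 := ⟨p - 1, by ring⟩
    rw [tensorRep_comul_F, map_add, map_smul, map_smul, WeightData.rep_F, shift_single]
    have h_dn : (strangeData q hq (k₁ + k₂ - 1 / 2 + m) (ε - k₁ + k₂)).dn (p + 1) = p :=
      add_sub_cancel_right p 1
    rw [h_dn, ← smul_single_add_smul_single (thetaNeg_F hq h₁ h₂ p n m)]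
    congr 2
    · exact coreMapNeg_basisTmul m n (show (n + (p + 1) - 1 : ℤ) = n + p by ring)
    · exact coreMapNeg_basisTmul m (n + 1) (by push_cast; ring)

theorem coreMapPos_comp_gen (h₁ : 0 < k₁) (h₂ : 0 < k₂) (hε : 2 * ε = N) (m : ℕ) (g : Gen) :
    coreMapPos q k₁ k₂ ε N m ∘ₗ
        tensorRep (strangeData q hq (k₁ - 1 / 2) (-ε - k₁)).rep (posData q hq k₂ h₂).rep
          (comul q hq.1.ne' (gen q g)) =
      (strangeData q hq (k₁ + k₂ - 1 / 2 + m) (ε - k₁ + k₂)).rep (gen q g) ∘ₗ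
        coreMapPos q k₁ k₂ ε N m := by
  refine ext_basisTmul_pos N fun p n => ?_
  rw [LinearMap.comp_apply, LinearMap.comp_apply, coreMapPos_basisTmul m n rfl]
  cases g with
  | K =>
    rw [tensorRep_comul_K, map_smul, coreMapPos_basisTmul m n rfl, WeightData.rep_K, shift_single,
      strangeData_κ_mul_posData_κ hq h₂ hε p n m, Finsupp.smul_single, smul_eq_mul, mul_comm, id]
  | Kinv =>
    rw [tensorRep_comul_Kinv, map_smul, coreMapPos_basisTmul m n rfl, WeightData.rep_Kinv,
      shift_single, ← mul_inv, strangeData_κ_mul_posData_κ hq h₂ hε p n m, Finsupp.smul_single,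
      smul_eq_mul, mul_comm, id]
  | E =>
    rw [tensorRep_comul_E, map_add, map_smul, map_smul, WeightData.rep_E, shift_single]
    refine .trans ?_ (smul_single_add_smul_single (thetaPos_E hq h₁ h₂ hε p n m))
    congr 2
    · exact coreMapPos_basisTmul m (n + 1) (p := p + 1) (by push_cast; ring)
    · exact coreMapPos_basisTmul m n (show (N - n + p + 1 : ℤ) = N - n + (p + 1) by ring)
  | F =>
    obtain ⟨p, rfl⟩ : ∃ p', p = p' + 1 := ⟨p - 1, by ring⟩
    have h_pred : n = 0 → (strangeData q hq (k₁ - 1 / 2) (-ε - k₁)).κ (N - n + (p + 1)) *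
        (posData q hq k₂ h₂).d n = 0 := by
      rintro rfl
      rw [posData_d_zero, mul_zero]
    rw [tensorRep_comul_F, map_add, map_smul, map_smul, WeightData.rep_F, shift_single]
    have h_dn : (strangeData q hq (k₁ + k₂ - 1 / 2 + m) (ε - k₁ + k₂)).dn (p + 1) = p :=
      add_sub_cancel_right p 1
    rw [h_dn, ← smul_single_add_smul_single (thetaPos_F hq h₁ h₂ hε p n m),
      ← smul_coreMapPos_basisTmul_pred h_pred]
    congr 2
    exact coreMapPos_basisTmul m n (show (N - n + (p + 1) - 1 : ℤ) = N - n + p by ring)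

/-- The `m`-th component of the intertwiner on the algebraic core of the domain of `T'`. -/
def coreMap (q k₁ k₂ ε : ℝ) (N : ℤ) (m : ℕ) : CoreT →ₗ[ℂ] (ℤ →₀ ℂ) :=
  (coreMapNeg q k₁ k₂ ε m).coprod (coreMapPos q k₁ k₂ ε N m)

theorem coreMap_comp_gen (h₁ : 0 < k₁) (h₂ : 0 < k₂) (hε : 2 * ε = N) (m : ℕ) (g : Gen) :
    coreMap q k₁ k₂ ε N m ∘ₗ actionT q hq k₁ k₂ h₁ h₂ ε (gen q g) =
      (strangeData q hq (k₁ + k₂ - 1 / 2 + m) (ε - k₁ + k₂)).rep (gen q g) ∘ₗ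
        coreMap q k₁ k₂ ε N m := by
  refine LinearMap.ext fun v => ?_
  have h_neg := LinearMap.congr_fun (coreMapNeg_comp_gen (ε := ε) hq h₁ h₂ m g) v.1
  have h_pos := LinearMap.congr_fun (coreMapPos_comp_gen hq h₁ h₂ hε m g) v.2
  simp only [LinearMap.comp_apply] at h_neg h_pos
  simp only [LinearMap.comp_apply, actionT_apply, coreMap, LinearMap.coprod_apply, map_add, h_neg,
    h_pos]

theorem coreMap_action (h₁ : 0 < k₁) (h₂ : 0 < k₂) (hε : 2 * ε = N) (m : ℕ) (X : Uq q)
    (v : CoreT) :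
    coreMap q k₁ k₂ ε N m (actionT q hq k₁ k₂ h₁ h₂ ε X v) =
      (strangeData q hq (k₁ + k₂ - 1 / 2 + m) (ε - k₁ + k₂)).rep X
        (coreMap q k₁ k₂ ε N m v) := by
  obtain ⟨x, rfl⟩ := RingQuot.mkAlgHom_surjective ℂ (Rel q) X
  induction x using FreeAlgebra.induction generalizing v with
  | grade0 r => simp only [AlgHom.commutes, Module.algebraMap_end_apply, map_smul]
  | grade1 g => exact LinearMap.congr_fun (coreMap_comp_gen hq h₁ h₂ hε m g) v
  | mul a b ha hb => simp only [map_mul, Module.End.mul_apply, ha, hb]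
  | add a b ha hb => simp only [map_add, LinearMap.add_apply, ha, hb]

end Intertwiner

section Theta

variable {q k₁ k₂ ε : ℝ}

/-- The matrix coefficients of the intertwiner, with both families of basis vectors of a weight
space indexed as in `fVec`. -/
def theta (q k₁ k₂ ε : ℝ) (p : ℤ) (i : ℕ ⊕ ℕ) (m : ℕ) : ℝ :=
  Sum.elim (fun n => thetaNeg q k₁ k₂ ε p n m) (fun n => thetaPos q k₁ k₂ ε p n m) i

/-- The sign of the matrix coefficients relative to the big `q`-Jacobi polynomials. -/
def thetaSign (i : ℕ ⊕ ℕ) : ℝ := Sum.elim (fun _ => 1) (fun n => (-1) ^ n) i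

theorem abs_thetaSign (i : ℕ ⊕ ℕ) : |thetaSign i| = 1 := by
  rcases i with i | i <;> simp [thetaSign]

theorem theta_eq (hq : 0 < q) (p : ℤ) (i : ℕ ⊕ ℕ) (m : ℕ) : theta q k₁ k₂ ε p i m =
    thetaSign i * normBigQJacobi (jacksonNode (jacobiA q k₁) (jacobiC q k₁ ε p) (q ^ 2) i) m
      (jacobiA q k₁) (jacobiA q k₂) (jacobiC q k₁ ε p) (q ^ 2) := by
  rcases i with i | i
  · rw [jacksonNode_inl hq]
    exact (one_mul _).symm
  · rw [jacksonNode_inr hq]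
    rfl

theorem hasSum_theta_mul (hq : q ∈ Set.Ioo (0 : ℝ) 1) (h₁ : 0 < k₁) (h₂ : 0 < k₂) (p : ℤ)
    (m n : ℕ) : HasSum (fun i => theta q k₁ k₂ ε p i m * theta q k₁ k₂ ε p i n)
      (if m = n then 1 else 0) := by
  refine ((isBigQJacobiParam_jacobi hq h₁ h₂ ε p).hasSum_normBigQJacobi_mul m n).congr_fun
    fun i => ?_
  rw [theta_eq hq.1, theta_eq hq.1, mul_mul_mul_comm, ← abs_mul_abs_self (thetaSign i),
    abs_thetaSign, one_mul, one_mul]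

theorem eq_zero_of_tsum_theta_mul_eq_zero (hq : q ∈ Set.Ioo (0 : ℝ) 1) (h₁ : 0 < k₁)
    (h₂ : 0 < k₂) (p : ℤ) (g : ℕ ⊕ ℕ → ℂ) (hg : Summable fun i => ‖g i‖ ^ 2)
    (h_orth : ∀ m, ∑' i, (theta q k₁ k₂ ε p i m : ℂ) * g i = 0) (i : ℕ ⊕ ℕ) : g i = 0 := by
  have h := (isBigQJacobiParam_jacobi hq h₁ h₂ ε p).eq_zero_of_tsum_normBigQJacobi_mul_eq_zero
    (g := fun i => (thetaSign i : ℂ) * g i) (hg.congr fun i => by simp [abs_thetaSign])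
    (fun m => (tsum_congr fun i => by rw [theta_eq hq.1]; push_cast; ring).trans (h_orth m)) i
  have h_sign : thetaSign i ≠ 0 := abs_ne_zero.1 (by simp [abs_thetaSign])
  exact (mul_eq_zero.1 h).resolve_left (Complex.ofReal_ne_zero.2 h_sign)

theorem exists_unitary (hq : q ∈ Set.Ioo (0 : ℝ) 1) (h₁ : 0 < k₁) (h₂ : 0 < k₂) (N : ℤ) :
    ∃ U : HilbT ≃ₗᵢ[ℂ] lp (fun _ : ℕ => ℓ²(ℤ, ℂ)) 2, ∀ p i m,
      (U (fVec N p i) : ℕ → ℓ²(ℤ, ℂ)) m =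
        (theta q k₁ k₂ ε p i m : ℂ) • embed ℤ (Finsupp.single p 1) := by
  obtain ⟨V, hV⟩ := exists_fVec_unitary N
  obtain ⟨U, hU⟩ := exists_unitary_of_fibres (θ := theta q k₁ k₂ ε)
    (hasSum_theta_mul hq h₁ h₂) (eq_zero_of_tsum_theta_mul_eq_zero hq h₁ h₂)
  obtain ⟨W, hW⟩ := exists_curry_unitary ℤ ℕ
  refine ⟨V.trans (U.trans W.symm), fun p i m => ?_⟩
  ext s
  rw [← hW, LinearIsometryEquiv.trans_apply, LinearIsometryEquiv.trans_apply,
    LinearIsometryEquiv.apply_symm_apply, hV, hU, lp.coeFn_smul, Pi.smul_apply, embed_apply,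
    Finsupp.single_apply]
  by_cases h : s = p
  · simp [h]
  · simp [h, Ne.symm h]

end Theta

section Intertwines

theorem StarRep.ofCore_action {q : ℝ} {V H : Type*} [AddCommMonoid V] [Module ℂ V]
    [NormedAddCommGroup H] [InnerProductSpace ℂ H] (π : Uq q →ₐ[ℂ] Module.End ℂ V)
    (j : V →ₗ[ℂ] H) (hj : Function.Injective j) (hd : DenseRange j) (hK) (hE) (X : Uq q) (v : V)
    (x : H) (hx : x = j v) (h : x ∈ (StarRep.ofCore π j hj hd hK hE).domain) :
    ((StarRep.ofCore π j hj hd hK hE).action X ⟨x, h⟩ : H) = j (π X v) := by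
  subst hx
  have h_symm : (LinearEquiv.ofInjective j hj).symm ⟨j v, h⟩ = v :=
    (LinearEquiv.symm_apply_eq _).2 rfl
  change j (π X ((LinearEquiv.ofInjective j hj).symm ⟨j v, h⟩)) = _
  rw [h_symm]

variable {q k₁ k₂ ε : ℝ} {N : ℤ} {U : HilbT ≃ₗᵢ[ℂ] lp (fun _ : ℕ => ℓ²(ℤ, ℂ)) 2}
  (hU : ∀ p i m, (U (fVec N p i) : ℕ → ℓ²(ℤ, ℂ)) m =
    (theta q k₁ k₂ ε p i m : ℂ) • embed ℤ (Finsupp.single p 1))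
include hU

theorem apply_embedT_eq_embed_coreMap (m : ℕ) (v : CoreT) :
    (U (embedT v) : ℕ → ℓ²(ℤ, ℂ)) m = embed ℤ (coreMap q k₁ k₂ ε N m v) := by
  let component : lp (fun _ : ℕ => ℓ²(ℤ, ℂ)) 2 →ₗ[ℂ] ℓ²(ℤ, ℂ) :=
    { toFun := fun φ => φ m, map_add' := fun _ _ => rfl, map_smul' := fun _ _ => rfl }
  suffices component ∘ₗ U.toLinearEquiv.toLinearMap ∘ₗ embedT =
    embed ℤ ∘ₗ coreMap q k₁ k₂ ε N m from LinearMap.congr_fun this v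
  refine LinearMap.prod_ext (ext_basisTmul_neg fun p n => ?_) (ext_basisTmul_pos N fun p n => ?_)
  · refine (hU p (Sum.inl n) m).trans ?_
    simp [theta, coreMap, coreMapNeg_basisTmul m n rfl, ← map_smul]
  · refine (hU p (Sum.inr n) m).trans ?_
    simp [theta, coreMap, coreMapPos_basisTmul m n rfl, ← map_smul]

theorem intertwines_of_apply_fVec (hq : q ∈ Set.Ioo (0 : ℝ) 1) (h₁ : 0 < k₁) (h₂ : 0 < k₂)
    (hε : 2 * ε = N) :
    (repT q hq k₁ k₂ h₁ h₂ ε).Intertwines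
      (StarRep.directSum fun m : ℕ =>
        (strangeData q hq (k₁ + k₂ - 1 / 2 + m) (ε - k₁ + k₂)).starRep) U := by
  rintro ⟨_, v, rfl⟩
  have h_mem (m : ℕ) : (U (embedT v) : ℕ → ℓ²(ℤ, ℂ)) m ∈
      ((strangeData q hq (k₁ + k₂ - 1 / 2 + m) (ε - k₁ + k₂)).starRep).domain :=
    ⟨_, (apply_embedT_eq_embed_coreMap hU m v).symm⟩
  have h_action (X : Uq q) (m : ℕ) :
      (((strangeData q hq (k₁ + k₂ - 1 / 2 + m) (ε - k₁ + k₂)).starRep).action X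
        ⟨_, h_mem m⟩ : ℓ²(ℤ, ℂ)) =
      (U (embedT (actionT q hq k₁ k₂ h₁ h₂ ε X v)) : ℕ → ℓ²(ℤ, ℂ)) m := by
    refine (StarRep.ofCore_action _ _ _ _ _ _ X _ _ (apply_embedT_eq_embed_coreMap hU m v)
      _).trans ?_
    rw [apply_embedT_eq_embed_coreMap hU, coreMap_action hq h₁ h₂ hε]
  have h_repT (X : Uq q) : ((repT q hq k₁ k₂ h₁ h₂ ε).action X ⟨embedT v, v, rfl⟩ : HilbT) =
      embedT (actionT q hq k₁ k₂ h₁ h₂ ε X v) :=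
    StarRep.ofCore_action _ _ _ _ _ _ X v _ rfl _
  refine ⟨⟨h_mem, fun X => ?_⟩, fun X => ?_⟩
  · rw [funext (h_action X)]
    exact lp.memℓp _
  · rw [h_repT]
    exact lp.ext (funext (h_action X))

end Intertwines

end SU11

end

theorem theorem3p5 (q : ℝ) (hq : q ∈ Set.Ioo (0 : ℝ) 1) (k₁ k₂ : ℝ) (h₁ : 0 < k₁) (h₂ : 0 < k₂)
    (ε : ℝ) (N : ℤ) (hε : 2 * ε = N) :
    ∃ U : SU11.HilbT ≃ₗᵢ[ℂ] lp (fun _ : ℕ => ℓ²(ℤ, ℂ)) 2,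
      (SU11.repT q hq k₁ k₂ h₁ h₂ ε).Intertwines
        (SU11.StarRep.directSum fun m : ℕ =>
          (SU11.strangeData q hq (k₁ + k₂ - 1 / 2 + m) (ε - k₁ + k₂)).starRep) U ∧
      (∀ (p : ℤ) (n m : ℕ), (U (SU11.basisNeg n (n + p)) : ℕ → ℓ²(ℤ, ℂ)) m =
        (SU11.thetaNeg q k₁ k₂ ε p n m : ℂ) • SU11.embed ℤ (Finsupp.single p 1)) ∧
      (∀ (p : ℤ) (n m : ℕ), (U (SU11.basisPos (N - n + p) n) : ℕ → ℓ²(ℤ, ℂ)) m =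
        (SU11.thetaPos q k₁ k₂ ε p n m : ℂ) • SU11.embed ℤ (Finsupp.single p 1)) := by
  obtain ⟨U, hU⟩ := SU11.exists_unitary (ε := ε) hq h₁ h₂ N
  exact ⟨U, SU11.intertwines_of_apply_fVec hU hq h₁ h₂ hε,
    fun p n m => hU p (Sum.inl n) m, fun p n m => hU p (Sum.inr n) m⟩
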